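/- **Setting.** Let $X$ be a centred, square integrable, measurable stochastic process on $[0,1]$ with covariance function $C(s,t)=\mathbb E\{X(s)X(t)\}$, and let $X_1,X_2,\dots$ be i.i.d. copies of $X$. One observes $X_{il}=X_i(T_{il})+\varepsilon_{il}$ for $1\le i\le n$ and $1\le l\le N$, where the $T_{il}$ are i.i.d. uniform on $[0,1]$, the $\varepsilon_{il}$ are i.i.d. with mean $0$ and variance $\sigma_X^2$, and the processes, the sampling points and the errors are mutually independent. For a bandwidth $h>0$ and a kernel $\mathrm K$ let $$\hat C(s,t)=\frac1n\sum_{i=1}^n\frac{1}{N(N-1)}\frac1{h^2}\sum_{1\le l\ne m\le N}\mathrm K_h(T_{il}-s)\,\mathrm K_h(T_{im}-t)\,X_{il}X_{im},\qquad \mathrm K_h(x)=\sum_{z\in\mathbb Z}\mathrm K\Big(\frac{x+z}{h}\Big),$$ that is, the pooled local constant kernel estimator with weights $\mathrm K((T-s)/h)$, where differences of points of $[0,1]$ are read modulo $1$. Put $\Delta=\hat C-C$ and $\langle\Delta\phi_j,\phi_k\rangle=\iint_{[0,1]^2}\Delta(s,t)\phi_j(s)\phi_k(t)\,ds\,dt$.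 **Assumptions.** - (A.1) $\int_0^1\mathbb E X^4(t)\,dt<\infty$, $\sigma_X^2<\infty$, and $\mathbb E\xi_j^4\lesssim\lambda_j^2$ for all $j\ge1$, where $\xi_j=\int_0^1X(t)\phi_j(t)\,dt$. - (A.2) $C(s,t)=\sum_{k\ge1}\lambda_k\phi_k(s)\phi_k(t)$ on $[0,1]^2$, where $(\phi_k)_{k\ge1}$ is a complete orthonormal system of $L^2[0,1]$, $\lambda_k>0$, and for some $a>1$ and some constant $A>0$, $A j^{-a}\ge\lambda_j\ge\lambda_{j+1}+(a/A)j^{-a-1}$ for all $j\ge1$. - (A.3) The $\phi_j$ are twice differentiable on $[0,1]$, $\sup_j\sup_t|\phi_j(t)|<\infty$, and, for some $c>0$, $\sup_t|\phi_j^{(r)}(t)|\lesssim j^{c/2}\sup_t|\phi_j^{(r-1)}(t)|$ for $r=1,2$ and all $j\ge1$; moreover $\phi_j(0)=\phi_j(1)$ and $\phi_j^{(1)}(0)=\phi_j^{(1)}(1)$. - (K.1) $\mathrm K$ is a bounded symmetric probability density on $[-1,1]$. **Theorem.** For every $M$ there is a constant $A'$, not depending on $n,N,j,k,h$, such that for all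 $n\ge1$, $N\ge2$, $j\ge1$, $h>0$ with $h^4j^{2a+2c}\le M$: the variables $\langle\Delta\phi_j,\phi_k\rangle$ are square integrable; for all $1\le k\le2j$, $$\mathbb E\langle\Delta\phi_j,\phi_k\rangle^2\le A'\Big\{\frac1n\Big(j^{-a}k^{-a}+\frac{j^{-a}+k^{-a}}N+\frac1{N^2}\Big)+h^4k^{2c-2a}\Big\};$$ and the following series converges, with $$\sum_{k=j+1}^\infty\mathbb E\langle\Delta\phi_j,\phi_k\rangle^2\le A'\Big\{\frac1n\Big(j^{1-2a}+\frac{h^{-1}j^{-a}+j^{1-a}}N+\frac1{hN^2}\Big)+h^4j^{1+2c-2a}\Big\}.$$ -/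

import Mathlib

open MeasureTheory ProbabilityTheory Finset
open scoped unitInterval

noncomputable section

namespace DiscreteFPCA

/-- A bounded symmetric probability density on `[-1, 1]`. -/
structure IsKernel (K : ℝ → ℝ) : Prop where
  measurable : Measurable K
  nonneg : ∀ u, 0 ≤ K u
  bounded : ∃ B : ℝ, ∀ u, K u ≤ B
  symm : ∀ u, K (-u) = K u
  support : ∀ u, 1 < |u| → K u = 0
  integral_eq_one : ∫ u, K u = 1

/-- The kernel weight `K (x / h)` with the difference `x` of two points of `[0, 1]` read modulo `1`:
the end points `0` and `1` are identified, in accordance with the periodic boundary conditions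
imposed on the eigenfunctions (see `SmoothEigenfunctions`), so that smoothing has no edge effect.
The sum has only finitely many nonzero terms when `K` is supported in `[-1, 1]` and `0 < h`. -/
def kernelWeight (K : ℝ → ℝ) (h x : ℝ) : ℝ :=
  ∑' z : ℤ, K ((x + z) / h)

/-- Farther than `h` from the end points, the weight is the usual `K ((t - s) / h)`. -/
theorem kernelWeight_eq_of_interior {K : ℝ → ℝ} (hK : IsKernel K) {h s t : ℝ} (hh : 0 < h)
    (hs : h < s) (hs' : s < 1 - h) (ht : 0 ≤ t) (ht' : t ≤ 1) :
    kernelWeight K h (t - s) = K ((t - s) / h) := by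
  unfold kernelWeight
  rw [tsum_eq_single (0 : ℤ)]
  · simp
  · intro z hz
    apply hK.support
    rw [abs_div, abs_of_pos hh, lt_div_iff₀ hh, one_mul]
    rcases lt_or_gt_of_ne hz with hz | hz
    · have h1 : (z : ℝ) ≤ -1 := by exact_mod_cast (by omega : z ≤ -1)
      exact lt_abs.2 (Or.inr (by linarith))
    · have h1 : (1 : ℝ) ≤ z := by exact_mod_cast (by omega : 1 ≤ z)
      exact lt_abs.2 (Or.inl (by linarith))

variable {Ω : Type*} [MeasurableSpace Ω]

/-- The observation `X_{il} = X_i (T_{il}) + ε_{il}`. -/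
def obs (X : ℕ → Ω → I → ℝ) (T : ℕ → ℕ → Ω → I) (ε : ℕ → ℕ → Ω → ℝ) (i l : ℕ) (ω : Ω) : ℝ :=
  X i ω (T i l ω) + ε i l ω

/-- The pooled local constant kernel estimator of the covariance function, from the
observations `l < N` of the subjects `i < n`, with bandwidth `h`. -/
def covEstimator (K : ℝ → ℝ) (X : ℕ → Ω → I → ℝ) (T : ℕ → ℕ → Ω → I) (ε : ℕ → ℕ → Ω → ℝ)
    (n N : ℕ) (h : ℝ) (ω : Ω) (s t : I) : ℝ :=
  (1 / (n : ℝ)) * ∑ i ∈ range n,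
    (1 / ((N : ℝ) * ((N : ℝ) - 1))) * (1 / h ^ 2) *
      ∑ l ∈ range N, ∑ m ∈ (range N).erase l,
        kernelWeight K h ((T i l ω : ℝ) - s) * kernelWeight K h ((T i m ω : ℝ) - t) *
          (obs X T ε i l ω * obs X T ε i m ω)

/-- The covariance function `C (s, t)` of a process on `[0, 1]`. -/
def covFun (P : Measure Ω) (Y : Ω → I → ℝ) (s t : I) : ℝ :=
  covariance (fun ω => Y ω s) (fun ω => Y ω t) P

/-- `⟨A p, q⟩ = ∬ A (s, t) p (s) q (t) ds dt` over the unit square. -/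
def bilin (A : I → I → ℝ) (p q : ℝ → ℝ) : ℝ :=
  ∫ t : I, (∫ s : I, A s t * p s) * q t

/-- `⟨Δ φ_j, φ_k⟩`, where `Δ` is the estimation error of the covariance function. -/
def errorCoeff (P : Measure Ω) (K : ℝ → ℝ) (X : ℕ → Ω → I → ℝ) (T : ℕ → ℕ → Ω → I)
    (ε : ℕ → ℕ → Ω → ℝ) (φ : ℕ → ℝ → ℝ) (n N : ℕ) (h : ℝ) (j k : ℕ) (ω : Ω) : ℝ :=
  bilin (fun s t => covEstimator K X T ε n N h ω s t - covFun P (X 0) s t) (φ j) (φ k)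

/-- The score `ξ_k = ∫ Y (t) φ_k (t) dt` of a centred process. -/
def score (Y : Ω → I → ℝ) (φ : ℕ → ℝ → ℝ) (k : ℕ) (ω : Ω) : ℝ :=
  ∫ t : I, Y ω t * φ k t

/-- The sampling model: `X_i` are i.i.d. centred square integrable processes on `[0, 1]`, the
`T_{il}` are i.i.d. uniform on `[0, 1]`, the `ε_{il}` are i.i.d. with mean zero and finite variance,
and the processes, the sampling points and the errors are mutually independent. -/
structure IsSamplingModel (P : Measure Ω) (X : ℕ → Ω → I → ℝ) (T : ℕ → ℕ → Ω → I)
    (ε : ℕ → ℕ → Ω → ℝ) : Prop where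
  measurable_X : ∀ i, Measurable (X i)
  /-- Each process is a measurable process with respect to the σ-algebra that it generates, which
  makes `X_i (T_{il})` a function of the pair formed by the path `X_i` and the point `T_{il}`. -/
  jointly_measurable_X : ∀ i, ∃ g : (I → ℝ) × I → ℝ, Measurable g ∧ ∀ ω t, X i ω t = g (X i ω, t)
  identDistrib_X : ∀ i, IdentDistrib (X i) (X 0) P P
  iIndepFun_X : iIndepFun X P
  memLp_X : ∀ t, MemLp (fun ω => X 0 ω t) 2 P
  mean_X : ∀ t, ∫ ω, X 0 ω t ∂P = 0
  measurable_T : ∀ i l, Measurable (T i l)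
  uniform_T : ∀ i l, P.map (T i l) = volume
  iIndepFun_T : iIndepFun (fun p : ℕ × ℕ => T p.1 p.2) P
  measurable_ε : ∀ i l, Measurable (ε i l)
  identDistrib_ε : ∀ i l, IdentDistrib (ε i l) (ε 0 0) P P
  iIndepFun_ε : iIndepFun (fun p : ℕ × ℕ => ε p.1 p.2) P
  memLp_ε : MemLp (ε 0 0) 2 P
  mean_ε : ∫ ω, ε 0 0 ω ∂P = 0
  indep_T_ε : IndepFun (fun ω (p : ℕ × ℕ) => T p.1 p.2 ω) (fun ω (p : ℕ × ℕ) => ε p.1 p.2 ω) P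
  indep_X_Tε : IndepFun (fun ω (i : ℕ) => X i ω)
    (fun ω => ((fun p : ℕ × ℕ => T p.1 p.2 ω), (fun p : ℕ × ℕ => ε p.1 p.2 ω))) P

/-- `φ_1, φ_2, …` is a complete orthonormal system of `L² [0, 1]` and `C` has the expansion
`C (s, t) = ∑_{k ≥ 1} λ_k φ_k (s) φ_k (t)` with `λ_k > 0`. Index `0` is not used. -/
structure IsEigenExpansion (C : I → I → ℝ) (lam : ℕ → ℝ) (φ : ℕ → ℝ → ℝ) : Prop where
  pos : ∀ j, 1 ≤ j → 0 < lam j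
  memLp : ∀ j, 1 ≤ j → MemLp (fun t : I => φ j t) 2
  norm_eq_one : ∀ j, 1 ≤ j → ∫ t : I, φ j t ^ 2 = 1
  orthogonal : ∀ j k, 1 ≤ j → 1 ≤ k → j ≠ k → ∫ t : I, φ j t * φ k t = 0
  complete : ∀ f : I → ℝ, MemLp f 2 → (∀ j, 1 ≤ j → ∫ t : I, f t * φ j t = 0) →
    f =ᵐ[volume] 0
  hasSum : ∀ s t : I, HasSum (fun k : ℕ => lam (k + 1) * φ (k + 1) s * φ (k + 1) t) (C s t)

/-- Fourth moment conditions: `∫ E X⁴ < ∞` and `E ξ_j⁴ ≲ λ_j²`. -/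
def FourthMoments (P : Measure Ω) (Y : Ω → I → ℝ) (lam : ℕ → ℝ) (φ : ℕ → ℝ → ℝ) : Prop :=
  (∫⁻ t : I, ∫⁻ ω, ‖Y ω t‖ₑ ^ 4 ∂P) < ⊤ ∧
  ∃ A : ℝ, ∀ j, 1 ≤ j →
    Integrable (fun ω => score Y φ j ω ^ 4) P ∧ ∫ ω, score Y φ j ω ^ 4 ∂P ≤ A * lam j ^ 2

/-- Polynomial decay of the eigenvalues and of their gaps. -/
def PolynomialDecay (a : ℝ) (lam : ℕ → ℝ) : Prop :=
  ∃ A : ℝ, 0 < A ∧ ∀ j : ℕ, 1 ≤ j →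
    lam j ≤ A * (j : ℝ) ^ (-a) ∧ lam (j + 1) + a / A * (j : ℝ) ^ (-a - 1) ≤ lam j

/-- The derivative of order `r` on `[0, 1]`, one-sided at the end points. -/
def deriv01 (r : ℕ) (f : ℝ → ℝ) : ℝ → ℝ :=
  iteratedDerivWithin r f (Set.Icc 0 1)

/-- The eigenfunctions are uniformly bounded and twice differentiable on `[0, 1]`, each derivative
costs a factor of order `j ^ (c / 2)`, and `φ_j`, `φ_j'` satisfy periodic boundary conditions. -/
structure SmoothEigenfunctions (c : ℝ) (φ : ℕ → ℝ → ℝ) : Prop where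
  bounded : ∃ A : ℝ, ∀ j, 1 ≤ j → ∀ t : I, |φ j t| ≤ A
  differentiable : ∀ j, 1 ≤ j → ∀ r < 2,
    DifferentiableOn ℝ (deriv01 r (φ j)) (Set.Icc 0 1)
  deriv_bound : ∃ A : ℝ, ∀ j : ℕ, 1 ≤ j → ∀ r < 2, ∀ t : I,
    |deriv01 (r + 1) (φ j) t| ≤ A * (j : ℝ) ^ (c / 2) * ⨆ s : I, |deriv01 r (φ j) s|
  boundary : ∀ j, 1 ≤ j → φ j 0 = φ j 1
  boundary_deriv : ∀ j, 1 ≤ j → deriv01 1 (φ j) 0 = deriv01 1 (φ j) 1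

end DiscreteFPCA

end

namespace DiscreteFPCA

/-! ### The smoothing operator on the circle -/

section Kernel

/-! Let `S` be convolution on the circle with the kernel K_h / h, let ψ_k = S φ_k be the smoothed
eigenfunctions (`smoothEigen`), and let e_{jk} = ⟨ψ_j - φ_j, φ_k⟩ (`smoothError`). Pairing the
estimator with φ_j and φ_k moves the two kernels onto the eigenfunctions. Hence ⟨Ĉ φ_j, φ_k⟩ is an
average over the subjects of independent off-diagonal double sums U_i of ψ_j(T_l) X_l ψ_k(T_m) X_m,
divided by N(N-1). The mean squared error is at most E U² / n plus twice the squared bias ⟨C ψ_j,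
ψ_k⟩ - ⟨C φ_j, φ_k⟩ (`integral_errorCoeff_sq_le`).

Variance. Given the path x, the pairs (T_l, ε_l) are independent. Splitting the indices into two
complementary sets decouples the double sum (`sum_powerset_mul_sum_sdiff`) and gives E(U² | x) ≤ 64
m(ψ_j, x) m(ψ_k, x), where m(p, x) = N⁻¹ ∫ p² (x² + σ²) + (∫ x p)² is `pathMoment`. By
Cauchy–Schwarz over the paths only L² norms of m are needed. The fourth moment condition bounds the
norm of ξ_k² by a multiple of k^{-a}, and the bandwidth condition absorbs the smoothing error, so
the norm of m(ψ_k, X) is of order 1/N + k^{-a} for k ≤ 2j.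

For the tail, m(ψ_k, X) is summed over k > j before the norm is taken. In the first part, Bessel's
inequality for the kernel gives ∑ ψ_k(t)² ≲ 1/h. In the second, the path is split into its first j
components, which meet φ_k, k > j, only through the errors e_{rk}, and a remainder, which Bessel's
inequality and the L² contractivity of `S` bound by its own squared norm. Minkowski's inequality
makes the latter of order j^{1-a}. The norm of the sum is thus of order 1/(hN) + j^{1-a}.

Bias. In the eigenbasis C is diagonal and ⟨ψ_j, φ_r⟩ = δ_{jr} + e_{jr}, so the bias is (λ_j + λ_k)
e_{jk} + ∑_r λ_r e_{jr} e_{kr}. A Taylor expansion of the periodic extension bounds ψ_j - φ_j by a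
multiple of h² j^c. Bessel's inequality turns this into ∑_k e_{jk}² ≲ h⁴ j^{2c}. The matrix e is
symmetric, and the bandwidth condition makes the quadratic term no larger than the linear one
requires. -/

theorem integral_unitInterval (f : ℝ → ℝ) : ∫ t : I, f t = ∫ x in (0 : ℝ)..1, f x := by
  rw [intervalIntegral.integral_of_le zero_le_one, ← integral_Icc_eq_integral_Ioc]
  exact integral_subtype measurableSet_Icc f

variable {K : ℝ → ℝ} {h : ℝ}

theorem abs_sub_coe_le_one (t s : I) : |(t : ℝ) - s| ≤ 1 := by
  rw [abs_le]
  constructor <;> linarith [t.2.1, t.2.2, s.2.1, s.2.2]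

/-- A shift with |z| ≥ Z + 1 moves x to distance at least Z > h from the origin. The series thus
becomes one finite sum over a range that is uniform in x. -/
theorem IsKernel.eq_zero_of_notMem (hK : IsKernel K) (hh : 0 < h) {x : ℝ} (hx : |x| ≤ 1) {Z : ℕ}
    (hZ : h < Z) {z : ℤ} (hz : z ∉ Finset.Icc (-(Z : ℤ)) Z) : K ((x + z) / h) = 0 := by
  apply hK.support
  rw [abs_div, abs_of_pos hh, lt_div_iff₀ hh, one_mul]
  rw [abs_le] at hx
  rw [Finset.mem_Icc, not_and_or] at hz
  rcases hz with hz | hz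
  · have h1 : (z : ℝ) + 1 ≤ -Z := by exact_mod_cast (by omega : z + 1 ≤ -(Z : ℤ))
    exact lt_abs.2 (Or.inr (by linarith))
  · have h1 : (Z : ℝ) + 1 ≤ z := by exact_mod_cast (by omega : (Z : ℤ) + 1 ≤ z)
    exact lt_abs.2 (Or.inl (by linarith))

theorem IsKernel.kernelWeight_eq_sum (hK : IsKernel K) (hh : 0 < h) {x : ℝ} (hx : |x| ≤ 1) {Z : ℕ}
    (hZ : h < Z) :
    kernelWeight K h x = ∑ z ∈ Finset.Icc (-(Z : ℤ)) Z, K ((x + z) / h) :=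
  tsum_eq_sum fun _ hz => hK.eq_zero_of_notMem hh hx hZ hz

theorem IsKernel.kernelWeight_nonneg (hK : IsKernel K) (x : ℝ) : 0 ≤ kernelWeight K h x :=
  tsum_nonneg fun _ => hK.nonneg _

theorem IsKernel.kernelWeight_neg (hK : IsKernel K) (x : ℝ) :
    kernelWeight K h (-x) = kernelWeight K h x := by
  unfold kernelWeight
  rw [← (Equiv.neg ℤ).tsum_eq]
  refine tsum_congr fun z => ?_
  rw [← hK.symm]
  congr 1
  simp only [Equiv.neg_apply]
  push_cast
  ring

theorem IsKernel.kernelWeight_le (hK : IsKernel K) (hh : 0 < h) {B : ℝ} (hB : ∀ u, K u ≤ B) {x : ℝ}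
    (hx : |x| ≤ 1) : kernelWeight K h x ≤ B * (2 * h + 3) := by
  have hB0 : 0 ≤ B := (hK.nonneg 0).trans (hB 0)
  have hZ : h < (⌊h⌋₊ + 1 : ℕ) := by exact_mod_cast Nat.lt_floor_add_one h
  rw [hK.kernelWeight_eq_sum hh hx hZ]
  refine (Finset.sum_le_card_nsmul _ _ B fun z _ => hB _).trans ?_
  rw [nsmul_eq_mul, mul_comm]
  refine mul_le_mul_of_nonneg_left ?_ hB0
  have h1 : (#(Finset.Icc (-((⌊h⌋₊ + 1 : ℕ) : ℤ)) (⌊h⌋₊ + 1 : ℕ))) = 2 * (⌊h⌋₊ + 1) + 1 := by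
    rw [Int.card_Icc]; omega
  rw [h1]
  push_cast
  linarith [Nat.floor_le hh.le]

/-- The normalised kernel `K_h (t - s) / h` of the smoothing operator on `[0, 1]`. -/
noncomputable def smoothKernel (K : ℝ → ℝ) (h : ℝ) (t s : I) : ℝ :=
  h⁻¹ * kernelWeight K h ((t : ℝ) - s)

/-- The smoothing operator with kernel `smoothKernel`. -/
noncomputable def smooth (K : ℝ → ℝ) (h : ℝ) (f : I → ℝ) (t : I) : ℝ :=
  ∫ s : I, smoothKernel K h t s * f s

theorem IsKernel.smoothKernel_nonneg (hK : IsKernel K) (hh : 0 < h) (t s : I) :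
    0 ≤ smoothKernel K h t s :=
  mul_nonneg (inv_nonneg.2 hh.le) (hK.kernelWeight_nonneg _)

theorem IsKernel.smoothKernel_comm (hK : IsKernel K) (t s : I) :
    smoothKernel K h t s = smoothKernel K h s t := by
  unfold smoothKernel
  rw [← hK.kernelWeight_neg, neg_sub]

/-- At most 2⌊h⌋ + 3 shifts contribute to the weight. This number is bounded only for bounded h,
which is why an upper limit on the bandwidth appears. -/
theorem IsKernel.exists_smoothKernel_le (hK : IsKernel K) (M : ℝ) :
    ∃ C : ℝ, 0 < C ∧ ∀ h : ℝ, 0 < h → h ≤ M → ∀ t s : I, smoothKernel K h t s ≤ C * h⁻¹ := by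
  obtain ⟨B, hB⟩ := hK.bounded
  have hB0 : 0 ≤ B := (hK.nonneg 0).trans (hB 0)
  refine ⟨(B + 1) * (2 * |M| + 3), by positivity, fun h hh hM t s => ?_⟩
  unfold smoothKernel
  rw [mul_comm]
  refine mul_le_mul_of_nonneg_right ?_ (inv_nonneg.2 hh.le)
  refine (hK.kernelWeight_le hh hB (abs_sub_coe_le_one t s)).trans ?_
  have := hM.trans (le_abs_self M)
  gcongr
  linarith

theorem IsKernel.measurable_smoothKernel (hK : IsKernel K) (hh : 0 < h) :
    Measurable (Function.uncurry (smoothKernel K h)) := by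
  have hZ : h < (⌊h⌋₊ + 1 : ℕ) := by exact_mod_cast Nat.lt_floor_add_one h
  have h1 : Function.uncurry (smoothKernel K h) = fun p : I × I =>
      h⁻¹ * ∑ z ∈ Finset.Icc (-((⌊h⌋₊ + 1 : ℕ) : ℤ)) (⌊h⌋₊ + 1 : ℕ),
        K (((p.1 : ℝ) - p.2 + z) / h) := by
    funext p
    simp only [Function.uncurry, smoothKernel]
    rw [hK.kernelWeight_eq_sum hh (abs_sub_coe_le_one p.1 p.2) hZ]
  rw [h1]
  refine Measurable.const_mul (Finset.measurable_sum _ fun z _ => hK.measurable.comp ?_) _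
  fun_prop

theorem IsKernel.measurable_smoothKernel_left (hK : IsKernel K) (hh : 0 < h) (t : I) :
    Measurable (smoothKernel K h t) :=
  (hK.measurable_smoothKernel hh).comp measurable_prodMk_left

/-- The integral of a nonintegrable function is 0 by convention, which contradicts total mass one.
-/
theorem IsKernel.integrable (hK : IsKernel K) : Integrable K := by
  by_contra hn
  have := hK.integral_eq_one
  rw [integral_undef hn] at this
  exact zero_ne_one this

/-- Unfolding: smoothing on the circle is convolution on the line with the periodic extension. -/
theorem IsKernel.integral_smoothKernel_mul (hK : IsKernel K) (hh : 0 < h) {F : ℝ → ℝ} {b : ℝ}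
    (hFm : Measurable F) (hFb : ∀ x, |F x| ≤ b) (hFp : ∀ x (n : ℤ), F (x + n) = F x) (t : I) :
    ∫ s : I, smoothKernel K h t s * F s = ∫ u, K u * F (t - h * u) := by
  have hZ : h < (⌊h⌋₊ + 1 : ℕ) := by exact_mod_cast Nat.lt_floor_add_one h
  set S := Finset.Icc (-((⌊h⌋₊ + 1 : ℕ) : ℤ)) (⌊h⌋₊ + 1 : ℕ) with hS
  let w : ℝ → ℝ := fun y => K ((t - y) / h) * F y
  have hKi : Integrable fun y : ℝ => K ((t - y) / h) := by
    have h1 : Integrable fun y : ℝ => K (y / h) := hK.integrable.comp_div hh.ne'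
    exact h1.comp_sub_left t
  have hw : Integrable w :=
    hKi.mul_bdd (c := b) hFm.aestronglyMeasurable (Filter.Eventually.of_forall hFb)
  -- Substitution y = t - h u.
  have h2 : ∫ u, K u * F (t - h * u) = h⁻¹ * ∫ y, w y := by
    have h3 : (fun u : ℝ => K u * F (t - h * u)) = fun u => (fun v => w (t - v)) (h * u) := by
      funext u
      simp only [w]
      congr 2
      field_simp
      ring
    rw [h3, Measure.integral_comp_mul_left (fun v => w (t - v)) h, integral_sub_left_eq_self w,
      abs_of_pos (inv_pos.2 hh), smul_eq_mul]
  -- On the n-th period the periodicity of `F` leaves the shift in the kernel only, where it appears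
  -- as -n.
  have h4 : ∀ n : ℤ, ∀ x ∈ Set.Icc (0 : ℝ) 1, w (x + n) = K (((t : ℝ) - x + (-n : ℤ)) / h) * F x := by
    intro n x _
    simp only [w]
    rw [hFp]
    congr 3
    push_cast
    ring
  -- The line is cut into unit intervals. Only the periods in `S` are met by the support of the
  -- kernel.
  have h5 : ∫ y, w y = ∑ n ∈ S, ∫ x in (0 : ℝ)..1, w (x + n) := by
    rw [← hw.hasSum_intervalIntegral_comp_add_int.tsum_eq]
    refine tsum_eq_sum fun n hn => ?_
    have h6 : ∀ x ∈ Set.uIcc (0 : ℝ) 1, w (x + n) = 0 := by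
      intro x hx
      rw [Set.uIcc_of_le zero_le_one] at hx
      rw [h4 n x hx, hK.eq_zero_of_notMem hh (abs_sub_coe_le_one t ⟨x, hx⟩) hZ, zero_mul]
      rw [hS, Finset.mem_Icc] at hn
      rw [Finset.mem_Icc]
      omega
    rw [intervalIntegral.integral_congr h6]
    simp
  rw [h2, h5]
  rw [← intervalIntegral.integral_finsetSum]
  · unfold smoothKernel
    rw [integral_unitInterval fun s => h⁻¹ * kernelWeight K h (t - s) * F s,
      ← intervalIntegral.integral_const_mul]
    refine intervalIntegral.integral_congr fun x hx => ?_
    rw [Set.uIcc_of_le zero_le_one] at hx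
    rw [hK.kernelWeight_eq_sum hh (abs_sub_coe_le_one t ⟨x, hx⟩) hZ, mul_assoc, Finset.sum_mul]
    congr 1
    -- Period n carries the kernel shift -n; the range `S` is symmetric.
    refine Finset.sum_nbij' (fun z => -z) (fun z => -z) ?_ ?_ ?_ ?_ ?_
    · intro z; rw [hS, Finset.mem_Icc, Finset.mem_Icc]; omega
    · intro z; rw [hS, Finset.mem_Icc, Finset.mem_Icc]; omega
    · simp
    · simp
    · intro z _
      rw [h4 _ x hx, neg_neg]
  · intro n _
    exact (hw.comp_add_right (n : ℝ)).intervalIntegrable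

theorem IsKernel.integral_smoothKernel (hK : IsKernel K) (hh : 0 < h) (t : I) :
    ∫ s : I, smoothKernel K h t s = 1 := by
  have := hK.integral_smoothKernel_mul hh (F := fun _ => 1) (b := 1) measurable_const
    (by simp) (by simp) t
  simpa [hK.integral_eq_one] using this

theorem IsKernel.bounded_smoothKernel (hK : IsKernel K) (hh : 0 < h) :
    ∃ C : ℝ, 0 ≤ C ∧ ∀ t s : I, ‖smoothKernel K h t s‖ ≤ C := by
  obtain ⟨C, hC, hb⟩ := hK.exists_smoothKernel_le h
  refine ⟨C * h⁻¹, by positivity, fun t s => ?_⟩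
  rw [Real.norm_of_nonneg (hK.smoothKernel_nonneg hh t s)]
  exact hb h hh le_rfl t s

theorem IsKernel.integrable_smoothKernel (hK : IsKernel K) (hh : 0 < h) (t : I) :
    Integrable (smoothKernel K h t) := by
  obtain ⟨C, -, hC⟩ := hK.bounded_smoothKernel hh
  exact Integrable.of_bound (hK.measurable_smoothKernel_left hh t).aestronglyMeasurable C
    (Filter.Eventually.of_forall (hC t))

theorem IsKernel.integrable_smoothKernel_mul (hK : IsKernel K) (hh : 0 < h) {f : I → ℝ}
    (hf : Integrable f) (t : I) : Integrable fun s => smoothKernel K h t s * f s := by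
  obtain ⟨C, -, hC⟩ := hK.bounded_smoothKernel hh
  exact hf.bdd_mul (c := C) (hK.measurable_smoothKernel_left hh t).aestronglyMeasurable
    (Filter.Eventually.of_forall (hC t))

/-- One factor is bounded by its supremum, of order 1/h; the other has mass one. -/
theorem IsKernel.integral_smoothKernel_sq_le (hK : IsKernel K) (M : ℝ) :
    ∃ C : ℝ, 0 < C ∧ ∀ h : ℝ, 0 < h → h ≤ M → ∀ t : I,
      ∫ s : I, smoothKernel K h t s ^ 2 ≤ C * h⁻¹ := by
  obtain ⟨C, hC, hb⟩ := hK.exists_smoothKernel_le M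
  refine ⟨C, hC, fun h hh hM t => ?_⟩
  calc ∫ s : I, smoothKernel K h t s ^ 2 ≤ ∫ s : I, smoothKernel K h t s * (C * h⁻¹) := by
        refine integral_mono_of_nonneg (Filter.Eventually.of_forall fun s => sq_nonneg _)
          ((hK.integrable_smoothKernel hh t).mul_const _) (Filter.Eventually.of_forall fun s => ?_)
        simp only [sq]
        exact mul_le_mul_of_nonneg_left (hb h hh hM t s) (hK.smoothKernel_nonneg hh t s)
    _ = C * h⁻¹ := by rw [integral_mul_const, hK.integral_smoothKernel hh, one_mul]

theorem IsKernel.measurable_smooth (hK : IsKernel K) (hh : 0 < h) {f : I → ℝ} (hf : Measurable f) :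
    Measurable (smooth K h f) := by
  have h1 : StronglyMeasurable (Function.uncurry fun t s : I => smoothKernel K h t s * f s) :=
    ((hK.measurable_smoothKernel hh).mul (hf.comp measurable_snd)).stronglyMeasurable
  exact h1.integral_prod_right.measurable

theorem IsKernel.abs_smooth_le (hK : IsKernel K) (hh : 0 < h) {f : I → ℝ} {b : ℝ}
    (hb : ∀ t, |f t| ≤ b) (t : I) : |smooth K h f t| ≤ b := by
  calc |smooth K h f t| ≤ ∫ s : I, smoothKernel K h t s * b := by
        unfold smooth
        rw [← Real.norm_eq_abs]
        refine norm_integral_le_of_norm_le ((hK.integrable_smoothKernel hh t).mul_const b)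
          (Filter.Eventually.of_forall fun s => ?_)
        rw [norm_mul, Real.norm_of_nonneg (hK.smoothKernel_nonneg hh t s)]
        exact mul_le_mul_of_nonneg_left (hb s) (hK.smoothKernel_nonneg hh t s)
    _ = b := by rw [integral_mul_const, hK.integral_smoothKernel hh, one_mul]

/-- Fubini's theorem for a bounded symmetric kernel. Self-adjointness yields the symmetry of
`smoothError` and transfers smoothing from an eigenfunction to a path. -/
theorem IsKernel.integral_smooth_mul (hK : IsKernel K) (hh : 0 < h) {f g : I → ℝ}
    (hf : Integrable f) (hg : Integrable g) :
    ∫ t, smooth K h f t * g t = ∫ t, f t * smooth K h g t := by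
  obtain ⟨C, -, hC⟩ := hK.bounded_smoothKernel hh
  have hi : Integrable (fun p : I × I => smoothKernel K h p.1 p.2 * (g p.1 * f p.2))
      (volume.prod volume) :=
    (hg.mul_prod hf).bdd_mul (c := C) (hK.measurable_smoothKernel hh).aestronglyMeasurable
      (Filter.Eventually.of_forall fun p => hC p.1 p.2)
  have h1 : ∀ t, smooth K h f t * g t = ∫ s, smoothKernel K h t s * (g t * f s) := by
    intro t
    unfold smooth
    rw [← integral_mul_const]
    exact integral_congr_ae (Filter.Eventually.of_forall fun s => by simp only; ring)
  have h2 : ∀ s, f s * smooth K h g s = ∫ t, smoothKernel K h t s * (g t * f s) := by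
    intro s
    unfold smooth
    rw [← integral_const_mul]
    refine integral_congr_ae (Filter.Eventually.of_forall fun t => ?_)
    simp only
    rw [hK.smoothKernel_comm s t]
    ring
  simp_rw [h1, h2]
  exact integral_integral_swap hi

/-- Jensen's inequality: the variance of f under the probability density `smoothKernel K h t` is
nonnegative. -/
theorem IsKernel.smooth_sq_le (hK : IsKernel K) (hh : 0 < h) {f : I → ℝ} (hf : MemLp f 2) (t : I) :
    smooth K h f t ^ 2 ≤ smooth K h (fun s => f s ^ 2) t := by
  have hfi : Integrable f := hf.integrable (by norm_num)
  have hf2 : Integrable fun s => f s ^ 2 := hf.integrable_sq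
  set m := smooth K h f t with hm
  have h0 : 0 ≤ ∫ s, smoothKernel K h t s * (f s - m) ^ 2 :=
    integral_nonneg fun s => mul_nonneg (hK.smoothKernel_nonneg hh t s) (sq_nonneg _)
  have h1 : ∫ s, smoothKernel K h t s * (f s - m) ^ 2 =
      smooth K h (fun s => f s ^ 2) t - 2 * m * m + m ^ 2 := by
    have h2 : ∀ s, smoothKernel K h t s * (f s - m) ^ 2 =
        smoothKernel K h t s * f s ^ 2 - 2 * m * (smoothKernel K h t s * f s)
          + m ^ 2 * smoothKernel K h t s := fun s => by ring
    simp_rw [h2]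
    have i1 := hK.integrable_smoothKernel_mul hh hf2 t
    have i2 := (hK.integrable_smoothKernel_mul hh hfi t).const_mul (2 * m)
    have i3 := (hK.integrable_smoothKernel hh t).const_mul (m ^ 2)
    refine (integral_add (i1.sub i2) i3).trans ?_
    rw [integral_const_mul, hK.integral_smoothKernel hh, mul_one]
    congr 1
    refine (integral_sub i1 i2).trans ?_
    rw [integral_const_mul]
    rfl
  nlinarith

theorem IsKernel.memLp_smooth (hK : IsKernel K) (hh : 0 < h) {f : I → ℝ} (hfm : Measurable f)
    (hf : Integrable f) : MemLp (smooth K h f) 2 := by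
  obtain ⟨C, hC0, hC⟩ := hK.bounded_smoothKernel hh
  refine MemLp.of_bound (hK.measurable_smooth hh hfm).aestronglyMeasurable (C * ∫ s, ‖f s‖)
    (Filter.Eventually.of_forall fun t => ?_)
  rw [← integral_const_mul]
  refine norm_integral_le_of_norm_le (hf.norm.const_mul C) (Filter.Eventually.of_forall fun s => ?_)
  rw [norm_mul]
  exact mul_le_mul_of_nonneg_right (hC t s) (norm_nonneg _)

/-- Integrated form of Jensen's inequality; smoothing preserves integrals because it is self-adjoint
and fixes constants. -/
theorem IsKernel.integral_smooth_sq_le (hK : IsKernel K) (hh : 0 < h) {f : I → ℝ}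
    (hfm : Measurable f) (hf : MemLp f 2) :
    ∫ t, smooth K h f t ^ 2 ≤ ∫ t, f t ^ 2 := by
  have hf2 : Integrable fun s => f s ^ 2 := hf.integrable_sq
  calc ∫ t, smooth K h f t ^ 2 ≤ ∫ t, smooth K h (fun s => f s ^ 2) t * 1 := by
        refine integral_mono_of_nonneg (Filter.Eventually.of_forall fun s => sq_nonneg _) ?_
          (Filter.Eventually.of_forall fun t => ?_)
        · simpa using (hK.memLp_smooth hh (hfm.pow_const 2) hf2).integrable (by norm_num)
        · simpa using hK.smooth_sq_le hh hf t
    _ = ∫ t, f t ^ 2 := by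
        rw [hK.integral_smooth_mul hh hf2 (integrable_const 1)]
        refine integral_congr_ae (Filter.Eventually.of_forall fun t => ?_)
        simp [smooth, hK.integral_smoothKernel hh]

end Kernel

/-! ### Smoothing error of periodic, twice differentiable functions -/

section Periodic

/-- The floor is constant immediately to the right of every point, the integers included. Right
derivatives therefore exist everywhere without any matching of derivatives at the end points, and
they suffice for the mean value inequality of a continuous function. -/
theorem hasDerivWithinAt_comp_fract {f g : ℝ → ℝ}
    (hf : ∀ x ∈ Set.Icc (0 : ℝ) 1, HasDerivWithinAt f (g x) (Set.Icc 0 1) x) (x : ℝ) :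
    HasDerivWithinAt (fun y => f (Int.fract y)) (g (Int.fract x)) (Set.Ici x) x := by
  have h0 := Int.fract_nonneg x
  have h1 := Int.fract_lt_one x
  have h2 : HasDerivWithinAt f (g (Int.fract x)) (Set.Ici (Int.fract x)) (Int.fract x) := by
    refine (hf _ ⟨h0, h1.le⟩).mono_of_mem_nhdsWithin ?_
    exact Filter.mem_of_superset (Icc_mem_nhdsGE h1) (Set.Icc_subset_Icc_left h0)
  have h3 : HasDerivWithinAt (fun y => f (y - ⌊x⌋)) (g (Int.fract x)) (Set.Ici x) x := by
    have h4 : HasDerivWithinAt (fun y : ℝ => y - ⌊x⌋) 1 (Set.Ici x) x :=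
      (hasDerivWithinAt_id x _).sub_const _
    have h5 := HasDerivWithinAt.scomp (h := fun y : ℝ => y - ⌊x⌋) (t' := Set.Ici (Int.fract x)) x h2 h4
      (fun y hy => by
        simp only [Set.mem_Ici] at hy ⊢
        rw [← Int.self_sub_floor]
        linarith)
    simpa using! h5
  refine h3.congr_of_eventuallyEq ?_ rfl
  filter_upwards [Ico_mem_nhdsGE (Int.lt_floor_add_one x)] with y hy
  have h6 : ⌊y⌋ = ⌊x⌋ := Int.floor_eq_iff.2 ⟨(Int.floor_le x).trans hy.1, hy.2⟩
  rw [← h6, Int.self_sub_floor]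

/-- Second order Taylor bound for the periodic extension of a function on `[0, 1]`. -/
theorem abs_comp_fract_sub_sub_le {f g w : ℝ → ℝ} {L : ℝ}
    (hf : ∀ x ∈ Set.Icc (0 : ℝ) 1, HasDerivWithinAt f (g x) (Set.Icc 0 1) x)
    (hg : ∀ x ∈ Set.Icc (0 : ℝ) 1, HasDerivWithinAt g (w x) (Set.Icc 0 1) x)
    (hf01 : f 0 = f 1) (hg01 : g 0 = g 1) (hw : ∀ x ∈ Set.Icc (0 : ℝ) 1, |w x| ≤ L) (x y : ℝ) :
    |f (Int.fract y) - f (Int.fract x) - g (Int.fract x) * (y - x)| ≤ 2 * L * (y - x) ^ 2 := by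
  have hL : 0 ≤ L := (abs_nonneg _).trans (hw 0 ⟨le_rfl, zero_le_one⟩)
  have cf : Continuous fun y : ℝ => f (Int.fract y) :=
    ContinuousOn.comp_fract'' (fun x hx => (hf x hx).continuousWithinAt) hf01
  have cg : Continuous fun y : ℝ => g (Int.fract y) :=
    ContinuousOn.comp_fract'' (fun x hx => (hg x hx).continuousWithinAt) hg01
  -- The boundary condition on g makes its periodic extension continuous, hence Lipschitz across the
  -- integers too.
  have lip : ∀ x y : ℝ, x ≤ y → |g (Int.fract y) - g (Int.fract x)| ≤ L * (y - x) := by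
    intro x y hxy
    exact norm_image_sub_le_of_norm_deriv_right_le_segment cg.continuousOn
      (fun z _ => hasDerivWithinAt_comp_fract hg z)
      (fun z _ => hw _ ⟨Int.fract_nonneg z, (Int.fract_lt_one z).le⟩) y ⟨hxy, le_rfl⟩
  have main : ∀ x y : ℝ, x ≤ y →
      |f (Int.fract y) - f (Int.fract x) - g (Int.fract x) * (y - x)| ≤ L * (y - x) ^ 2 := by
    intro x y hxy
    have h1 := norm_image_sub_le_of_norm_deriv_right_le_segment
      (f := fun z => f (Int.fract z) - g (Int.fract x) * z) (a := x) (b := y)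
      (f' := fun z => g (Int.fract z) - g (Int.fract x)) (C := L * (y - x))
      (cf.sub (continuous_const.mul continuous_id)).continuousOn
      (fun z _ => by
        have := (hasDerivWithinAt_comp_fract hf z).sub
          (((hasDerivWithinAt_id z (Set.Ici z)).const_mul (g (Int.fract x))))
        simpa using! this)
      (fun z hz => (lip x z hz.1).trans (by gcongr; exact hz.2.le)) y ⟨hxy, le_rfl⟩
    rw [Real.norm_eq_abs] at h1
    calc _ = _ := by congr 1; ring
      _ ≤ _ := h1
      _ = _ := by ring
  rcases le_total x y with hxy | hxy
  · refine (main x y hxy).trans ?_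
    nlinarith [sq_nonneg (y - x)]
  -- Here the expansion is about y. Exchanging the slope at y for the slope at x costs a further L
  -- (y - x)², whence the factor 2.
  · have h1 := main y x hxy
    have h2 := lip y x hxy
    have h3 : f (Int.fract y) - f (Int.fract x) - g (Int.fract x) * (y - x) =
        -(f (Int.fract x) - f (Int.fract y) - g (Int.fract y) * (x - y)) +
          (g (Int.fract x) - g (Int.fract y)) * (x - y) := by ring
    rw [h3]
    refine (abs_add_le _ _).trans ?_
    rw [abs_neg, abs_mul, abs_of_nonneg (sub_nonneg.2 hxy)]
    have h4 := mul_le_mul_of_nonneg_right h2 (sub_nonneg.2 hxy)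
    nlinarith

variable {K : ℝ → ℝ} {h : ℝ}

theorem IsKernel.mul_sq_le (hK : IsKernel K) (u : ℝ) : K u * u ^ 2 ≤ K u := by
  by_cases hu : 1 < |u|
  · simp [hK.support u hu]
  · have : u ^ 2 ≤ 1 := by
      rw [← sq_abs]
      nlinarith [abs_nonneg u, not_lt.1 hu]
    nlinarith [hK.nonneg u]

theorem IsKernel.integrable_mul_id (hK : IsKernel K) : Integrable fun u => K u * u := by
  refine hK.integrable.mono' (hK.measurable.mul measurable_id).aestronglyMeasurable
    (Filter.Eventually.of_forall fun u => ?_)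
  by_cases hu : 1 < |u|
  · simp [hK.support u hu]
  · rw [norm_mul, Real.norm_of_nonneg (hK.nonneg u), Real.norm_eq_abs]
    nlinarith [hK.nonneg u, not_lt.1 hu]

/-- The integrand is odd. This removes the first order Taylor term, so that the smoothing error is
of order h² and not h. -/
theorem IsKernel.integral_mul_id (hK : IsKernel K) : ∫ u, K u * u = 0 := by
  have h1 := integral_neg_eq_self (fun u => K u * u) (volume : Measure ℝ)
  simp_rw [hK.symm, mul_neg, integral_neg] at h1
  linarith

/-- Smoothing a periodic function with second derivative bounded by `L` changes it by `O(h² L)`. -/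
theorem IsKernel.abs_smooth_sub_le (hK : IsKernel K) (hh : 0 < h) {f g w : ℝ → ℝ} {L : ℝ}
    (hf : ∀ x ∈ Set.Icc (0 : ℝ) 1, HasDerivWithinAt f (g x) (Set.Icc 0 1) x)
    (hg : ∀ x ∈ Set.Icc (0 : ℝ) 1, HasDerivWithinAt g (w x) (Set.Icc 0 1) x)
    (hf01 : f 0 = f 1) (hg01 : g 0 = g 1) (hw : ∀ x ∈ Set.Icc (0 : ℝ) 1, |w x| ≤ L) (t : I) :
    |smooth K h (fun s => f s) t - f t| ≤ 2 * L * h ^ 2 := by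
  have hL : 0 ≤ L := (abs_nonneg _).trans (hw 0 ⟨le_rfl, zero_le_one⟩)
  have cf : Continuous fun y : ℝ => f (Int.fract y) :=
    ContinuousOn.comp_fract'' (fun x hx => (hf x hx).continuousWithinAt) hf01
  obtain ⟨b, hb⟩ := isCompact_Icc.exists_bound_of_continuousOn
    (fun x hx => (hf x hx).continuousWithinAt)
  have hFb : ∀ x : ℝ, |f (Int.fract x)| ≤ b := fun x =>
    hb _ ⟨Int.fract_nonneg x, (Int.fract_lt_one x).le⟩
  -- Only s = 1 is delicate: its fractional part is 0, and f 0 = f 1.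
  have heq : ∀ s : I, f (Int.fract (s : ℝ)) = f s := by
    intro s
    rcases eq_or_lt_of_le s.2.2 with h1 | h1
    · rw [h1, Int.fract_one, hf01]
    · rw [Int.fract_eq_self.2 ⟨s.2.1, h1⟩]
  have h1 := hK.integral_smoothKernel_mul hh cf.measurable hFb
    (fun x n => by rw [Int.fract_add_intCast]) t
  simp_rw [heq] at h1
  have i1 : Integrable fun u => K u * f (Int.fract (t - h * u)) :=
    hK.integrable.mul_bdd (c := b) (cf.comp (by fun_prop)).aestronglyMeasurable
      (Filter.Eventually.of_forall fun u => hFb _)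
  have h2 : ∫ u, K u * (f (Int.fract (t - h * u)) - f (Int.fract t)
      - g (Int.fract t) * ((t - h * u) - t)) = smooth K h (fun s => f s) t - f t := by
    have h3 : ∀ u, K u * (f (Int.fract (t - h * u)) - f (Int.fract t)
        - g (Int.fract t) * ((t - h * u) - t)) =
        (K u * f (Int.fract (t - h * u)) - f (Int.fract t) * K u)
          + (g (Int.fract t) * h) * (K u * u) := fun u => by ring
    simp_rw [h3]
    refine (integral_add (i1.sub (hK.integrable.const_mul _))
      (hK.integrable_mul_id.const_mul _)).trans ?_
    rw [integral_const_mul, hK.integral_mul_id, mul_zero, add_zero]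
    refine (integral_sub i1 (hK.integrable.const_mul _)).trans ?_
    rw [integral_const_mul, hK.integral_eq_one, mul_one, ← h1, heq]
    rfl
  rw [← h2, ← Real.norm_eq_abs]
  calc _ ≤ ∫ u, K u * (2 * L * h ^ 2) := by
        refine norm_integral_le_of_norm_le (hK.integrable.mul_const _)
          (Filter.Eventually.of_forall fun u => ?_)
        have h4 := abs_comp_fract_sub_sub_le hf hg hf01 hg01 hw (t : ℝ) (t - h * u)
        rw [norm_mul, Real.norm_of_nonneg (hK.nonneg u), Real.norm_eq_abs]
        calc _ ≤ K u * (2 * L * ((t - h * u) - t) ^ 2) :=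
              mul_le_mul_of_nonneg_left h4 (hK.nonneg u)
          _ = (K u * u ^ 2) * (2 * L * h ^ 2) := by ring
          _ ≤ _ := mul_le_mul_of_nonneg_right (hK.mul_sq_le u) (by positivity)
    _ = 2 * L * h ^ 2 := by rw [integral_mul_const, hK.integral_eq_one, one_mul]

variable {c : ℝ} {φ : ℕ → ℝ → ℝ}

theorem SmoothEigenfunctions.hasDerivWithinAt (hs : SmoothEigenfunctions c φ) {j : ℕ} (hj : 1 ≤ j)
    {r : ℕ} (hr : r < 2) {x : ℝ} (hx : x ∈ Set.Icc (0 : ℝ) 1) :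
    HasDerivWithinAt (deriv01 r (φ j)) (deriv01 (r + 1) (φ j) x) (Set.Icc 0 1) x := by
  have h1 := (hs.differentiable j hj r hr x hx).hasDerivWithinAt
  have h2 : derivWithin (deriv01 r (φ j)) (Set.Icc 0 1) x = deriv01 (r + 1) (φ j) x := by
    unfold deriv01
    rw [iteratedDerivWithin_succ]
  rwa [h2] at h1

/-- Each of the two differentiations costs a factor j^{c/2}, starting from a uniform bound for the
eigenfunctions. -/
theorem SmoothEigenfunctions.exists_second_deriv_le (hs : SmoothEigenfunctions c φ) :
    ∃ C : ℝ, 0 < C ∧ ∀ j : ℕ, 1 ≤ j → ∀ t : I, |deriv01 2 (φ j) t| ≤ C * (j : ℝ) ^ c := by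
  obtain ⟨B, hB⟩ := hs.bounded
  obtain ⟨A, hA⟩ := hs.deriv_bound
  have hB0 : 0 ≤ B := (abs_nonneg _).trans (hB 1 le_rfl 0)
  refine ⟨|A| * |A| * B + 1, by positivity, fun j hj t => ?_⟩
  have hj0 : (0 : ℝ) < j := by exact_mod_cast hj
  have hp : 0 ≤ (j : ℝ) ^ (c / 2) := by positivity
  have h0 : ⨆ s : I, |deriv01 0 (φ j) s| ≤ B := by
    refine ciSup_le fun s => ?_
    simpa [deriv01] using hB j hj s
  have hA' : A * (j : ℝ) ^ (c / 2) ≤ |A| * (j : ℝ) ^ (c / 2) :=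
    mul_le_mul_of_nonneg_right (le_abs_self A) hp
  have n0 : 0 ≤ ⨆ s : I, |deriv01 0 (φ j) s| := Real.iSup_nonneg fun s => abs_nonneg _
  have h1 : ⨆ s : I, |deriv01 1 (φ j) s| ≤ |A| * (j : ℝ) ^ (c / 2) * B := by
    refine ciSup_le fun s => (hA j hj 0 (by norm_num) s).trans ?_
    exact mul_le_mul hA' h0 n0 (by positivity)
  have n1 : 0 ≤ ⨆ s : I, |deriv01 1 (φ j) s| := Real.iSup_nonneg fun s => abs_nonneg _
  have hc : (j : ℝ) ^ (c / 2) * (j : ℝ) ^ (c / 2) = (j : ℝ) ^ c := by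
    rw [← Real.rpow_add hj0]; congr 1; ring
  calc |deriv01 2 (φ j) t| ≤ _ := hA j hj 1 (by norm_num) t
    _ ≤ (|A| * (j : ℝ) ^ (c / 2)) * (|A| * (j : ℝ) ^ (c / 2) * B) :=
        mul_le_mul hA' h1 n1 (by positivity)
    _ = |A| * |A| * B * ((j : ℝ) ^ (c / 2) * (j : ℝ) ^ (c / 2)) := by ring
    _ ≤ (|A| * |A| * B + 1) * ((j : ℝ) ^ (c / 2) * (j : ℝ) ^ (c / 2)) := by
        gcongr; linarith
    _ = _ := by rw [hc]

theorem SmoothEigenfunctions.exists_abs_smooth_sub_le (hs : SmoothEigenfunctions c φ)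
    (hK : IsKernel K) :
    ∃ C : ℝ, 0 < C ∧ ∀ (j : ℕ) (h : ℝ), 1 ≤ j → 0 < h → ∀ t : I,
      |smooth K h (fun s => φ j s) t - φ j t| ≤ C * h ^ 2 * (j : ℝ) ^ c := by
  obtain ⟨C, hC, hb⟩ := hs.exists_second_deriv_le
  refine ⟨2 * C, by positivity, fun j h hj hh t => ?_⟩
  have h0 : deriv01 0 (φ j) = φ j := by
    unfold deriv01
    rw [iteratedDerivWithin_zero]
  have h1 := hK.abs_smooth_sub_le hh (f := deriv01 0 (φ j)) (g := deriv01 1 (φ j))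
    (w := deriv01 2 (φ j)) (L := C * (j : ℝ) ^ c)
    (fun x hx => hs.hasDerivWithinAt hj (by norm_num) hx)
    (fun x hx => hs.hasDerivWithinAt hj (by norm_num) hx)
    (by rw [h0]; exact hs.boundary j hj) (hs.boundary_deriv j hj)
    (fun x hx => hb j hj ⟨x, hx⟩) t
  rw [h0] at h1
  refine h1.trans (le_of_eq ?_)
  ring

theorem SmoothEigenfunctions.continuous (hs : SmoothEigenfunctions c φ) {j : ℕ} (hj : 1 ≤ j) :
    Continuous fun t : I => φ j t := by
  have h0 : deriv01 0 (φ j) = φ j := by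
    unfold deriv01
    rw [iteratedDerivWithin_zero]
  have h1 := (hs.differentiable j hj 0 (by norm_num)).continuousOn
  rw [h0] at h1
  exact continuousOn_iff_continuous_domRestrict.1 h1

end Periodic

/-! ### Parseval's identity and the coefficients of the smoothing errors -/

section Parseval

variable {C : I → I → ℝ} {lam : ℕ → ℝ} {φ : ℕ → ℝ → ℝ}

theorem inner_toLp {f g : I → ℝ} (hf : MemLp f 2) (hg : MemLp g 2) :
    inner ℝ (hf.toLp f) (hg.toLp g) = ∫ t, f t * g t := by
  rw [L2.inner_def]
  refine integral_congr_ae ?_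
  filter_upwards [hf.coeFn_toLp, hg.coeFn_toLp] with t h1 h2
  rw [h1, h2]
  simp [mul_comm]

/-- Completeness says that the orthogonal complement of the span is trivial, so the classes of the
eigenfunctions form a Hilbert basis of L², to which Parseval's identity applies. -/
theorem IsEigenExpansion.hasSum_mul (he : IsEigenExpansion C lam φ) {f g : I → ℝ}
    (hf : MemLp f 2) (hg : MemLp g 2) :
    HasSum (fun k : ℕ => (∫ t, f t * φ (k + 1) t) * ∫ t, g t * φ (k + 1) t) (∫ t, f t * g t) := by
  let v : ℕ → Lp ℝ 2 (volume : Measure I) := fun k => (he.memLp (k + 1) (by omega)).toLp _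
  have hv : Orthonormal ℝ v := by
    rw [orthonormal_iff_ite]
    intro i k
    rw [inner_toLp]
    split_ifs with hik
    · subst hik
      simp_rw [← sq]
      exact he.norm_eq_one _ (by omega)
    · exact he.orthogonal _ _ (by omega) (by omega) (by omega)
  have hsp : (Submodule.span ℝ (Set.range v))ᗮ = ⊥ := by
    rw [Submodule.eq_bot_iff]
    intro x hx
    rw [Submodule.mem_orthogonal'] at hx
    have hx' : ∀ j, 1 ≤ j → ∫ t : I, x t * φ j t = 0 := by
      intro j hj
      obtain ⟨k, rfl⟩ : ∃ k, j = k + 1 := ⟨j - 1, by omega⟩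
      have h1 := hx (v k) (Submodule.subset_span ⟨k, rfl⟩)
      rw [← Lp.toLp_coeFn x (Lp.memLp x), inner_toLp] at h1
      exact h1
    have h2 := he.complete x (Lp.memLp x) hx'
    exact (Lp.eq_zero_iff_ae_eq_zero).2 h2
  let b := HilbertBasis.mkOfOrthogonalEqBot hv hsp
  have hb : ∀ k, b k = v k := fun k => by
    simp only [b, HilbertBasis.coe_mkOfOrthogonalEqBot]
  have h3 := b.hasSum_inner_mul_inner (hf.toLp f) (hg.toLp g)
  have h4 : ∀ k, inner ℝ (v k) (hg.toLp g) = inner ℝ (hg.toLp g) (v k) := fun k =>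
    real_inner_comm _ _
  simp only [hb, h4] at h3
  simpa only [v, inner_toLp] using h3

theorem IsEigenExpansion.hasSum_sq (he : IsEigenExpansion C lam φ) {f : I → ℝ} (hf : MemLp f 2) :
    HasSum (fun k : ℕ => (∫ t, f t * φ (k + 1) t) ^ 2) (∫ t, f t ^ 2) := by
  simp_rw [sq]
  exact he.hasSum_mul hf hf

/-- Bessel's inequality. -/
theorem IsEigenExpansion.sum_sq_le (he : IsEigenExpansion C lam φ) {f : I → ℝ} (hf : MemLp f 2)
    {s : Finset ℕ} (hs : ∀ k ∈ s, 1 ≤ k) :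
    ∑ k ∈ s, (∫ t, f t * φ k t) ^ 2 ≤ ∫ t, f t ^ 2 := by
  have h1 : ∑ k ∈ s, (∫ t, f t * φ k t) ^ 2 =
      ∑ k ∈ s.image (fun k => k - 1), (∫ t, f t * φ (k + 1) t) ^ 2 := by
    rw [Finset.sum_image]
    · refine Finset.sum_congr rfl fun k hk => ?_
      rw [Nat.sub_add_cancel (hs k hk)]
    · intro x hx y hy hxy
      have h1 := hs x hx
      have h2 := hs y hy
      simp only at hxy
      omega
  rw [h1]
  exact sum_le_hasSum _ (fun k _ => sq_nonneg _) (he.hasSum_sq hf)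

variable {K : ℝ → ℝ} {h c : ℝ}

/-- The smoothed eigenfunction. -/
noncomputable def smoothEigen (K : ℝ → ℝ) (h : ℝ) (φ : ℕ → ℝ → ℝ) (k : ℕ) : I → ℝ :=
  smooth K h fun s => φ k s

/-- The coefficients of the smoothing errors of the eigenfunctions. -/
noncomputable def smoothError (K : ℝ → ℝ) (h : ℝ) (φ : ℕ → ℝ → ℝ) (j k : ℕ) : ℝ :=
  ∫ t : I, (smoothEigen K h φ j t - φ j t) * φ k t

theorem SmoothEigenfunctions.measurable (hs : SmoothEigenfunctions c φ) {j : ℕ} (hj : 1 ≤ j) :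
    Measurable fun t : I => φ j t := (hs.continuous hj).measurable

theorem SmoothEigenfunctions.measurable_smoothEigen (hs : SmoothEigenfunctions c φ)
    (hK : IsKernel K) (hh : 0 < h) {j : ℕ} (hj : 1 ≤ j) : Measurable (smoothEigen K h φ j) :=
  hK.measurable_smooth hh (hs.measurable hj)

theorem memLp_of_abs_le {f : I → ℝ} {b : ℝ} (hf : Measurable f) (hb : ∀ t, |f t| ≤ b)
    (p : ENNReal) : MemLp f p :=
  MemLp.of_bound hf.aestronglyMeasurable b (Filter.Eventually.of_forall hb)

theorem SmoothEigenfunctions.integrable (hs : SmoothEigenfunctions c φ) {j : ℕ} (hj : 1 ≤ j) :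
    Integrable fun t : I => φ j t := by
  obtain ⟨B, hB⟩ := hs.bounded
  exact memLp_one_iff_integrable.1 (memLp_of_abs_le (hs.measurable hj) (hB j hj) 1)

theorem SmoothEigenfunctions.memLp_smoothEigen (hs : SmoothEigenfunctions c φ)
    (hK : IsKernel K) (hh : 0 < h) {j : ℕ} (hj : 1 ≤ j) : MemLp (smoothEigen K h φ j) 2 :=
  hK.memLp_smooth hh (hs.measurable hj) (hs.integrable hj)

/-- Consequence of self-adjointness. It lets a coefficient be estimated through whichever of its two
indices is more favourable. -/
theorem SmoothEigenfunctions.smoothError_comm (hs : SmoothEigenfunctions c φ)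
    (hK : IsKernel K) (he : IsEigenExpansion C lam φ) (hh : 0 < h) {j k : ℕ} (hj : 1 ≤ j)
    (hk : 1 ≤ k) : smoothError K h φ j k = smoothError K h φ k j := by
  have i1 : Integrable fun t : I => smoothEigen K h φ j t * φ k t :=
    (hs.memLp_smoothEigen hK hh hj).integrable_mul (he.memLp k hk)
  have i2 : Integrable fun t : I => smoothEigen K h φ k t * φ j t :=
    (hs.memLp_smoothEigen hK hh hk).integrable_mul (he.memLp j hj)
  have i3 : Integrable fun t : I => φ j t * φ k t :=
    (he.memLp j hj).integrable_mul (he.memLp k hk)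
  have i4 : Integrable fun t : I => φ k t * φ j t :=
    (he.memLp k hk).integrable_mul (he.memLp j hj)
  unfold smoothError
  simp_rw [sub_mul]
  rw [integral_sub i1 i3, integral_sub i2 i4]
  congr 1
  · refine (hK.integral_smooth_mul hh (hs.integrable hj) (hs.integrable hk)).trans ?_
    exact integral_congr_ae (Filter.Eventually.of_forall fun t => mul_comm _ _)
  · exact integral_congr_ae (Filter.Eventually.of_forall fun t => mul_comm _ _)

theorem SmoothEigenfunctions.integral_smoothEigen_mul (hs : SmoothEigenfunctions c φ)
    (hK : IsKernel K) (he : IsEigenExpansion C lam φ) (hh : 0 < h) {j k : ℕ} (hj : 1 ≤ j)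
    (hk : 1 ≤ k) : ∫ t : I, smoothEigen K h φ j t * φ k t =
      (if j = k then 1 else 0) + smoothError K h φ j k := by
  have i1 : Integrable fun t : I => smoothEigen K h φ j t * φ k t :=
    (hs.memLp_smoothEigen hK hh hj).integrable_mul (he.memLp k hk)
  have i3 : Integrable fun t : I => φ j t * φ k t :=
    (he.memLp j hj).integrable_mul (he.memLp k hk)
  unfold smoothError
  simp_rw [sub_mul]
  rw [integral_sub i1 i3]
  have : ∫ t : I, φ j t * φ k t = if j = k then 1 else 0 := by
    split_ifs with hjk
    · subst hjk
      simp_rw [← sq]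
      exact he.norm_eq_one _ hj
    · exact he.orthogonal _ _ hj hk hjk
  rw [this]
  ring

/-- Uniform bounds for the smoothed eigenfunctions and the coefficients of the smoothing errors. -/
structure SmoothBounds (K : ℝ → ℝ) (φ : ℕ → ℝ → ℝ) (c B : ℝ) : Prop where
  pos : 0 < B
  abs_le : ∀ (j : ℕ) (h : ℝ), 1 ≤ j → 0 < h → ∀ t : I, |smoothEigen K h φ j t| ≤ B
  sub_le : ∀ (j : ℕ) (h : ℝ), 1 ≤ j → 0 < h → ∀ t : I,
    |smoothEigen K h φ j t - φ j t| ≤ B * h ^ 2 * (j : ℝ) ^ c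
  error_le : ∀ (j k : ℕ) (h : ℝ), 1 ≤ j → 1 ≤ k → 0 < h →
    |smoothError K h φ j k| ≤ B * h ^ 2 * (j : ℝ) ^ c
  sum_error_sq_le : ∀ (j : ℕ) (h : ℝ) (s : Finset ℕ), 1 ≤ j → 0 < h → (∀ k ∈ s, 1 ≤ k) →
    ∑ k ∈ s, smoothError K h φ j k ^ 2 ≤ B * h ^ 4 * (j : ℝ) ^ (2 * c)
  sum_error_sq_le_const : ∀ (j : ℕ) (h : ℝ) (s : Finset ℕ), 1 ≤ j → 0 < h → (∀ k ∈ s, 1 ≤ k) →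
    ∑ k ∈ s, smoothError K h φ j k ^ 2 ≤ B

/-- The sums of squares are Bessel's inequality for ψ_j - φ_j, combined with one of two uniform
bounds: the Taylor bound of order h² j^c, or the trivial bound by two suprema. The latter serves for
indices to which the bandwidth condition does not extend. -/
theorem SmoothEigenfunctions.exists_smoothBounds (hs : SmoothEigenfunctions c φ)
    (hK : IsKernel K) (he : IsEigenExpansion C lam φ) : ∃ B, SmoothBounds K φ c B := by
  obtain ⟨b, hb⟩ := hs.bounded
  obtain ⟨C₂, hC₂, h2⟩ := hs.exists_abs_smooth_sub_le hK
  have hb0 : 0 ≤ b := (abs_nonneg _).trans (hb 1 le_rfl 0)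
  -- A single constant that dominates each of those needed below.
  set B := 1 + b + C₂ * b + C₂ + C₂ ^ 2 + 4 * b ^ 2 with hB
  have hsb : ∀ (j : ℕ) (h : ℝ), 1 ≤ j → 0 < h → ∀ t : I, |smoothEigen K h φ j t| ≤ b :=
    fun j h hj hh t => hK.abs_smooth_le hh (hb j hj) t
  have hmem : ∀ (j : ℕ) (h : ℝ), 1 ≤ j → 0 < h →
      MemLp (fun t : I => smoothEigen K h φ j t - φ j t) 2 := fun j h hj hh =>
    (hs.memLp_smoothEigen hK hh hj).sub (he.memLp j hj)
  have hsq : ∀ (j : ℕ) (h : ℝ) (D : ℝ), 1 ≤ j → 0 < h →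
      (∀ t : I, |smoothEigen K h φ j t - φ j t| ≤ D) → ∀ s : Finset ℕ, (∀ k ∈ s, 1 ≤ k) →
      ∑ k ∈ s, smoothError K h φ j k ^ 2 ≤ D ^ 2 := by
    intro j h D hj hh hD s hs1
    refine (he.sum_sq_le (hmem j h hj hh) hs1).trans ?_
    calc _ ≤ ∫ _ : I, D ^ 2 := by
          refine integral_mono (hmem j h hj hh).integrable_sq (integrable_const _) fun t => ?_
          simp only
          rw [← sq_abs]
          exact pow_le_pow_left₀ (abs_nonneg _) (hD t) 2
      _ = D ^ 2 := by simp
  refine ⟨B, by positivity, fun j h hj hh t => (hsb j h hj hh t).trans ?_,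
    fun j h hj hh t => (h2 j h hj hh t).trans ?_, ?_, ?_, ?_⟩
  · rw [hB]; nlinarith [mul_nonneg hC₂.le hb0, sq_nonneg b, sq_nonneg C₂]
  · gcongr
    rw [hB]; nlinarith [mul_nonneg hC₂.le hb0, sq_nonneg b, sq_nonneg C₂]
  · intro j k h hj hk hh
    unfold smoothError
    rw [← Real.norm_eq_abs]
    refine (norm_integral_le_of_norm_le_const (C := (C₂ * h ^ 2 * (j : ℝ) ^ c) * b)
      (Filter.Eventually.of_forall fun t => ?_)).trans ?_
    · rw [norm_mul]
      exact mul_le_mul (h2 j h hj hh t) (hb k hk t) (norm_nonneg _) (by positivity)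
    · simp only [probReal_univ, mul_one]
      calc _ = (C₂ * b) * h ^ 2 * (j : ℝ) ^ c := by ring
        _ ≤ _ := by
          gcongr
          rw [hB]; nlinarith [mul_nonneg hC₂.le hb0, sq_nonneg b, sq_nonneg C₂]
  · intro j h s hj hh hs1
    refine (hsq j h _ hj hh (h2 j h hj hh) s hs1).trans ?_
    have : ((j : ℝ) ^ c) ^ 2 = (j : ℝ) ^ (2 * c) := by
      rw [← Real.rpow_natCast, ← Real.rpow_mul (by positivity)]
      congr 1; push_cast; ring
    calc _ = C₂ ^ 2 * h ^ 4 * ((j : ℝ) ^ c) ^ 2 := by ring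
      _ ≤ B * h ^ 4 * (j : ℝ) ^ (2 * c) := by
        rw [this]
        gcongr
        rw [hB]; nlinarith [mul_nonneg hC₂.le hb0, sq_nonneg b, sq_nonneg C₂]
  · intro j h s hj hh hs1
    refine (hsq j h (2 * b) hj hh (fun t => ?_) s hs1).trans ?_
    · refine (abs_sub _ _).trans ?_
      linarith [hsb j h hj hh t, hb j hj t]
    · rw [hB]; nlinarith [mul_nonneg hC₂.le hb0, sq_nonneg b, sq_nonneg C₂]

/-- The squares of the smoothed eigenfunctions sum up to at most a constant times `1 / h`. -/
theorem IsEigenExpansion.exists_sum_smoothEigen_sq_le (he : IsEigenExpansion C lam φ)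
    (hK : IsKernel K) (M : ℝ) :
    ∃ B : ℝ, 0 < B ∧ ∀ h : ℝ, 0 < h → h ≤ M → ∀ s : Finset ℕ, (∀ k ∈ s, 1 ≤ k) → ∀ t : I,
      ∑ k ∈ s, smoothEigen K h φ k t ^ 2 ≤ B * h⁻¹ := by
  obtain ⟨B, hB, hb⟩ := hK.integral_smoothKernel_sq_le M
  refine ⟨B, hB, fun h hh hM s hs t => le_trans ?_ (hb h hh hM t)⟩
  obtain ⟨b, -, hbd⟩ := hK.bounded_smoothKernel hh
  -- The value ψ_k(t) is the k-th coefficient of the function s ↦ `smoothKernel K h t s`, so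
  -- Bessel's inequality applies to the kernel itself.
  exact he.sum_sq_le (memLp_of_abs_le (hK.measurable_smoothKernel_left hh t) (hbd t) 2) hs

end Parseval

/-! ### Moments of off-diagonal double sums by decoupling -/

section UStatistic

/-- An off-diagonal double sum is, up to the factor `2 ^ (#R - 2)`, the sum over the subsets `A` of
the index set of the products of a sum over `A` and a sum over the complement of `A`. -/
theorem sum_powerset_mul_sum_sdiff {ι : Type*} [DecidableEq ι] (R : Finset ι) (y w : ι → ℝ) :
    ∑ A ∈ R.powerset, (∑ l ∈ A, y l) * ∑ m ∈ R \ A, w m =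
      2 ^ (#R - 2) * ∑ l ∈ R, ∑ m ∈ R.erase l, y l * w m := by
  -- The pair (l, m) occurs in the product belonging to `A` exactly when l ∈ A and m ∉ A.
  have h1 : ∀ A ∈ R.powerset, (∑ l ∈ A, y l) * ∑ m ∈ R \ A, w m =
      ∑ l ∈ R, ∑ m ∈ R.erase l, if A ∈ Finset.Icc {l} (R.erase m) then y l * w m else 0 := by
    intro A hA
    rw [Finset.mem_powerset] at hA
    rw [Finset.sum_mul_sum, ← Finset.sum_filter_of_ne (s := R) (p := fun l => l ∈ A)]
    · rw [Finset.filter_mem_eq_inter, Finset.inter_eq_right.2 hA]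
      refine Finset.sum_congr rfl fun l hl => ?_
      rw [← Finset.sum_filter]
      refine Finset.sum_congr ?_ fun _ _ => rfl
      ext m
      simp only [Finset.mem_sdiff, Finset.mem_filter, Finset.mem_erase, Finset.mem_Icc,
        Finset.singleton_subset_iff, Finset.subset_erase]
      constructor
      · rintro ⟨hm, hmA⟩
        exact ⟨⟨fun hml => hmA (hml ▸ hl), hm⟩, hl, hA, hmA⟩
      · rintro ⟨⟨_, hm⟩, _, _, hmA⟩
        exact ⟨hm, hmA⟩
    · intro l _ hne
      by_contra hlA
      apply hne
      refine Finset.sum_eq_zero fun m _ => ?_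
      rw [if_neg]
      simp [hlA]
  rw [Finset.sum_congr rfl h1, Finset.sum_comm, Finset.mul_sum]
  refine Finset.sum_congr rfl fun l hl => ?_
  rw [Finset.sum_comm, Finset.mul_sum]
  refine Finset.sum_congr rfl fun m hm => ?_
  rw [Finset.mem_erase] at hm
  rw [← Finset.sum_filter, Finset.sum_const, nsmul_eq_mul]
  congr 1
  have h2 : R.powerset.filter (fun A => A ∈ Finset.Icc {l} (R.erase m)) =
      Finset.Icc {l} (R.erase m) := by
    ext A
    simp only [Finset.mem_filter, Finset.mem_powerset, and_iff_right_iff_imp, Finset.mem_Icc]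
    rintro ⟨_, h⟩
    exact h.trans (Finset.erase_subset _ _)
  have h3 : ({l} : Finset ι) ⊆ R.erase m := by
    simp [hl, hm.1.symm]
  -- All elements other than l and m can be placed freely, which gives 2 ^ (#R - 2) sets.
  rw [h2, Finset.card_Icc_finset h3, Finset.card_erase_of_mem hm.2, Finset.card_singleton,
    Nat.sub_sub]
  push_cast
  rfl

variable {Ω : Type*} [MeasurableSpace Ω] {P : Measure Ω}

/-- Variance plus squared mean; variances add by pairwise independence and are bounded by second
moments. -/
theorem integral_sum_sq_le [IsProbabilityMeasure P] {Y : ℕ → Ω → ℝ} {α v : ℝ} (hY : ∀ l, MemLp (Y l) 2 P)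
    (hind : Pairwise fun l m => IndepFun (Y l) (Y m) P)
    (hα : ∀ l, ∫ ω, Y l ω ∂P = α) (hv : ∀ l, ∫ ω, Y l ω ^ 2 ∂P ≤ v) (A : Finset ℕ) :
    ∫ ω, (∑ l ∈ A, Y l ω) ^ 2 ∂P ≤ #A * v + (#A : ℝ) ^ 2 * α ^ 2 := by
  have hS : MemLp (∑ l ∈ A, Y l) 2 P := memLp_finsetSum' _ fun l _ => hY l
  have h1 := variance_eq_sub hS
  rw [IndepFun.variance_sum (fun l _ => hY l) (fun l _ m _ hlm => hind hlm)] at h1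
  have h2 : ∑ l ∈ A, variance (Y l) P ≤ #A * v := by
    rw [← nsmul_eq_mul]
    refine Finset.sum_le_card_nsmul _ _ _ fun l _ => ?_
    exact (variance_le_expectation_sq (hY l).aestronglyMeasurable).trans (hv l)
  have h3 : ∫ ω, (∑ l ∈ A, Y l) ω ∂P = #A * α := by
    simp only [Finset.sum_apply]
    rw [integral_finsetSum _ fun l _ => (hY l).integrable (by norm_num)]
    simp [hα]
  rw [h3] at h1
  have h4 : ∫ ω, (∑ l ∈ A, Y l ω) ^ 2 ∂P = ∫ ω, ((∑ l ∈ A, Y l) ^ 2) ω ∂P := by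
    simp
  rw [h4]
  nlinarith

/-- `Y l` and `W l` may depend on each other, as both are built from the same sampling point and
error. Only disjoint index sets give independent sums, and this is what the decoupling provides. -/
theorem indepFun_sum_sum {Y W : ℕ → Ω → ℝ} (hYm : ∀ l, Measurable (Y l))
    (hWm : ∀ l, Measurable (W l)) (hind : iIndepFun (fun l ω => (Y l ω, W l ω)) P)
    {A B : Finset ℕ} (hAB : Disjoint A B) :
    IndepFun (fun ω => ∑ l ∈ A, Y l ω) (fun ω => ∑ m ∈ B, W m ω) P := by
  have h1 := hind.indepFun_finset A B hAB fun l => (hYm l).prodMk (hWm l)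
  have h2 := h1.comp (φ := fun p : A → ℝ × ℝ => ∑ l, (p l).1) (ψ := fun p : B → ℝ × ℝ => ∑ l, (p l).2)
    (by fun_prop) (by fun_prop)
  have e1 : (fun ω => ∑ l ∈ A, Y l ω) =
      (fun p : A → ℝ × ℝ => ∑ l, (p l).1) ∘ fun ω (i : A) => (Y i ω, W i ω) := by
    funext ω
    simp only [Function.comp]
    exact (Finset.sum_coe_sort A fun l => Y l ω).symm
  have e2 : (fun ω => ∑ l ∈ B, W l ω) =
      (fun p : B → ℝ × ℝ => ∑ l, (p l).2) ∘ fun ω (i : B) => (Y i ω, W i ω) := by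
    funext ω
    simp only [Function.comp]
    exact (Finset.sum_coe_sort B fun l => W l ω).symm
  rw [e1, e2]
  exact h2

/-- Second moment of an off-diagonal double sum of independent pairs. -/
theorem integral_offDiag_sq_le [IsProbabilityMeasure P] {Y W : ℕ → Ω → ℝ} {α β v w : ℝ} (hYm : ∀ l, Measurable (Y l))
    (hWm : ∀ l, Measurable (W l)) (hY : ∀ l, MemLp (Y l) 2 P) (hW : ∀ l, MemLp (W l) 2 P)
    (hind : iIndepFun (fun l ω => (Y l ω, W l ω)) P)
    (hα : ∀ l, ∫ ω, Y l ω ∂P = α) (hβ : ∀ l, ∫ ω, W l ω ∂P = β)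
    (hv : ∀ l, ∫ ω, Y l ω ^ 2 ∂P ≤ v) (hw : ∀ l, ∫ ω, W l ω ^ 2 ∂P ≤ w) {N : ℕ} (hN : 2 ≤ N) :
    Integrable (fun ω => (∑ l ∈ range N, ∑ m ∈ (range N).erase l, Y l ω * W m ω) ^ 2) P ∧
    ∫ ω, (∑ l ∈ range N, ∑ m ∈ (range N).erase l, Y l ω * W m ω) ^ 2 ∂P ≤
      16 * ((N * v + (N : ℝ) ^ 2 * α ^ 2) * (N * w + (N : ℝ) ^ 2 * β ^ 2)) := by
  have hv0 : 0 ≤ v := (integral_nonneg fun ω => sq_nonneg _).trans (hv 0)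
  have hw0 : 0 ≤ w := (integral_nonneg fun ω => sq_nonneg _).trans (hw 0)
  have hYind : Pairwise fun l m => IndepFun (Y l) (Y m) P := fun l m hlm =>
    (hind.indepFun hlm).comp (φ := Prod.fst) (ψ := Prod.fst) measurable_fst measurable_fst
  have hWind : Pairwise fun l m => IndepFun (W l) (W m) P := fun l m hlm =>
    (hind.indepFun hlm).comp (φ := Prod.snd) (ψ := Prod.snd) measurable_snd measurable_snd
  set R := range N with hR
  have hRc : #R = N := card_range N
  set D := (N * v + (N : ℝ) ^ 2 * α ^ 2) * (N * w + (N : ℝ) ^ 2 * β ^ 2) with hD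
  let F : Finset ℕ → Ω → ℝ := fun A ω => (∑ l ∈ A, Y l ω) * ∑ m ∈ R \ A, W m ω
  have hF : ∀ A ∈ R.powerset, Integrable (fun ω => F A ω ^ 2) P ∧ ∫ ω, F A ω ^ 2 ∂P ≤ D := by
    intro A hA
    rw [Finset.mem_powerset] at hA
    have h1 := indepFun_sum_sum hYm hWm hind (A := A) (B := R \ A)
      Finset.disjoint_sdiff
    have h2 : IndepFun (fun ω => (∑ l ∈ A, Y l ω) ^ 2) (fun ω => (∑ m ∈ R \ A, W m ω) ^ 2) P :=
      h1.comp (φ := fun x => x ^ 2) (ψ := fun x => x ^ 2) (by fun_prop) (by fun_prop)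
    have i1 : Integrable (fun ω => (∑ l ∈ A, Y l ω) ^ 2) P :=
      (memLp_finsetSum _ fun l _ => hY l).integrable_sq
    have i2 : Integrable (fun ω => (∑ l ∈ R \ A, W l ω) ^ 2) P :=
      (memLp_finsetSum _ fun l _ => hW l).integrable_sq
    have h3 : ∀ ω, F A ω ^ 2 = (∑ l ∈ A, Y l ω) ^ 2 * (∑ m ∈ R \ A, W m ω) ^ 2 := fun ω => by
      simp only [F]; ring
    have cA : (#A : ℝ) ≤ N := by
      exact_mod_cast (Finset.card_le_card hA).trans_eq hRc
    have cB : (#(R \ A) : ℝ) ≤ N := by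
      exact_mod_cast (Finset.card_le_card Finset.sdiff_subset).trans_eq hRc
    simp_rw [h3]
    refine ⟨h2.integrable_mul i1 i2, ?_⟩
    rw [h2.integral_fun_mul_eq_mul_integral i1.aestronglyMeasurable i2.aestronglyMeasurable]
    refine mul_le_mul ((integral_sum_sq_le hY hYind hα hv A).trans ?_)
      ((integral_sum_sq_le hW hWind hβ hw _).trans ?_) (integral_nonneg fun ω => sq_nonneg _)
      (by positivity)
    · gcongr
    · gcongr
  have h2N : (2 : ℝ) ^ N = 4 * 2 ^ (N - 2) := by
    obtain ⟨k, rfl⟩ : ∃ k, N = k + 2 := ⟨N - 2, by omega⟩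
    simp only [Nat.add_sub_cancel, pow_add]; ring
  -- Cauchy–Schwarz over the 2^N subsets: the square of 2^{N-2} times the double sum is at most 2^N
  -- ∑ F², and 2^N = 4 · 2^{N-2}.
  have hpw : ∀ ω, (∑ l ∈ R, ∑ m ∈ R.erase l, Y l ω * W m ω) ^ 2 ≤
      4 / 2 ^ (N - 2) * ∑ A ∈ R.powerset, F A ω ^ 2 := by
    intro ω
    have h1 := sq_sum_le_card_mul_sum_sq (s := R.powerset) (f := fun A => F A ω)
    simp only [F] at h1 ⊢
    rw [sum_powerset_mul_sum_sdiff R (fun l => Y l ω) (fun l => W l ω), Finset.card_powerset, hRc] at h1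
    push_cast at h1
    rw [h2N, mul_pow] at h1
    have hp : (0 : ℝ) < 2 ^ (N - 2) := by positivity
    rw [div_mul_eq_mul_div, le_div_iff₀ hp]
    refine le_of_mul_le_mul_left ?_ hp
    calc _ = _ := by ring
      _ ≤ _ := h1
      _ = _ := by ring
  have hint : Integrable (fun ω => 4 / 2 ^ (N - 2) * ∑ A ∈ R.powerset, F A ω ^ 2) P :=
    (integrable_finsetSum _ fun A hA => (hF A hA).1).const_mul _
  have hmeas : Measurable fun ω => (∑ l ∈ R, ∑ m ∈ R.erase l, Y l ω * W m ω) ^ 2 := by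
    refine Measurable.pow_const (Finset.measurable_sum _ fun l _ => Finset.measurable_sum _ fun m _ =>
      (hYm l).mul (hWm m)) 2
  refine ⟨hint.mono' hmeas.aestronglyMeasurable (Filter.Eventually.of_forall fun ω => ?_), ?_⟩
  · rw [Real.norm_of_nonneg (sq_nonneg _)]
    exact hpw ω
  · refine (integral_mono_of_nonneg (Filter.Eventually.of_forall fun ω => sq_nonneg _) hint
      (Filter.Eventually.of_forall hpw)).trans ?_
    rw [integral_const_mul, integral_finsetSum _ fun A hA => (hF A hA).1]
    -- The 2^N subsets together with the prefactor 4 / 2^{N-2} yield the constant 16.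
    have h1 : ∑ A ∈ R.powerset, ∫ ω, F A ω ^ 2 ∂P ≤ 2 ^ N * D := by
      refine (Finset.sum_le_card_nsmul _ _ D fun A hA => (hF A hA).2).trans (le_of_eq ?_)
      rw [Finset.card_powerset, hRc, nsmul_eq_mul]
      push_cast
      ring
    have hp : (0 : ℝ) < 2 ^ (N - 2) := by positivity
    rw [div_mul_eq_mul_div, div_le_iff₀ hp]
    rw [h2N] at h1
    linarith

theorem integral_offDiag {Y W : ℕ → Ω → ℝ} {α β : ℝ}
    (hY : ∀ l, Integrable (Y l) P) (hW : ∀ l, Integrable (W l) P)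
    (hind : iIndepFun (fun l ω => (Y l ω, W l ω)) P)
    (hα : ∀ l, ∫ ω, Y l ω ∂P = α) (hβ : ∀ l, ∫ ω, W l ω ∂P = β) (N : ℕ) :
    ∫ ω, ∑ l ∈ range N, ∑ m ∈ (range N).erase l, Y l ω * W m ω ∂P =
      (N : ℝ) * ((N : ℝ) - 1) * (α * β) := by
  have h1 : ∀ l m, l ≠ m → IndepFun (Y l) (W m) P := fun l m hlm =>
    (hind.indepFun hlm).comp (φ := Prod.fst) (ψ := Prod.snd) measurable_fst measurable_snd
  have i1 : ∀ l m, l ≠ m → Integrable (fun ω => Y l ω * W m ω) P := fun l m hlm =>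
    (h1 l m hlm).integrable_mul (hY l) (hW m)
  rw [integral_finsetSum _ fun l _ => integrable_finsetSum _ fun m hm =>
    i1 l m (Finset.ne_of_mem_erase hm).symm]
  have h2 : ∀ l ∈ range N, ∫ ω, ∑ m ∈ (range N).erase l, Y l ω * W m ω ∂P =
      ((N : ℝ) - 1) * (α * β) := by
    intro l hl
    rw [integral_finsetSum _ fun m hm => i1 l m (Finset.ne_of_mem_erase hm).symm]
    have h3 : ∀ m ∈ (range N).erase l, ∫ ω, Y l ω * W m ω ∂P = α * β := by
      intro m hm
      rw [(h1 l m (Finset.ne_of_mem_erase hm).symm).integral_fun_mul_eq_mul_integral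
        (hY l).aestronglyMeasurable (hW m).aestronglyMeasurable, hα, hβ]
    rw [Finset.sum_congr rfl h3, Finset.sum_const, Finset.card_erase_of_mem hl, card_range,
      nsmul_eq_mul]
    rw [Finset.mem_range] at hl
    rw [Nat.cast_sub (by omega)]
    simp
  rw [Finset.sum_congr rfl h2, Finset.sum_const, card_range, nsmul_eq_mul]
  ring

end UStatistic

/-! ### Independence of the subjects and of their sampling designs -/

section Independence

variable {Ω : Type*} [MeasurableSpace Ω] {P : Measure Ω}

/-- Two independent families, each of them consisting of independent random variables, give an
independent family of pairs. -/
theorem iIndepFun_prodMk {ι β γ : Type*} [MeasurableSpace β] [MeasurableSpace γ]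
    {f : ι → Ω → β} {g : ι → Ω → γ} (hf : iIndepFun f P) (hg : iIndepFun g P)
    (hfm : ∀ i, Measurable (f i)) (hgm : ∀ i, Measurable (g i))
    (hfg : IndepFun (fun ω i => f i ω) (fun ω i => g i ω) P) :
    iIndepFun (fun i ω => (f i ω, g i ω)) P := by
  rw [iIndepFun_iff_iIndep]
  -- It suffices to test rectangles, which form a π-system generating the product σ-algebra.
  refine iIndepSets.iIndep (fun i => ((hfm i).prodMk (hgm i)).comap_le)
    (fun i => Set.preimage (fun ω => (f i ω, g i ω)) ''
      (Set.image2 (· ×ˢ ·) {s : Set β | MeasurableSet s} {t : Set γ | MeasurableSet t}))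
    (fun i => ?_) (fun i => ?_) ?_
  · exact isPiSystem_prod.comap _
  · rw [← MeasurableSpace.comap_generateFrom, generateFrom_prod]
  · rw [iIndepSets_iff]
    intro S u hu
    have h1 : ∀ i : ι, ∃ ab : Set β × Set γ, MeasurableSet ab.1 ∧ MeasurableSet ab.2 ∧
        (i ∈ S → u i = f i ⁻¹' ab.1 ∩ g i ⁻¹' ab.2) := by
      intro i
      by_cases hi : i ∈ S
      · obtain ⟨_, ⟨a, ha, b, hb, rfl⟩, h2⟩ := hu i hi
        exact ⟨(a, b), ha, hb, fun _ => h2.symm⟩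
      · exact ⟨(Set.univ, Set.univ), MeasurableSet.univ, MeasurableSet.univ, fun h => absurd h hi⟩
    choose ab ha hb hab using h1
    have h2 : ∀ A B, MeasurableSet A → MeasurableSet B →
        P ((fun ω i => f i ω) ⁻¹' A ∩ (fun ω i => g i ω) ⁻¹' B) =
          P ((fun ω i => f i ω) ⁻¹' A) * P ((fun ω i => g i ω) ⁻¹' B) := fun A B hA hB =>
      hfg.measure_inter_preimage_eq_mul A B hA hB
    have h3 : ∀ i ∈ S, P (u i) = P (f i ⁻¹' (ab i).1) * P (g i ⁻¹' (ab i).2) := by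
      intro i hi
      rw [hab i hi]
      exact h2 ((fun x => x i) ⁻¹' (ab i).1) ((fun x => x i) ⁻¹' (ab i).2)
        (measurable_pi_apply i (ha i)) (measurable_pi_apply i (hb i))
    -- An intersection of rectangles splits into an event of the family f and one of the family g.
    -- These are independent of each other, and each then factors within its own family.
    have h4 : ⋂ i ∈ S, u i = (⋂ i ∈ S, f i ⁻¹' (ab i).1) ∩ ⋂ i ∈ S, g i ⁻¹' (ab i).2 := by
      rw [Set.iInter₂_congr hab]
      simp only [Set.iInter_inter_distrib]
    have h5 : (⋂ i ∈ S, f i ⁻¹' (ab i).1) =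
        (fun ω i => f i ω) ⁻¹' (⋂ i ∈ S, (fun x => x i) ⁻¹' (ab i).1) := by
      simp only [Set.preimage_iInter]; rfl
    have h6 : (⋂ i ∈ S, g i ⁻¹' (ab i).2) =
        (fun ω i => g i ω) ⁻¹' (⋂ i ∈ S, (fun x => x i) ⁻¹' (ab i).2) := by
      simp only [Set.preimage_iInter]; rfl
    rw [h4, Finset.prod_congr rfl h3, Finset.prod_mul_distrib,
      ← hf.measure_inter_preimage_eq_mul S fun i _ => ha i,
      ← hg.measure_inter_preimage_eq_mul S fun i _ => hb i, h5, h6]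
    refine h2 _ _ ?_ ?_
    · exact S.measurableSet_biInter fun i _ => measurable_pi_apply i (ha i)
    · exact S.measurableSet_biInter fun i _ => measurable_pi_apply i (hb i)

/-- The law of an independent array is a product measure, and currying turns a product over pairs
into a product of products. -/
theorem iIndepFun_rows [IsProbabilityMeasure P] {ι κ β : Type*} [MeasurableSpace β]
    {f : ι → κ → Ω → β}
    (hf : iIndepFun (fun p : ι × κ => f p.1 p.2) P) (hfm : ∀ i j, Measurable (f i j)) :
    iIndepFun (fun i ω l => f i l ω) P := by
  have : ∀ i j, IsProbabilityMeasure (P.map (f i j)) :=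
    fun i j => Measure.isProbabilityMeasure_map (hfm i j).aemeasurable
  have h1 : (MeasurableEquiv.curry ι κ β) ∘ (fun ω (p : ι × κ) => f p.1 p.2 ω) =
      fun ω i l => f i l ω := rfl
  have h2 : ∀ i, iIndepFun (fun l => f i l) P := fun i =>
    hf.precomp (g := fun l : κ => (i, l)) fun l m hlm => (Prod.mk.inj hlm).2
  rw [iIndepFun_iff_map_fun_eq_infinitePi_map (fun i => measurable_pi_lambda _ fun l => hfm i l),
    ← h1, ← Measure.map_map (by fun_prop)
      (measurable_pi_lambda (fun ω (p : ι × κ) => f p.1 p.2 ω) fun p => hfm p.1 p.2),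
    iIndepFun.map_fun_eq_infinitePi_map (X := fun p : ι × κ => f p.1 p.2)
      (fun p => hfm p.1 p.2) hf,
    Measure.infinitePi_map_curry fun i j => P.map (f i j)]
  congr 1
  funext i
  rw [iIndepFun.map_fun_eq_infinitePi_map (X := fun l => f i l) (fun l => hfm i l) (h2 i)]

variable {X : ℕ → Ω → I → ℝ} {T : ℕ → ℕ → Ω → I} {ε : ℕ → ℕ → Ω → ℝ}

/-- The sampling points and the errors of the subject `i`. -/
def design (T : ℕ → ℕ → Ω → I) (ε : ℕ → ℕ → Ω → ℝ) (i : ℕ) (ω : Ω) : (ℕ → I) × (ℕ → ℝ) :=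
  (fun l => T i l ω, fun l => ε i l ω)

theorem IsSamplingModel.measurable_design (hm : IsSamplingModel P X T ε) (i : ℕ) :
    Measurable (design T ε i) :=
  (measurable_pi_lambda _ fun l => hm.measurable_T i l).prodMk
    (measurable_pi_lambda _ fun l => hm.measurable_ε i l)

theorem IsSamplingModel.indepFun_design (hm : IsSamplingModel P X T ε) (i : ℕ) :
    IndepFun (X i) (design T ε i) P :=
  hm.indep_X_Tε.comp (φ := fun x : ℕ → I → ℝ => x i)
    (ψ := fun p : (ℕ × ℕ → I) × (ℕ × ℕ → ℝ) =>
      ((fun l => p.1 (i, l) : ℕ → I), (fun l => p.2 (i, l) : ℕ → ℝ)))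
    (measurable_pi_apply i) (by fun_prop)

theorem IsSamplingModel.iIndepFun_design_apply (hm : IsSamplingModel P X T ε) (i : ℕ) :
    iIndepFun (fun l ω => (T i l ω, ε i l ω)) P := by
  have h1 := iIndepFun_prodMk hm.iIndepFun_T hm.iIndepFun_ε (fun p => hm.measurable_T p.1 p.2)
    (fun p => hm.measurable_ε p.1 p.2) hm.indep_T_ε
  exact h1.precomp (g := fun l : ℕ => (i, l)) fun l m hlm => (Prod.mk.inj hlm).2

theorem IsSamplingModel.iIndepFun_design [IsProbabilityMeasure P] (hm : IsSamplingModel P X T ε) :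
    iIndepFun (fun i ω => (X i ω, design T ε i ω)) P := by
  have h1 : iIndepFun (design T ε) P := by
    refine iIndepFun_prodMk (iIndepFun_rows hm.iIndepFun_T hm.measurable_T)
      (iIndepFun_rows hm.iIndepFun_ε hm.measurable_ε)
      (fun i => measurable_pi_lambda _ fun l => hm.measurable_T i l)
      (fun i => measurable_pi_lambda _ fun l => hm.measurable_ε i l) ?_
    exact hm.indep_T_ε.comp (φ := fun (x : ℕ × ℕ → I) i l => x (i, l))
      (ψ := fun (x : ℕ × ℕ → ℝ) i l => x (i, l)) (by fun_prop) (by fun_prop)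
  refine iIndepFun_prodMk hm.iIndepFun_X h1 hm.measurable_X hm.measurable_design ?_
  exact hm.indep_X_Tε.comp (φ := id)
    (ψ := fun (p : (ℕ × ℕ → I) × (ℕ × ℕ → ℝ)) i =>
      ((fun l => p.1 (i, l) : ℕ → I), (fun l => p.2 (i, l) : ℕ → ℝ)))
    measurable_id (by fun_prop)

/-- The joint law of a path and of the design of the same subject is that of a copy of `X 0` and
of an independent copy of the design. -/
theorem IsSamplingModel.map_path_design [IsProbabilityMeasure P] (hm : IsSamplingModel P X T ε)
    (i : ℕ) : P.map (fun ω => (X i ω, design T ε i ω)) =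
      (P.prod P).map (fun p => (X 0 p.1, design T ε i p.2)) := by
  rw [(hm.indepFun_design i).map_prod_eq_prod_map_map (hm.measurable_X i).aemeasurable
    (hm.measurable_design i).aemeasurable, (hm.identDistrib_X i).map_eq]
  exact Measure.map_prod_map _ _ (hm.measurable_X 0) (hm.measurable_design i)

theorem IsSamplingModel.indepFun_T_ε (hm : IsSamplingModel P X T ε) (i l : ℕ) :
    IndepFun (T i l) (ε i l) P :=
  hm.indep_T_ε.comp (φ := fun x : ℕ × ℕ → I => x (i, l)) (ψ := fun x : ℕ × ℕ → ℝ => x (i, l))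
    (measurable_pi_apply _) (measurable_pi_apply _)

/-- A path functional which represents the paths of `X 0` represents those of every `X i`
at the sampling points. -/
theorem IsSamplingModel.ae_apply_eq [IsProbabilityMeasure P] (hm : IsSamplingModel P X T ε)
    {g : (I → ℝ) × I → ℝ} (hg : Measurable g) (hg0 : ∀ ω t, X 0 ω t = g (X 0 ω, t)) (i l : ℕ) :
    ∀ᵐ ω ∂P, X i ω (T i l ω) = g (X i ω, T i l ω) := by
  obtain ⟨f, hf, hfX⟩ := hm.jointly_measurable_X i
  have hTm := hm.measurable_T i l
  have hXm := hm.measurable_X i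
  have hind : IndepFun (X i) (T i l) P :=
    (hm.indepFun_design i).comp (φ := id) (ψ := fun p : (ℕ → I) × (ℕ → ℝ) => p.1 l) measurable_id (by fun_prop)
  have hmeas : MeasurableSet {p : (I → ℝ) × I | f p = g p} := measurableSet_eq_fun hf hg
  -- The functionals representing `X i` and `X 0` may differ. For fixed t, however, both agree with
  -- evaluation at t almost surely under the common law of the paths.
  have hpt : ∀ t : I, ∀ᵐ x ∂(P.map (X i)), f (x, t) = g (x, t) := by
    intro t
    have h1 : ∀ᵐ x ∂(P.map (X i)), f (x, t) = x t := by
      rw [ae_map_iff hXm.aemeasurable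
        (measurableSet_eq_fun (f := fun x => f (x, t)) (hf.comp measurable_prodMk_right) (measurable_pi_apply t))]
      exact Filter.Eventually.of_forall fun ω => (hfX ω t).symm
    have h2 : ∀ᵐ x ∂(P.map (X i)), g (x, t) = x t := by
      rw [(hm.identDistrib_X i).map_eq, ae_map_iff (hm.measurable_X 0).aemeasurable
        (measurableSet_eq_fun (f := fun x => g (x, t)) (hg.comp measurable_prodMk_right) (measurable_pi_apply t))]
      exact Filter.Eventually.of_forall fun ω => (hg0 ω t).symm
    filter_upwards [h1, h2] with x h3 h4
    rw [h3, h4]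
  have : IsProbabilityMeasure (P.map (X i)) := Measure.isProbabilityMeasure_map hXm.aemeasurable
  have : IsProbabilityMeasure (P.map (T i l)) := Measure.isProbabilityMeasure_map hTm.aemeasurable
  -- Fubini's theorem passes from each fixed t to the product law, which by independence is the law
  -- of the pair formed by the path and the sampling point.
  have hprod : ∀ᵐ p ∂((P.map (X i)).prod (P.map (T i l))), f p = g p := by
    rw [← Measure.prod_swap]
    rw [ae_map_iff measurable_swap.aemeasurable hmeas]
    rw [Measure.ae_prod_iff_ae_ae (p := fun x : I × (I → ℝ) => f x.swap = g x.swap)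
      (measurable_swap hmeas)]
    exact Filter.Eventually.of_forall hpt
  rw [← hind.map_prod_eq_prod_map_map hXm.aemeasurable hTm.aemeasurable,
    ae_map_iff (hXm.prodMk hTm).aemeasurable hmeas] at hprod
  filter_upwards [hprod] with ω hω
  rw [hfX, hω]

end Independence

/-! ### Pairing kernels with functions; reduction to the smoothed functions -/

section Bilinear

/-- The iterated integral of `A (s, t) p (s) q (t)` exists and has the value `v`. -/
structure HasBilin (A : I → I → ℝ) (p q : I → ℝ) (v : ℝ) : Prop where
  inner : ∀ t, Integrable fun s => A s t * p s
  outer : Integrable fun t => (∫ s, A s t * p s) * q t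
  eq : ∫ t, (∫ s, A s t * p s) * q t = v

variable {A B : I → I → ℝ} {p q : I → ℝ} {v w : ℝ}

theorem HasBilin.sub (hA : HasBilin A p q v) (hB : HasBilin B p q w) :
    HasBilin (fun s t => A s t - B s t) p q (v - w) := by
  have h1 : ∀ t, (∫ s, (A s t - B s t) * p s) * q t =
      (∫ s, A s t * p s) * q t - (∫ s, B s t * p s) * q t := by
    intro t
    rw [← sub_mul, ← integral_sub (hA.inner t) (hB.inner t)]
    simp_rw [sub_mul]
  refine ⟨fun t => ?_, ?_, ?_⟩
  · simp_rw [sub_mul]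
    exact (hA.inner t).sub (hB.inner t)
  · simp_rw [h1]
    exact hA.outer.sub hB.outer
  · simp_rw [h1]
    rw [integral_sub hA.outer hB.outer, hA.eq, hB.eq]

theorem HasBilin.const_mul (hA : HasBilin A p q v) (c : ℝ) :
    HasBilin (fun s t => c * A s t) p q (c * v) := by
  have h1 : ∀ t, (∫ s, c * A s t * p s) * q t = c * ((∫ s, A s t * p s) * q t) := by
    intro t
    simp_rw [mul_assoc]
    rw [integral_const_mul, mul_assoc]
  refine ⟨fun t => ?_, ?_, ?_⟩
  · simp_rw [mul_assoc]
    exact (hA.inner t).const_mul c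
  · simp_rw [h1]
    exact hA.outer.const_mul c
  · simp_rw [h1]
    rw [integral_const_mul, hA.eq]

theorem HasBilin.sum {ι : Type*} {S : Finset ι} {A : ι → I → I → ℝ} {v : ι → ℝ}
    (hA : ∀ i ∈ S, HasBilin (A i) p q (v i)) :
    HasBilin (fun s t => ∑ i ∈ S, A i s t) p q (∑ i ∈ S, v i) := by
  have h1 : ∀ t, (∫ s, (∑ i ∈ S, A i s t) * p s) * q t =
      ∑ i ∈ S, (∫ s, A i s t * p s) * q t := by
    intro t
    simp_rw [Finset.sum_mul]
    rw [integral_finsetSum _ fun i hi => (hA i hi).inner t, Finset.sum_mul]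
  refine ⟨fun t => ?_, ?_, ?_⟩
  · simp_rw [Finset.sum_mul]
    exact integrable_finsetSum _ fun i hi => (hA i hi).inner t
  · simp_rw [h1]
    exact integrable_finsetSum _ fun i hi => (hA i hi).outer
  · simp_rw [h1]
    rw [integral_finsetSum _ fun i hi => (hA i hi).outer]
    exact Finset.sum_congr rfl fun i hi => (hA i hi).eq

theorem hasBilin_mul {u w : I → ℝ} (hu : Integrable fun s => u s * p s)
    (hw : Integrable fun t => w t * q t) :
    HasBilin (fun s t => u s * w t) p q ((∫ s, u s * p s) * ∫ t, w t * q t) := by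
  have h0 : ∀ s t, u s * w t * p s = w t * (u s * p s) := fun s t => by ring
  have h1 : ∀ t, (∫ s, u s * w t * p s) * q t = (∫ s, u s * p s) * (w t * q t) := by
    intro t
    simp_rw [h0]
    rw [integral_const_mul]
    ring
  refine ⟨fun t => ?_, ?_, ?_⟩
  · simp_rw [h0]
    exact hu.const_mul _
  · simp_rw [h1]
    exact hw.const_mul _
  · simp_rw [h1]
    rw [integral_const_mul]

theorem HasBilin.congr (hA : HasBilin A p q v) (h : ∀ s t, A s t = B s t) : HasBilin B p q v := by
  have : A = B := funext fun s => funext fun t => h s t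
  rwa [← this]

variable {Ω : Type*} {X : ℕ → Ω → I → ℝ} {T : ℕ → ℕ → Ω → I}
  {ε : ℕ → ℕ → Ω → ℝ} {K : ℝ → ℝ} {h : ℝ}

/-- The contribution of a subject with observations `y` at the points `τ` to the pairing of the
covariance estimator with a pair of functions, in terms of the smoothed functions `p` and `q`. -/
noncomputable def subjectStat (N : ℕ) (p q : I → ℝ) (τ : ℕ → I) (y : ℕ → ℝ) : ℝ :=
  (1 / ((N : ℝ) * ((N : ℝ) - 1))) *
    ∑ l ∈ range N, ∑ m ∈ (range N).erase l, (p (τ l) * y l) * (q (τ m) * y m)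

/-- The estimator is a finite sum of products of a kernel in s and a kernel in t. Integrating each
against p or q produces a smoothed function at a sampling point; the factor h⁻² is shared between
the two normalised kernels. -/
theorem IsKernel.hasBilin_covEstimator (hK : IsKernel K) (hh : 0 < h) (hp : Integrable p)
    (hq : Integrable q) (n N : ℕ) (ω : Ω) :
    HasBilin (covEstimator K X T ε n N h ω) p q ((1 / (n : ℝ)) * ∑ i ∈ range n,
      subjectStat N (smooth K h p) (smooth K h q) (fun l => T i l ω)
        (fun l => obs X T ε i l ω)) := by
  have h1 : HasBilin (fun s t => (1 / (n : ℝ)) * ∑ i ∈ range n,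
      (1 / ((N : ℝ) * ((N : ℝ) - 1))) * ∑ l ∈ range N, ∑ m ∈ (range N).erase l,
        (obs X T ε i l ω * obs X T ε i m ω) *
          (smoothKernel K h (T i l ω) s * smoothKernel K h (T i m ω) t)) p q
      ((1 / (n : ℝ)) * ∑ i ∈ range n,
        (1 / ((N : ℝ) * ((N : ℝ) - 1))) * ∑ l ∈ range N, ∑ m ∈ (range N).erase l,
          (obs X T ε i l ω * obs X T ε i m ω) *
            (smooth K h p (T i l ω) * smooth K h q (T i m ω))) := by
    refine (HasBilin.sum fun i _ => (HasBilin.sum fun l _ => HasBilin.sum fun m _ =>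
      ((hasBilin_mul ?_ ?_).const_mul _)).const_mul _).const_mul _
    · exact hK.integrable_smoothKernel_mul hh hp _
    · exact hK.integrable_smoothKernel_mul hh hq _
  have h2 : (1 / (n : ℝ)) * ∑ i ∈ range n,
      subjectStat N (smooth K h p) (smooth K h q) (fun l => T i l ω)
        (fun l => obs X T ε i l ω) = (1 / (n : ℝ)) * ∑ i ∈ range n,
        (1 / ((N : ℝ) * ((N : ℝ) - 1))) * ∑ l ∈ range N, ∑ m ∈ (range N).erase l,
          (obs X T ε i l ω * obs X T ε i m ω) *
            (smooth K h p (T i l ω) * smooth K h q (T i m ω)) := by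
    unfold subjectStat
    congr 1
    refine Finset.sum_congr rfl fun i _ => ?_
    congr 1
    refine Finset.sum_congr rfl fun l _ => Finset.sum_congr rfl fun m _ => ?_
    ring
  rw [h2]
  refine h1.congr fun s t => ?_
  unfold covEstimator
  congr 1
  refine Finset.sum_congr rfl fun i _ => ?_
  rw [mul_assoc (1 / ((N : ℝ) * ((N : ℝ) - 1)))]
  congr 1
  rw [Finset.mul_sum]
  refine Finset.sum_congr rfl fun l _ => ?_
  rw [Finset.mul_sum]
  refine Finset.sum_congr rfl fun m _ => ?_
  unfold smoothKernel
  field_simp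

end Bilinear

/-! ### The covariance function in the eigenbasis -/

section Covariance

variable {C : I → I → ℝ} {lam : ℕ → ℝ} {φ : ℕ → ℝ → ℝ} {c : ℝ}

theorem abs_integral_mul_le {f g : I → ℝ} {b d : ℝ} (hf : ∀ t, |f t| ≤ b) (hg : ∀ t, |g t| ≤ d) :
    |∫ t, f t * g t| ≤ b * d := by
  rw [← Real.norm_eq_abs]
  have h1 := norm_integral_le_of_norm_le_const (μ := (volume : Measure I)) (f := fun t => f t * g t)
    (C := b * d) (Filter.Eventually.of_forall fun t => ?_)
  · simpa using h1
  · rw [norm_mul]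
    exact mul_le_mul (hf t) (hg t) (norm_nonneg _) ((abs_nonneg _).trans (hf t))

theorem integrable_of_abs_le {f : I → ℝ} {b : ℝ} (hf : Measurable f) (hb : ∀ t, |f t| ≤ b) :
    Integrable f :=
  memLp_one_iff_integrable.1 (memLp_of_abs_le hf hb 1)

/-- Termwise integration under a summable majorant. Measurability and boundedness of the sum come
along because the inner integral must itself be integrated again. -/
theorem hasSum_integral_of_abs_le {F : ℕ → I → ℝ} {G : I → ℝ} {u : ℕ → ℝ}
    (hF : ∀ r, Measurable (F r)) (hb : ∀ r t, |F r t| ≤ u r) (hu : Summable u)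
    (hG : ∀ t, HasSum (fun r => F r t) (G t)) :
    HasSum (fun r => ∫ t, F r t) (∫ t, G t) ∧ Measurable G ∧ ∀ t, |G t| ≤ ∑' r, u r := by
  refine ⟨?_, ?_, fun t => ?_⟩
  · have h1 := hasSum_integral_of_summable_integral_norm (μ := (volume : Measure I)) (F := F)
      (fun r => integrable_of_abs_le (hF r) (hb r)) (by
        refine Summable.of_nonneg_of_le (fun r => integral_nonneg fun s => norm_nonneg _)
          (fun r => ?_) hu
        calc ∫ t, ‖F r t‖ ≤ ∫ _ : I, u r :=
              integral_mono (integrable_of_abs_le (hF r) (hb r)).norm (integrable_const _) (hb r)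
          _ = u r := by simp)
    simp_rw [fun t => (hG t).tsum_eq] at h1
    exact h1
  · refine measurable_of_tendsto_metrizable (f := fun n t => ∑ r ∈ range n, F r t) (fun n => ?_) ?_
    · exact Finset.measurable_sum _ fun r _ => hF r
    · rw [tendsto_pi_nhds]
      exact fun t => (hG t).tendsto_sum_nat
  · rw [← Real.norm_eq_abs, ← (hG t).tsum_eq]
    exact tsum_of_norm_bounded hu.hasSum fun r => hb r t

/-- The covariance function acts diagonally in the eigenbasis. -/
theorem IsEigenExpansion.hasBilin (he : IsEigenExpansion C lam φ)
    (hs : SmoothEigenfunctions c φ) (hlam : Summable fun k => lam (k + 1)) {p q : I → ℝ} {b d : ℝ}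
    (hp : Measurable p) (hpb : ∀ t, |p t| ≤ b) (hq : Measurable q) (hqb : ∀ t, |q t| ≤ d) :
    ∃ v, HasBilin C p q v ∧
      HasSum (fun r => lam (r + 1) * ((∫ t : I, p t * φ (r + 1) t) * ∫ t : I, q t * φ (r + 1) t)) v := by
  obtain ⟨B, hB⟩ := hs.bounded
  have hB0 : 0 ≤ B := (abs_nonneg _).trans (hB 1 le_rfl 0)
  have hb0 : 0 ≤ b := (abs_nonneg _).trans (hpb 0)
  have hl : ∀ r, 0 ≤ lam (r + 1) := fun r => (he.pos _ (by omega)).le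
  have hφ : ∀ r (t : I), |φ (r + 1) t| ≤ B := fun r t => hB _ (by omega) t
  have hφm : ∀ r, Measurable fun t : I => φ (r + 1) t := fun r => hs.measurable (by omega)
  have hpi : ∀ r, |∫ t : I, p t * φ (r + 1) t| ≤ b * B := fun r => abs_integral_mul_le hpb (hφ r)
  have hmul : ∀ x y z x' y' z' : ℝ, |x| ≤ x' → |y| ≤ y' → |z| ≤ z' → |x * y * z| ≤ x' * y' * z' := by
    intro x y z x' y' z' hx hy hz
    rw [abs_mul, abs_mul]
    have := (abs_nonneg _).trans hx
    have := (abs_nonneg _).trans hy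
    gcongr
  have hl' : ∀ r, |lam (r + 1)| ≤ lam (r + 1) := fun r => (abs_of_nonneg (hl r)).le
  -- Integration in s for fixed t, with a majorant proportional to the summable eigenvalues; `h2`
  -- repeats this in t.
  have h1 : ∀ t : I, _ := fun t : I => hasSum_integral_of_abs_le
    (F := fun r (s : I) => lam (r + 1) * φ (r + 1) s * φ (r + 1) t * p s)
    (G := fun s => C s t * p s) (u := fun r => lam (r + 1) * B * B * b)
    (fun r => (((hφm r).const_mul _).mul_const _).mul hp)
    (fun r s => hmul _ _ _ _ _ _ (by rw [abs_mul]; exact mul_le_mul (hl' r) (hφ r s) (abs_nonneg _) (hl r))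
      (hφ r t) (hpb s))
    (((hlam.mul_right B).mul_right B).mul_right b)
    (fun s => (he.hasSum s t).mul_right _)
  have hinner : ∀ t : I, HasSum (fun r => lam (r + 1) * (∫ s : I, p s * φ (r + 1) s) * φ (r + 1) t)
      (∫ s, C s t * p s) := by
    intro t
    have h3 := (h1 t).1
    have h4 : ∀ r, ∫ s : I, lam (r + 1) * φ (r + 1) s * φ (r + 1) t * p s =
        lam (r + 1) * (∫ s : I, p s * φ (r + 1) s) * φ (r + 1) t := by
      intro r
      rw [mul_right_comm, ← integral_const_mul]
      exact integral_congr_ae (Filter.Eventually.of_forall fun s => by simp only; ring)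
    simpa only [h4] using h3
  have h2 := hasSum_integral_of_abs_le
    (F := fun r (t : I) => lam (r + 1) * (∫ s : I, p s * φ (r + 1) s) * φ (r + 1) t * q t)
    (G := fun t => (∫ s, C s t * p s) * q t) (u := fun r => lam (r + 1) * (b * B) * B * d)
    (fun r => ((hφm r).const_mul _).mul hq)
    (fun r t => hmul _ _ _ _ _ _ (by rw [abs_mul]; exact mul_le_mul (hl' r) (hpi r) (abs_nonneg _) (hl r))
      (hφ r t) (hqb t))
    (((hlam.mul_right _).mul_right _).mul_right _)
    (fun t => (hinner t).mul_right _)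
  refine ⟨_, ⟨fun t => integrable_of_abs_le (h1 t).2.1 (h1 t).2.2,
    integrable_of_abs_le h2.2.1 h2.2.2, rfl⟩, ?_⟩
  have h3 := h2.1
  have h4 : ∀ r, ∫ t : I, lam (r + 1) * (∫ s : I, p s * φ (r + 1) s) * φ (r + 1) t * q t =
      lam (r + 1) * ((∫ t : I, p t * φ (r + 1) t) * ∫ t : I, q t * φ (r + 1) t) := by
    intro r
    rw [← mul_assoc, ← integral_const_mul (lam (r + 1) * ∫ t : I, p t * φ (r + 1) t)]
    exact integral_congr_ae (Filter.Eventually.of_forall fun s => by simp only; ring)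
  simpa only [h4] using h3

end Covariance

/-! ### Contribution of one subject, first for a fixed path and then in the mean -/

section Subject

variable {Ω : Type*} [MeasurableSpace Ω] {P : Measure Ω}
  {X : ℕ → Ω → I → ℝ} {T : ℕ → ℕ → Ω → I} {ε : ℕ → ℕ → Ω → ℝ}

/-- For a path `x` and a weight `p`, the second moment of an average of `N` weighted noisy values of
the path at uniform points, up to constants; `σ2` is the variance of the noise. -/
noncomputable def pathMoment (N : ℕ) (σ2 : ℝ) (p x : I → ℝ) : ℝ :=
  (∫ t, p t ^ 2 * (x t ^ 2 + σ2)) / N + (∫ t, x t * p t) ^ 2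

theorem pathMoment_nonneg {N : ℕ} {σ2 : ℝ} (hσ : 0 ≤ σ2) (p x : I → ℝ) :
    0 ≤ pathMoment N σ2 p x := by
  unfold pathMoment
  have : 0 ≤ ∫ t, p t ^ 2 * (x t ^ 2 + σ2) := integral_nonneg fun t => by
    simp only [Pi.zero_apply]; positivity
  positivity

theorem IsSamplingModel.measurePreserving_T (hm : IsSamplingModel P X T ε) (i l : ℕ) :
    MeasurePreserving (T i l) P volume := ⟨hm.measurable_T i l, hm.uniform_T i l⟩

theorem IsSamplingModel.memLp_ε_apply (hm : IsSamplingModel P X T ε) (i l : ℕ) :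
    MemLp (ε i l) 2 P := (hm.identDistrib_ε i l).memLp_iff.2 hm.memLp_ε

theorem IsSamplingModel.integral_comp_T (hm : IsSamplingModel P X T ε) (i l : ℕ) {f : I → ℝ}
    (hf : Measurable f) : ∫ ω, f (T i l ω) ∂P = ∫ t, f t := by
  rw [← hm.uniform_T i l, integral_map (hm.measurable_T i l).aemeasurable hf.aestronglyMeasurable]

/-- The error is centred and independent of the sampling point, so it leaves the mean unchanged and
only adds its variance to the second moment. Uniformity of the point turns expectations into
integrals. -/
theorem IsSamplingModel.weighted_obs [IsProbabilityMeasure P]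
    (hm : IsSamplingModel P X T ε) (i l : ℕ) {p x : I → ℝ} {b : ℝ}
    (hp : Measurable p) (hpb : ∀ t, |p t| ≤ b) (hx : Measurable x) (hx2 : MemLp x 2) :
    Measurable (fun ω => p (T i l ω) * (x (T i l ω) + ε i l ω)) ∧
    MemLp (fun ω => p (T i l ω) * (x (T i l ω) + ε i l ω)) 2 P ∧
    ∫ ω, p (T i l ω) * (x (T i l ω) + ε i l ω) ∂P = ∫ t, x t * p t ∧
    ∫ ω, (p (T i l ω) * (x (T i l ω) + ε i l ω)) ^ 2 ∂P =
      ∫ t, p t ^ 2 * (x t ^ 2 + ∫ ω, ε 0 0 ω ^ 2 ∂P) := by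
  have hT := hm.measurable_T i l
  have hε := hm.measurable_ε i l
  have mpT : MemLp (fun ω => p (T i l ω)) ⊤ P :=
    memLp_top_of_bound (hp.comp hT).aestronglyMeasurable b
      (Filter.Eventually.of_forall fun ω => hpb _)
  have mx : MemLp (fun ω => x (T i l ω)) 2 P := hx2.comp_measurePreserving (hm.measurePreserving_T i l)
  have me := hm.memLp_ε_apply i l
  have mpx : MemLp (fun ω => p (T i l ω) * x (T i l ω)) 2 P := mx.mul mpT
  have mpe : MemLp (fun ω => p (T i l ω) * ε i l ω) 2 P := me.mul mpT
  have ipe : IndepFun (fun ω => p (T i l ω)) (ε i l) P :=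
    (hm.indepFun_T_ε i l).comp (φ := p) (ψ := id) hp measurable_id
  have ip2x : IndepFun (fun ω => p (T i l ω) ^ 2 * x (T i l ω)) (ε i l) P :=
    (hm.indepFun_T_ε i l).comp (φ := fun t => p t ^ 2 * x t) (ψ := id) ((hp.pow_const 2).mul hx)
      measurable_id
  have ip2e : IndepFun (fun ω => p (T i l ω) ^ 2) (fun ω => ε i l ω ^ 2) P :=
    (hm.indepFun_T_ε i l).comp (φ := fun t => p t ^ 2) (ψ := fun e => e ^ 2) (hp.pow_const 2)
      (measurable_id.pow_const 2)
  have m0 : ∫ ω, ε i l ω ∂P = 0 := by rw [(hm.identDistrib_ε i l).integral_eq, hm.mean_ε]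
  have v0 : ∫ ω, ε i l ω ^ 2 ∂P = ∫ ω, ε 0 0 ω ^ 2 ∂P :=
    ((hm.identDistrib_ε i l).comp (u := fun e : ℝ => e ^ 2) (by fun_prop)).integral_eq
  refine ⟨(hp.comp hT).mul ((hx.comp hT).add hε), ?_, ?_, ?_⟩
  · simp_rw [mul_add]
    exact mpx.add mpe
  · simp_rw [mul_add]
    rw [integral_add (mpx.integrable (by norm_num)) (mpe.integrable (by norm_num)),
      ipe.integral_fun_mul_eq_mul_integral (hp.comp hT).aestronglyMeasurable
        hε.aestronglyMeasurable, m0, mul_zero, add_zero,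
      hm.integral_comp_T i l (f := fun t => p t * x t) (hp.mul hx)]
    simp_rw [mul_comm]
  · have h1 : ∀ ω, (p (T i l ω) * (x (T i l ω) + ε i l ω)) ^ 2 =
        (p (T i l ω) * x (T i l ω)) ^ 2 + 2 * (p (T i l ω) ^ 2 * x (T i l ω) * ε i l ω)
          + p (T i l ω) ^ 2 * ε i l ω ^ 2 := fun ω => by ring
    have j1 := mpx.integrable_sq
    have j2 : Integrable (fun ω => 2 * (p (T i l ω) ^ 2 * x (T i l ω) * ε i l ω)) P := by
      have : Integrable (fun ω => p (T i l ω) * x (T i l ω) * (p (T i l ω) * ε i l ω)) P :=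
        mpx.integrable_mul mpe
      refine (this.congr (Filter.Eventually.of_forall fun ω => ?_)).const_mul 2
      simp only
      ring
    have j3 : Integrable (fun ω => p (T i l ω) ^ 2 * ε i l ω ^ 2) P := by
      refine mpe.integrable_sq.congr (Filter.Eventually.of_forall fun ω => ?_)
      simp only
      ring
    have j12 : Integrable (fun ω => (p (T i l ω) * x (T i l ω)) ^ 2 +
        2 * (p (T i l ω) ^ 2 * x (T i l ω) * ε i l ω)) P := j1.add j2
    simp_rw [h1]
    rw [integral_add j12 j3, integral_add j1 j2, integral_const_mul,
      ip2x.integral_fun_mul_eq_mul_integral (((hp.pow_const 2).mul hx).comp hT).aestronglyMeasurable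
        hε.aestronglyMeasurable, m0, mul_zero, mul_zero, add_zero,
      ip2e.integral_fun_mul_eq_mul_integral ((hp.pow_const 2).comp hT).aestronglyMeasurable
        (hε.pow_const 2).aestronglyMeasurable, v0,
      hm.integral_comp_T i l (f := fun t => (p t * x t) ^ 2) ((hp.mul hx).pow_const 2),
      hm.integral_comp_T i l (f := fun t => p t ^ 2) (hp.pow_const 2), ← integral_mul_const]
    rw [← integral_add]
    · refine integral_congr_ae (Filter.Eventually.of_forall fun t => ?_)
      simp only
      ring
    · exact MemLp.integrable_sq (hx2.mul (memLp_of_abs_le hp hpb ⊤))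
    · exact ((memLp_of_abs_le hp hpb 2).integrable_sq).mul_const _

/-- First and second moment of the contribution of a subject with a given path. -/
theorem IsSamplingModel.subjectStat_of_path [IsProbabilityMeasure P]
    (hm : IsSamplingModel P X T ε) (i : ℕ) {p q x : I → ℝ}
    {b : ℝ} (hp : Measurable p) (hpb : ∀ t, |p t| ≤ b) (hq : Measurable q) (hqb : ∀ t, |q t| ≤ b)
    (hx : Measurable x) (hx2 : MemLp x 2) {N : ℕ} (hN : 2 ≤ N) :
    Integrable (fun ω => subjectStat N p q (fun l => T i l ω)
      (fun l => x (T i l ω) + ε i l ω) ^ 2) P ∧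
    ∫ ω, subjectStat N p q (fun l => T i l ω) (fun l => x (T i l ω) + ε i l ω) ^ 2 ∂P ≤
      64 * (pathMoment N (∫ ω, ε 0 0 ω ^ 2 ∂P) p x * pathMoment N (∫ ω, ε 0 0 ω ^ 2 ∂P) q x) ∧
    ∫ ω, subjectStat N p q (fun l => T i l ω) (fun l => x (T i l ω) + ε i l ω) ∂P =
      (∫ t, x t * p t) * ∫ t, x t * q t := by
  have hY := fun l => hm.weighted_obs i l hp hpb hx hx2
  have hW := fun l => hm.weighted_obs i l hq hqb hx hx2
  have hind : iIndepFun (fun l ω => (p (T i l ω) * (x (T i l ω) + ε i l ω),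
      q (T i l ω) * (x (T i l ω) + ε i l ω))) P := by
    refine (hm.iIndepFun_design_apply i).comp
      (fun _ z => (p z.1 * (x z.1 + z.2), q z.1 * (x z.1 + z.2))) fun _ => ?_
    exact ((hp.comp measurable_fst).mul ((hx.comp measurable_fst).add measurable_snd)).prodMk
      ((hq.comp measurable_fst).mul ((hx.comp measurable_fst).add measurable_snd))
  set σ2 := ∫ ω, ε 0 0 ω ^ 2 ∂P with hσ
  have hσ0 : 0 ≤ σ2 := integral_nonneg fun ω => sq_nonneg _
  obtain ⟨h1, h2⟩ := integral_offDiag_sq_le (fun l => (hY l).1) (fun l => (hW l).1)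
    (fun l => (hY l).2.1) (fun l => (hW l).2.1) hind (fun l => (hY l).2.2.1)
    (fun l => (hW l).2.2.1) (fun l => (hY l).2.2.2.le) (fun l => (hW l).2.2.2.le) hN
  have h3 := integral_offDiag (fun l => (hY l).2.1.integrable (by norm_num))
    (fun l => (hW l).2.1.integrable (by norm_num)) hind (fun l => (hY l).2.2.1)
    (fun l => (hW l).2.2.1) N
  have hN' : (2 : ℝ) ≤ N := by exact_mod_cast hN
  unfold subjectStat
  refine ⟨?_, ?_, ?_⟩
  · simp_rw [mul_pow _ _ 2]
    exact (h1.congr (Filter.Eventually.of_forall fun ω => rfl)).const_mul _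
  · simp_rw [mul_pow _ (Finset.sum _ _) 2]
    rw [integral_const_mul]
    -- N ≤ 2 (N - 1) for N ≥ 2. The resulting 4 times the 16 from decoupling is the 64 of the bound.
    have h4 : (1 / ((N : ℝ) * ((N : ℝ) - 1))) ^ 2 ≤ 4 / (N : ℝ) ^ 4 := by
      have h7 : (0 : ℝ) < N * ((N : ℝ) - 1) := mul_pos (by linarith) (by linarith)
      rw [div_pow, one_pow, div_le_div_iff₀ (pow_pos h7 2) (by positivity)]
      have h5 : (N : ℝ) ≤ 2 * ((N : ℝ) - 1) := by linarith
      have h6 : (N : ℝ) ^ 2 ≤ 2 * (N * ((N : ℝ) - 1)) := by nlinarith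
      nlinarith [sq_nonneg ((N : ℝ) ^ 2)]
    calc _ ≤ 4 / (N : ℝ) ^ 4 * _ := mul_le_mul h4 h2 (integral_nonneg fun ω => sq_nonneg _)
          (by positivity)
      _ = _ := by
        unfold pathMoment
        field_simp
        ring
  · have h7 : (0 : ℝ) < N * ((N : ℝ) - 1) := mul_pos (by linarith) (by linarith)
    rw [integral_const_mul, h3, ← mul_assoc, one_div, inv_mul_cancel₀ h7.ne', one_mul]

theorem measurable_subjectStat {E : Type*} [MeasurableSpace E] (N : ℕ) {p q : I → ℝ}
    (hp : Measurable p) (hq : Measurable q) {τ : E → ℕ → I} {y : E → ℕ → ℝ}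
    (hτ : ∀ l, Measurable fun e => τ e l) (hy : ∀ l, Measurable fun e => y e l) :
    Measurable fun e => subjectStat N p q (τ e) (y e) := by
  unfold subjectStat
  refine Measurable.const_mul (Finset.measurable_sum _ fun l _ => Finset.measurable_sum _ fun m _ =>
    ?_) _
  exact ((hp.comp (hτ l)).mul (hy l)).mul ((hq.comp (hτ m)).mul (hy m))

/-- The contribution of the subject `i`, with the path evaluated by means of `g`. -/
noncomputable def subjectVar (g : (I → ℝ) × I → ℝ) (N : ℕ) (p q : I → ℝ)
    (z : (I → ℝ) × ((ℕ → I) × (ℕ → ℝ))) : ℝ :=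
  subjectStat N p q z.2.1 (fun l => g (z.1, z.2.1 l) + z.2.2 l)

theorem measurable_subjectVar {g : (I → ℝ) × I → ℝ} (hg : Measurable g) (N : ℕ) {p q : I → ℝ}
    (hp : Measurable p) (hq : Measurable q) : Measurable (subjectVar g N p q) := by
  unfold subjectVar
  refine measurable_subjectStat N hp hq (fun l => by fun_prop) fun l => ?_
  exact (hg.comp (by fun_prop)).add (by fun_prop)

/-- Path and design are independent, so the moments can be computed on a product space. There the
path is held fixed, `subjectStat_of_path` applies to almost every path, and Fubini's theorem
averages the result. -/
theorem IsSamplingModel.subjectVar_moments [IsProbabilityMeasure P] (hm : IsSamplingModel P X T ε) (i : ℕ)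
    {g : (I → ℝ) × I → ℝ} (hg : Measurable g) (hg0 : ∀ ω t, X 0 ω t = g (X 0 ω, t)) {p q : I → ℝ}
    {b : ℝ} (hp : Measurable p) (hpb : ∀ t, |p t| ≤ b) (hq : Measurable q) (hqb : ∀ t, |q t| ≤ b)
    (hX2 : ∀ᵐ ω ∂P, MemLp (X 0 ω) 2) {N : ℕ} (hN : 2 ≤ N)
    (hint : Integrable (fun ω => pathMoment N (∫ ω, ε 0 0 ω ^ 2 ∂P) p (X 0 ω) *
      pathMoment N (∫ ω, ε 0 0 ω ^ 2 ∂P) q (X 0 ω)) P) :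
    MemLp (fun ω => subjectVar g N p q (X i ω, design T ε i ω)) 2 P ∧
    ∫ ω, subjectVar g N p q (X i ω, design T ε i ω) ^ 2 ∂P ≤
      64 * ∫ ω, pathMoment N (∫ ω, ε 0 0 ω ^ 2 ∂P) p (X 0 ω) *
        pathMoment N (∫ ω, ε 0 0 ω ^ 2 ∂P) q (X 0 ω) ∂P ∧
    ∫ ω, subjectVar g N p q (X i ω, design T ε i ω) ∂P =
      ∫ ω, (∫ t, X 0 ω t * p t) * (∫ t, X 0 ω t * q t) ∂P := by
  have hXd : Measurable fun ω => (X i ω, design T ε i ω) :=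
    (hm.measurable_X i).prodMk (hm.measurable_design i)
  have hXd2 : Measurable fun z : Ω × Ω => (X 0 z.1, design T ε i z.2) :=
    ((hm.measurable_X 0).comp measurable_fst).prodMk ((hm.measurable_design i).comp measurable_snd)
  have hV := measurable_subjectVar hg N hp hq
  have hV2 : Measurable fun z : Ω × Ω => subjectVar g N p q (X 0 z.1, design T ε i z.2) :=
    hV.comp hXd2
  have hcond : ∀ᵐ ω ∂P,
      Integrable (fun ω' => subjectVar g N p q (X 0 ω, design T ε i ω') ^ 2) P ∧
      ∫ ω', subjectVar g N p q (X 0 ω, design T ε i ω') ^ 2 ∂P ≤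
        64 * (pathMoment N (∫ ω, ε 0 0 ω ^ 2 ∂P) p (X 0 ω) *
          pathMoment N (∫ ω, ε 0 0 ω ^ 2 ∂P) q (X 0 ω)) ∧
      ∫ ω', subjectVar g N p q (X 0 ω, design T ε i ω') ∂P =
        (∫ t, X 0 ω t * p t) * ∫ t, X 0 ω t * q t := by
    filter_upwards [hX2] with ω hω
    have hxm : Measurable (X 0 ω) := by
      have : X 0 ω = fun t => g (X 0 ω, t) := funext (hg0 ω)
      rw [this]
      exact hg.comp measurable_prodMk_left
    have h1 := hm.subjectStat_of_path i hp hpb hq hqb hxm hω hN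
    simpa only [subjectVar, design, ← hg0] using h1
  have hI2 : Integrable (fun z : Ω × Ω => subjectVar g N p q (X 0 z.1, design T ε i z.2) ^ 2)
      (P.prod P) := by
    rw [integrable_prod_iff (hV2.pow_const 2).aestronglyMeasurable]
    refine ⟨hcond.mono fun ω hω => hω.1, ?_⟩
    refine (hint.const_mul 64).mono'
      ((hV2.pow_const 2).norm.stronglyMeasurable.integral_prod_right').aestronglyMeasurable ?_
    filter_upwards [hcond] with ω hω
    rw [Real.norm_of_nonneg (integral_nonneg fun _ => norm_nonneg _)]
    simp_rw [Real.norm_of_nonneg (sq_nonneg _)]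
    exact hω.2.1
  have hmap := hm.map_path_design i
  have hM : MemLp (fun z : Ω × Ω => subjectVar g N p q (X 0 z.1, design T ε i z.2)) 2 (P.prod P) :=
    (memLp_two_iff_integrable_sq hV2.aestronglyMeasurable).2 hI2
  have hI1 := hM.integrable (q := 2) (by norm_num)
  -- Transfer to the product space, where the path of subject i is replaced by an identically
  -- distributed copy of `X 0`.
  have htr : ∀ f : (I → ℝ) × ((ℕ → I) × (ℕ → ℝ)) → ℝ, Measurable f →
      ∫ ω, f (X i ω, design T ε i ω) ∂P = ∫ z, f (X 0 z.1, design T ε i z.2) ∂(P.prod P) := by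
    intro f hf
    rw [← integral_map hXd.aemeasurable hf.aestronglyMeasurable, hmap,
      integral_map hXd2.aemeasurable hf.aestronglyMeasurable]
  refine ⟨?_, ?_, ?_⟩
  · have h1 : MemLp (subjectVar g N p q) 2
        ((P.prod P).map fun z => (X 0 z.1, design T ε i z.2)) :=
      (memLp_map_measure_iff hV.aestronglyMeasurable hXd2.aemeasurable).2 hM
    rw [← hmap] at h1
    exact (memLp_map_measure_iff hV.aestronglyMeasurable hXd.aemeasurable).1 h1
  · rw [htr (fun z => subjectVar g N p q z ^ 2) (hV.pow_const 2), integral_prod _ hI2,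
      ← integral_const_mul]
    refine integral_mono_ae hI2.integral_prod_left (hint.const_mul 64) ?_
    exact hcond.mono fun ω hω => hω.2.1
  · rw [htr _ hV, integral_prod _ hI1]
    exact integral_congr_ae (hcond.mono fun ω hω => hω.2.2)

/-- Mean squared error of an average of uncorrelated variables. -/
theorem integral_average_sub_sq_le [IsProbabilityMeasure P] {U : ℕ → Ω → ℝ} {m V : ℝ} (hU : ∀ i, MemLp (U i) 2 P)
    (hind : Pairwise fun i k => IndepFun (U i) (U k) P) (hm : ∀ i, ∫ ω, U i ω ∂P = m)
    (hV : ∀ i, ∫ ω, U i ω ^ 2 ∂P ≤ V) (q0 : ℝ) {n : ℕ} (hn : 1 ≤ n) :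
    Integrable (fun ω => (1 / (n : ℝ) * ∑ i ∈ range n, U i ω - q0) ^ 2) P ∧
    ∫ ω, (1 / (n : ℝ) * ∑ i ∈ range n, U i ω - q0) ^ 2 ∂P ≤ 1 / n * V + 2 * (m - q0) ^ 2 := by
  have hn0 : (1 : ℝ) ≤ n := by exact_mod_cast hn
  have hUq : ∀ i, MemLp (fun ω => U i ω - q0) 2 P := fun i => (hU i).sub (memLp_const q0)
  have h1 : ∀ ω, 1 / (n : ℝ) * ∑ i ∈ range n, U i ω - q0 =
      1 / (n : ℝ) * ∑ i ∈ range n, (U i ω - q0) := by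
    intro ω
    rw [Finset.sum_sub_distrib, Finset.sum_const, card_range, nsmul_eq_mul]
    field_simp
  -- E (U - q0)² = E U² - m² + (m - q0)².
  have hv : ∀ i, ∫ ω, (U i ω - q0) ^ 2 ∂P ≤ V + (m - q0) ^ 2 := by
    intro i
    have h2 : ∀ ω, (U i ω - q0) ^ 2 = U i ω ^ 2 - 2 * q0 * U i ω + q0 ^ 2 := fun ω => by ring
    have i1 := (hU i).integrable_sq
    have i2 := ((hU i).integrable (q := 2) (by norm_num)).const_mul (2 * q0)
    simp_rw [h2]
    have i12 : Integrable (fun ω => U i ω ^ 2 - 2 * q0 * U i ω) P := i1.sub i2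
    rw [integral_add i12 (integrable_const _), integral_sub i1 i2, integral_const_mul, hm]
    simp only [integral_const, probReal_univ, one_smul]
    nlinarith [hV i, sq_nonneg m]
  have h3 := integral_sum_sq_le hUq (fun i k hik => (hind hik).comp (φ := fun x => x - q0)
    (ψ := fun x => x - q0) (by fun_prop) (by fun_prop)) (α := m - q0)
    (fun i => by
      rw [integral_sub ((hU i).integrable (by norm_num)) (integrable_const _), hm]; simp) hv (range n)
  simp_rw [h1, mul_pow _ (Finset.sum _ _) 2]
  refine ⟨(memLp_finsetSum _ fun i _ => hUq i).integrable_sq.const_mul _, ?_⟩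
  rw [integral_const_mul]
  rw [card_range] at h3
  calc _ ≤ (1 / (n : ℝ)) ^ 2 * (n * (V + (m - q0) ^ 2) + n ^ 2 * (m - q0) ^ 2) := by gcongr
    _ = 1 / n * V + (1 / n + 1) * (m - q0) ^ 2 := by field_simp; ring
    _ ≤ _ := by
      have : 1 / (n : ℝ) ≤ 1 := by
        rw [div_le_one (by linarith)]; exact hn0
      nlinarith [sq_nonneg (m - q0)]

end Subject

/-! ### Deterministic bounds for `pathMoment` -/

section Path

variable {C : I → I → ℝ} {lam : ℕ → ℝ} {φ : ℕ → ℝ → ℝ} {K : ℝ → ℝ} {h c B σ2 : ℝ} {x : I → ℝ}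

theorem integrable_sq_mul_sq_add {p : I → ℝ} {b : ℝ} (hp : Measurable p) (hpb : ∀ t, |p t| ≤ b)
    (hx2 : MemLp x 2) : Integrable fun t => p t ^ 2 * (x t ^ 2 + σ2) := by
  have h1 : Integrable fun t => x t ^ 2 + σ2 := hx2.integrable_sq.add (integrable_const _)
  refine h1.bdd_mul (c := b ^ 2) (hp.pow_const 2).aestronglyMeasurable
    (Filter.Eventually.of_forall fun t => ?_)
  rw [Real.norm_of_nonneg (sq_nonneg _), ← sq_abs]
  exact pow_le_pow_left₀ (abs_nonneg _) (hpb t) 2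

theorem integral_mul_sq_le {f g : I → ℝ} {b : ℝ} (hf : MemLp f 2)
    (hg : ∀ t, |g t| ≤ b) : (∫ t, f t * g t) ^ 2 ≤ b ^ 2 * ∫ t, f t ^ 2 := by
  have hb : 0 ≤ b := (abs_nonneg _).trans (hg 0)
  have h0 : 0 ≤ ∫ t, (f t - ∫ s, f s * g s) ^ 2 := integral_nonneg fun _ => sq_nonneg _
  have hfi : Integrable f := hf.integrable (by norm_num)
  have h1 : |∫ t, f t * g t| ≤ b * ∫ t, |f t| := by
    rw [← integral_const_mul, ← Real.norm_eq_abs]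
    refine norm_integral_le_of_norm_le (hfi.abs.const_mul b) (Filter.Eventually.of_forall fun t => ?_)
    rw [norm_mul, mul_comm]
    exact mul_le_mul_of_nonneg_right (hg t) (norm_nonneg _)
  have h2 : (∫ t, |f t|) ^ 2 ≤ ∫ t, f t ^ 2 := by
    have h3 : 0 ≤ ∫ t, (|f t| - ∫ s, |f s|) ^ 2 := integral_nonneg fun _ => sq_nonneg _
    set m := ∫ s, |f s| with hm
    have h4 : ∀ t, (|f t| - m) ^ 2 = f t ^ 2 - 2 * m * |f t| + m ^ 2 := fun t => by
      rw [sub_sq, sq_abs]; ring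
    have i1 := hf.integrable_sq
    have i2 := hfi.abs.const_mul (2 * m)
    have i12 : Integrable (fun t => f t ^ 2 - 2 * m * |f t|) := i1.sub i2
    simp_rw [h4] at h3
    rw [integral_add i12 (integrable_const _), integral_sub i1 i2, integral_const_mul, ← hm] at h3
    simp only [integral_const, probReal_univ, one_smul] at h3
    nlinarith
  calc (∫ t, f t * g t) ^ 2 ≤ (b * ∫ t, |f t|) ^ 2 := by
        rw [← sq_abs]
        exact pow_le_pow_left₀ (abs_nonneg _) h1 2
    _ = b ^ 2 * (∫ t, |f t|) ^ 2 := by ring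
    _ ≤ _ := mul_le_mul_of_nonneg_left h2 (sq_nonneg _)

/-- The coefficient ∫ x ψ_k is the score ∫ x φ_k plus an error controlled by the uniform distance of
ψ_k from φ_k; the sampling term only uses that ψ_k is bounded. -/
theorem pathMoment_smoothEigen_le (hs : SmoothEigenfunctions c φ) (hK : IsKernel K)
    (he : IsEigenExpansion C lam φ) (hB : SmoothBounds K φ c B) (hσ : 0 ≤ σ2) (hh : 0 < h)
    (hx2 : MemLp x 2) (N : ℕ) {k : ℕ} (hk : 1 ≤ k) :
    pathMoment N σ2 (smoothEigen K h φ k) x ≤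
      B ^ 2 * ((∫ t, x t ^ 2) + σ2) / N + 2 * (∫ t : I, x t * φ k t) ^ 2 +
        2 * (B * h ^ 2 * (k : ℝ) ^ c) ^ 2 * ∫ t, x t ^ 2 := by
  have hm := hs.measurable_smoothEigen hK hh hk
  have h1 : ∫ t, smoothEigen K h φ k t ^ 2 * (x t ^ 2 + σ2) ≤ B ^ 2 * ((∫ t, x t ^ 2) + σ2) := by
    calc _ ≤ ∫ t, B ^ 2 * (x t ^ 2 + σ2) := by
          refine integral_mono (integrable_sq_mul_sq_add hm (hB.abs_le k h hk hh) hx2)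
            ((hx2.integrable_sq.add (integrable_const _)).const_mul _) fun t => ?_
          refine mul_le_mul_of_nonneg_right ?_ (by positivity)
          rw [← sq_abs]
          exact pow_le_pow_left₀ (abs_nonneg _) (hB.abs_le k h hk hh t) 2
      _ = _ := by
          rw [integral_const_mul, integral_add hx2.integrable_sq (integrable_const _)]
          simp
  have h2 : (∫ t, x t * smoothEigen K h φ k t) ^ 2 ≤ 2 * (∫ t : I, x t * φ k t) ^ 2 +
        2 * (B * h ^ 2 * (k : ℝ) ^ c) ^ 2 * ∫ t, x t ^ 2 := by
    have i1 : Integrable fun t : I => x t * φ k t := hx2.integrable_mul (he.memLp k hk)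
    have i2 : Integrable fun t : I => x t * (smoothEigen K h φ k t - φ k t) :=
      hx2.integrable_mul ((hs.memLp_smoothEigen hK hh hk).sub (he.memLp k hk))
    have h3 : ∫ t, x t * smoothEigen K h φ k t =
        (∫ t : I, x t * φ k t) + ∫ t : I, x t * (smoothEigen K h φ k t - φ k t) := by
      rw [← integral_add i1 i2]
      congr 1
      funext t
      ring
    have h4 := integral_mul_sq_le hx2 (hB.sub_le k h hk hh)
    rw [h3]
    nlinarith [sq_nonneg ((∫ t : I, x t * φ k t) -
      ∫ t : I, x t * (smoothEigen K h φ k t - φ k t))]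
  unfold pathMoment
  have h5 : (∫ t, smoothEigen K h φ k t ^ 2 * (x t ^ 2 + σ2)) / N ≤
      B ^ 2 * ((∫ t, x t ^ 2) + σ2) / N := by gcongr
  linarith

/-- The part of a path that is orthogonal to the first `j` eigenfunctions. -/
noncomputable def pathTail (φ : ℕ → ℝ → ℝ) (j : ℕ) (x : I → ℝ) (t : I) : ℝ :=
  x t - ∑ r ∈ Finset.Icc 1 j, (∫ s : I, x s * φ r s) * φ r t

theorem IsEigenExpansion.memLp_pathTail (he : IsEigenExpansion C lam φ) (hx2 : MemLp x 2) (j : ℕ) :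
    MemLp (pathTail φ j x) 2 :=
  hx2.sub (memLp_finsetSum _ fun r hr =>
    (he.memLp r (Finset.mem_Icc.1 hr).1).const_mul _)

theorem SmoothEigenfunctions.measurable_pathTail (hs : SmoothEigenfunctions c φ)
    (hx : Measurable x) (j : ℕ) : Measurable (pathTail φ j x) :=
  hx.sub (Finset.measurable_sum _ fun _ hr =>
    (hs.measurable (Finset.mem_Icc.1 hr).1).const_mul _)

theorem integral_pathTail_mul (he : IsEigenExpansion C lam φ) (hx2 : MemLp x 2) (j : ℕ)
    {g : I → ℝ} (hg : MemLp g 2) :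
    ∫ t, pathTail φ j x t * g t = (∫ t, x t * g t) -
      ∑ r ∈ Finset.Icc 1 j, (∫ s : I, x s * φ r s) * ∫ t : I, φ r t * g t := by
  have i1 : ∀ r ∈ Finset.Icc 1 j, Integrable fun t : I => (∫ s : I, x s * φ r s) * (φ r t * g t) :=
    fun r hr => Integrable.const_mul
      ((he.memLp r (Finset.mem_Icc.1 hr).1).integrable_mul hg : Integrable fun t : I => φ r t * g t) _
  have h1 : ∀ t : I, pathTail φ j x t * g t = x t * g t -
      ∑ r ∈ Finset.Icc 1 j, (∫ s : I, x s * φ r s) * (φ r t * g t) := by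
    intro t
    unfold pathTail
    rw [sub_mul, Finset.sum_mul]
    simp_rw [mul_assoc]
  have i2 : Integrable fun t => x t * g t := hx2.integrable_mul hg
  simp_rw [h1]
  rw [integral_sub i2 (integrable_finsetSum _ i1), integral_finsetSum _ i1]
  simp_rw [integral_const_mul]

/-- Parseval's identity: the coefficients of the remainder vanish up to j and agree with those of
the path beyond. -/
theorem IsEigenExpansion.hasSum_pathTail (he : IsEigenExpansion C lam φ) (hx2 : MemLp x 2) (j : ℕ) :
    HasSum (fun r : ℕ => (∫ t : I, x t * φ (j + 1 + r) t) ^ 2) (∫ t, pathTail φ j x t ^ 2) := by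
  have h1 := he.hasSum_sq (he.memLp_pathTail hx2 j)
  have hcoef : ∀ k, 1 ≤ k → ∫ t : I, pathTail φ j x t * φ k t =
      if k ≤ j then 0 else ∫ t : I, x t * φ k t := by
    intro k hk
    rw [integral_pathTail_mul he hx2 j (he.memLp k hk)]
    have h2 : ∀ r ∈ Finset.Icc 1 j, (∫ s : I, x s * φ r s) * ∫ t : I, φ r t * φ k t =
        if k = r then ∫ s : I, x s * φ k s else 0 := by
      intro r hr
      split_ifs with hkr
      · subst hkr
        simp_rw [← sq, he.norm_eq_one _ hk, mul_one]
      · rw [he.orthogonal r k (Finset.mem_Icc.1 hr).1 hk (fun hh => hkr hh.symm), mul_zero]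
    rw [Finset.sum_congr rfl h2, Finset.sum_ite_eq]
    simp only [Finset.mem_Icc, hk, true_and]
    split_ifs <;> simp
  have h2 := (hasSum_nat_add_iff' j).2 h1
  have h3 : ∑ i ∈ range j, (∫ t : I, pathTail φ j x t * φ (i + 1) t) ^ 2 = 0 := by
    refine Finset.sum_eq_zero fun i hi => ?_
    rw [Finset.mem_range] at hi
    rw [hcoef _ (by omega), if_pos (by omega)]
    simp
  rw [h3, sub_zero] at h2
  have h4 : ∀ r : ℕ, (∫ t : I, pathTail φ j x t * φ (r + j + 1 : ℕ) t) ^ 2 =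
      (∫ t : I, x t * φ (j + 1 + r) t) ^ 2 := by
    intro r
    rw [hcoef _ (by omega), if_neg (by omega), show r + j + 1 = j + 1 + r by ring]
  simpa only [h4] using h2

/-- Adding up the bounds for single k would not do, since these grow with k. The sum is kept
together so that Bessel's inequality can act on the pointwise sum of ψ_k², on the errors of the
first j eigenfunctions and on the smoothed remainder of the path. -/
theorem sum_pathMoment_smoothEigen_le (hs : SmoothEigenfunctions c φ) (hK : IsKernel K)
    (he : IsEigenExpansion C lam φ) (hB : SmoothBounds K φ c B) (hc : 0 ≤ c) (hσ : 0 ≤ σ2) (hh : 0 < h)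
    (hx : Measurable x) (hx2 : MemLp x 2) (N : ℕ) {j : ℕ} {s : Finset ℕ} {B' : ℝ}
    (hsj : ∀ k ∈ s, j < k) (hB' : ∀ t, ∑ k ∈ s, smoothEigen K h φ k t ^ 2 ≤ B' * h⁻¹) :
    ∑ k ∈ s, pathMoment N σ2 (smoothEigen K h φ k) x ≤
      B' * h⁻¹ * ((∫ t, x t ^ 2) + σ2) / N + 2 * (j * (B * h ^ 4 * (j : ℝ) ^ (2 * c))) * (∫ t, x t ^ 2)
        + 2 * ∫ t, pathTail φ j x t ^ 2 := by
  have hs1 : ∀ k ∈ s, 1 ≤ k := fun k hk => by have := hsj k hk; omega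
  have h1 : ∑ k ∈ s, (∫ t, smoothEigen K h φ k t ^ 2 * (x t ^ 2 + σ2)) ≤
      B' * h⁻¹ * ((∫ t, x t ^ 2) + σ2) := by
    have i1 : ∀ k ∈ s, Integrable fun t => smoothEigen K h φ k t ^ 2 * (x t ^ 2 + σ2) := fun k hk =>
      integrable_sq_mul_sq_add (hs.measurable_smoothEigen hK hh (hs1 k hk))
        (hB.abs_le k h (hs1 k hk) hh) hx2
    rw [← integral_finsetSum _ i1]
    calc _ ≤ ∫ t, B' * h⁻¹ * (x t ^ 2 + σ2) := by
          refine integral_mono (integrable_finsetSum _ i1)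
            ((hx2.integrable_sq.add (integrable_const _)).const_mul _) fun t => ?_
          simp only
          rw [← Finset.sum_mul]
          exact mul_le_mul_of_nonneg_right (hB' t) (by positivity)
      _ = _ := by
          rw [integral_const_mul, integral_add hx2.integrable_sq (integrable_const _)]
          simp
  have hq := he.memLp_pathTail hx2 j
  have hqm := hs.measurable_pathTail hx j
  have hqi : Integrable (pathTail φ j x) := hq.integrable (by norm_num)
  -- For r ≤ j < k the coefficient ⟨φ_r, ψ_k⟩ has no Kronecker term and reduces to a smoothing
  -- error. On the remainder, smoothing is moved from φ_k to the path.
  have h2 : ∀ k ∈ s, (∫ t, x t * smoothEigen K h φ k t) ^ 2 ≤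
      2 * (∑ r ∈ Finset.Icc 1 j, (∫ t : I, x t * φ r t) * smoothError K h φ r k) ^ 2 +
        2 * (∫ t : I, smooth K h (pathTail φ j x) t * φ k t) ^ 2 := by
    intro k hk
    have h3 := integral_pathTail_mul he hx2 j (hs.memLp_smoothEigen hK hh (hs1 k hk))
    have h4 : ∫ t, pathTail φ j x t * smoothEigen K h φ k t =
        ∫ t : I, smooth K h (pathTail φ j x) t * φ k t :=
      (hK.integral_smooth_mul hh hqi (hs.integrable (hs1 k hk))).symm
    have h5 : ∀ r ∈ Finset.Icc 1 j, (∫ s : I, x s * φ r s) * ∫ t : I, φ r t * smoothEigen K h φ k t =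
        (∫ t : I, x t * φ r t) * smoothError K h φ r k := by
      intro r hr
      have hr1 := (Finset.mem_Icc.1 hr).1
      have hr2 := (Finset.mem_Icc.1 hr).2
      have h6 := hs.integral_smoothEigen_mul hK he hh (hs1 k hk) hr1
      rw [if_neg (by have := hsj k hk; omega), zero_add,
        hs.smoothError_comm hK he hh (hs1 k hk) hr1] at h6
      rw [← h6]
      congr 2
      funext t
      ring
    rw [Finset.sum_congr rfl h5, h4] at h3
    have h7 : ∫ t, x t * smoothEigen K h φ k t =
        (∑ r ∈ Finset.Icc 1 j, (∫ t : I, x t * φ r t) * smoothError K h φ r k) +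
          ∫ t : I, smooth K h (pathTail φ j x) t * φ k t := by linarith
    rw [h7]
    nlinarith [sq_nonneg ((∑ r ∈ Finset.Icc 1 j, (∫ t : I, x t * φ r t) * smoothError K h φ r k) -
      ∫ t : I, smooth K h (pathTail φ j x) t * φ k t)]
  -- Bessel's inequality and the contractivity of smoothing in L².
  have h8 : ∑ k ∈ s, (∫ t : I, smooth K h (pathTail φ j x) t * φ k t) ^ 2 ≤
      ∫ t, pathTail φ j x t ^ 2 :=
    (he.sum_sq_le (hK.memLp_smooth hh hqm hqi) hs1).trans (hK.integral_smooth_sq_le hh hqm hq)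
  -- Cauchy–Schwarz in r. Each of the j rows r ≤ j then contributes at most B h⁴ j^{2c}, because c ≥
  -- 0.
  have h9 : ∑ k ∈ s, (∑ r ∈ Finset.Icc 1 j, (∫ t : I, x t * φ r t) * smoothError K h φ r k) ^ 2 ≤
      (j * (B * h ^ 4 * (j : ℝ) ^ (2 * c))) * ∫ t, x t ^ 2 := by
    calc _ ≤ ∑ k ∈ s, (∑ r ∈ Finset.Icc 1 j, (∫ t : I, x t * φ r t) ^ 2) *
          ∑ r ∈ Finset.Icc 1 j, smoothError K h φ r k ^ 2 :=
          Finset.sum_le_sum fun k _ => Finset.sum_mul_sq_le_sq_mul_sq _ _ _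
      _ = (∑ r ∈ Finset.Icc 1 j, (∫ t : I, x t * φ r t) ^ 2) *
          ∑ r ∈ Finset.Icc 1 j, ∑ k ∈ s, smoothError K h φ r k ^ 2 := by
          rw [← Finset.mul_sum, Finset.sum_comm]
      _ ≤ (∫ t, x t ^ 2) * (j * (B * h ^ 4 * (j : ℝ) ^ (2 * c))) := by
          refine mul_le_mul (he.sum_sq_le hx2 fun k hk => (Finset.mem_Icc.1 hk).1) ?_
            (Finset.sum_nonneg fun _ _ => Finset.sum_nonneg fun _ _ => sq_nonneg _)
            (integral_nonneg fun _ => sq_nonneg _)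
          have h10 : ∀ r ∈ Finset.Icc 1 j, ∑ k ∈ s, smoothError K h φ r k ^ 2 ≤
              B * h ^ 4 * (j : ℝ) ^ (2 * c) := by
            intro r hr
            have hr1 := (Finset.mem_Icc.1 hr).1
            have hr2 : (r : ℝ) ≤ j := by exact_mod_cast (Finset.mem_Icc.1 hr).2
            refine (hB.sum_error_sq_le r h s hr1 hh hs1).trans ?_
            have := hB.pos
            gcongr
          refine (Finset.sum_le_card_nsmul _ _ _ h10).trans (le_of_eq ?_)
          rw [Nat.card_Icc, nsmul_eq_mul]
          simp
      _ = _ := mul_comm _ _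
  unfold pathMoment
  rw [Finset.sum_add_distrib, ← Finset.sum_div]
  have h11 := Finset.sum_le_sum h2
  rw [Finset.sum_add_distrib, ← Finset.mul_sum, ← Finset.mul_sum] at h11
  have h12 : (∑ k ∈ s, ∫ t, smoothEigen K h φ k t ^ 2 * (x t ^ 2 + σ2)) / N ≤
      B' * h⁻¹ * ((∫ t, x t ^ 2) + σ2) / N := by gcongr
  linarith

end Path

/-! ### Calculus of L² norms -/

section L2Bound

variable {Ω : Type*} [MeasurableSpace Ω] {P : Measure Ω} {f g : Ω → ℝ} {b d : ℝ}

/-- `b` is a bound for the `L²` norm of `f`. -/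
structure L2Bound (P : Measure Ω) (f : Ω → ℝ) (b : ℝ) : Prop where
  nonneg : 0 ≤ b
  aesm : AEStronglyMeasurable f P
  le : eLpNorm f 2 P ≤ ENNReal.ofReal b

theorem L2Bound.memLp (hf : L2Bound P f b) : MemLp f 2 P :=
  ⟨hf.aesm, hf.le.trans_lt ENNReal.ofReal_lt_top⟩

theorem L2Bound.of_integral_le (hf : MemLp f 2 P) (hb : 0 ≤ b) (h : ∫ ω, f ω ^ 2 ∂P ≤ b ^ 2) :
    L2Bound P f b := by
  refine ⟨hb, hf.1, ?_⟩
  rw [hf.eLpNorm_eq_integral_rpow_norm (by norm_num) (by norm_num)]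
  refine ENNReal.ofReal_le_ofReal ?_
  simp only [ENNReal.toReal_ofNat, Real.rpow_ofNat, Real.norm_eq_abs, sq_abs]
  rw [← one_div, ← Real.sqrt_eq_rpow]
  exact Real.sqrt_le_iff.2 ⟨hb, h⟩

theorem L2Bound.add (hf : L2Bound P f b) (hg : L2Bound P g d) :
    L2Bound P (fun ω => f ω + g ω) (b + d) :=
  ⟨add_nonneg hf.nonneg hg.nonneg, hf.aesm.add hg.aesm, by
    rw [ENNReal.ofReal_add hf.nonneg hg.nonneg]
    exact (eLpNorm_add_le hf.aesm hg.aesm (by norm_num)).trans (add_le_add hf.le hg.le)⟩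

theorem L2Bound.const_mul (hf : L2Bound P f b) {c : ℝ} (hc : 0 ≤ c) :
    L2Bound P (fun ω => c * f ω) (c * b) :=
  ⟨mul_nonneg hc hf.nonneg, hf.aesm.const_mul c, by
    have h1 : (fun ω => c * f ω) = c • f := rfl
    rw [h1, eLpNorm_const_smul, Real.enorm_of_nonneg hc, ENNReal.ofReal_mul hc]
    gcongr
    exact hf.le⟩

theorem L2Bound.mono (hf : L2Bound P f b) (hg : AEStronglyMeasurable g P)
    (h : ∀ᵐ ω ∂P, 0 ≤ g ω ∧ g ω ≤ f ω) (hbd : b ≤ d) : L2Bound P g d := by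
  refine ⟨hf.nonneg.trans hbd, hg, ?_⟩
  refine le_trans (eLpNorm_mono_ae (h.mono fun ω hω => ?_))
    (hf.le.trans (ENNReal.ofReal_le_ofReal hbd))
  rw [Real.norm_of_nonneg hω.1, Real.norm_of_nonneg (hω.1.trans hω.2)]
  exact hω.2

theorem L2Bound.const [IsProbabilityMeasure P] {c : ℝ} (hc : 0 ≤ c) :
    L2Bound P (fun _ => c) c := by
  refine L2Bound.of_integral_le (memLp_const c) hc ?_
  simp

theorem L2Bound.integral_mul_le (hf : L2Bound P f b) (hg : L2Bound P g d) :
    Integrable (fun ω => f ω * g ω) P ∧ ∫ ω, f ω * g ω ∂P ≤ b * d := by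
  refine ⟨hf.memLp.integrable_mul hg.memLp, ?_⟩
  have h1 : ∫ ω, f ω * g ω ∂P = inner ℝ (hf.memLp.toLp f) (hg.memLp.toLp g) := by
    rw [L2.inner_def]
    refine integral_congr_ae ?_
    filter_upwards [hf.memLp.coeFn_toLp, hg.memLp.coeFn_toLp] with t h1 h2
    rw [h1, h2]
    simp [mul_comm]
  rw [h1]
  refine (real_inner_le_norm _ _).trans ?_
  rw [Lp.norm_toLp, Lp.norm_toLp]
  refine mul_le_mul ?_ ?_ ENNReal.toReal_nonneg hf.nonneg
  · exact ENNReal.toReal_le_of_le_ofReal hf.nonneg hf.le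
  · exact ENNReal.toReal_le_of_le_ofReal hg.nonneg hg.le

/-- Minkowski's inequality for a series. -/
theorem L2Bound.hasSum {F : ℕ → Ω → ℝ} {u : ℕ → ℝ} (hF : ∀ r, L2Bound P (F r) (u r))
    (hu : ∀ n, ∑ r ∈ range n, u r ≤ b) (hs : ∀ᵐ ω ∂P, HasSum (fun r => F r ω) (f ω)) :
    L2Bound P f b := by
  have hb : 0 ≤ b := by simpa using hu 0
  have hm : ∀ n, AEStronglyMeasurable (∑ r ∈ range n, F r) P := fun n =>
    Finset.aestronglyMeasurable_sum _ fun r _ => (hF r).aesm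
  have ht : ∀ᵐ ω ∂P, Filter.Tendsto (fun n => (∑ r ∈ range n, F r) ω) Filter.atTop
      (nhds (f ω)) := by
    filter_upwards [hs] with ω hω
    simpa using hω.tendsto_sum_nat
  refine ⟨hb, aestronglyMeasurable_of_tendsto_ae _ hm ht, ?_⟩
  -- Fatou's lemma; the partial sums are bounded by the triangle inequality.
  refine (Lp.eLpNorm_lim_le_liminf_eLpNorm hm f ht).trans ?_
  refine Filter.liminf_le_of_le (by isBoundedDefault) fun a ha => ?_
  obtain ⟨n, hn⟩ := ha.exists
  refine hn.trans ((eLpNorm_sum_le (fun r _ => (hF r).aesm) (by norm_num)).trans ?_)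
  refine (Finset.sum_le_sum fun r _ => (hF r).le).trans ?_
  rw [← ENNReal.ofReal_sum_of_nonneg fun r _ => (hF r).nonneg]
  exact ENNReal.ofReal_le_ofReal (hu n)

end L2Bound

/-! ### Tails of power series -/

section Rpow

/-- Tails of the series `∑ r ^ (-b)`. -/
theorem sum_range_rpow_neg_le {b : ℝ} (hb : 1 < b) {j : ℕ} (hj : 1 ≤ j) (n : ℕ) :
    ∑ r ∈ range n, ((j + 1 + r : ℕ) : ℝ) ^ (-b) ≤ (b - 1)⁻¹ * (j : ℝ) ^ (1 - b) := by
  have hj0 : (0 : ℝ) < j := by exact_mod_cast hj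
  have hanti : AntitoneOn (fun x : ℝ => x ^ (-b)) (Set.Icc (j : ℝ) (j + n)) := by
    intro x hx y hy hxy
    exact Real.rpow_le_rpow_of_nonpos (hj0.trans_le hx.1) hxy (by linarith)
  have h1 := hanti.sum_le_integral
  have h2 : ∑ r ∈ range n, ((j + 1 + r : ℕ) : ℝ) ^ (-b) =
      ∑ i ∈ range n, (fun x : ℝ => x ^ (-b)) ((j : ℝ) + ((i + 1 : ℕ) : ℝ)) := by
    refine Finset.sum_congr rfl fun i _ => ?_
    simp only
    congr 1
    push_cast
    ring
  rw [h2]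
  refine h1.trans ?_
  rw [integral_rpow (Or.inr ⟨by linarith, by
    rw [Set.uIcc_of_le (by linarith [Nat.cast_nonneg (α := ℝ) n])]
    intro h0
    linarith [h0.1]⟩)]
  -- The contribution of the upper end point of the comparison integral has a favourable sign and is
  -- dropped.
  have h3 : 0 ≤ ((j : ℝ) + n) ^ (-b + 1) := by positivity
  have h4 : (0 : ℝ) < b - 1 := by linarith
  rw [show -b + 1 = -(b - 1) by ring, show 1 - b = -(b - 1) by ring, div_neg, ← neg_div, neg_sub,
    inv_mul_eq_div]
  rw [show -b + 1 = -(b - 1) by ring] at h3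
  gcongr
  linarith

end Rpow

/-! ### L² norms of the path bounds -/

section Moments

variable {Ω : Type*} [MeasurableSpace Ω] {P : Measure Ω}
  {X : ℕ → Ω → I → ℝ} {T : ℕ → ℕ → Ω → I} {ε : ℕ → ℕ → Ω → ℝ}
  {lam : ℕ → ℝ} {φ : ℕ → ℝ → ℝ} {K : ℝ → ℝ} {a c B : ℝ}

theorem IsSamplingModel.measurable_uncurry (hm : IsSamplingModel P X T ε) :
    Measurable fun z : Ω × I => X 0 z.1 z.2 := by
  obtain ⟨g, hg, hgX⟩ := hm.jointly_measurable_X 0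
  simp_rw [hgX]
  exact hg.comp (((hm.measurable_X 0).comp measurable_fst).prodMk measurable_snd)

theorem IsSamplingModel.measurable_path (hm : IsSamplingModel P X T ε) (ω : Ω) :
    Measurable (X 0 ω) := hm.measurable_uncurry.comp measurable_prodMk_left

theorem IsSamplingModel.measurable_integral_mul (hm : IsSamplingModel P X T ε) {p : I → ℝ}
    (hp : Measurable p) : Measurable fun ω => ∫ t, X 0 ω t * p t :=
  (hm.measurable_uncurry.mul (hp.comp measurable_snd)).stronglyMeasurable.integral_prod_right'.measurable

theorem IsSamplingModel.measurable_integral_sq (hm : IsSamplingModel P X T ε) :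
    Measurable fun ω => ∫ t, X 0 ω t ^ 2 :=
  (hm.measurable_uncurry.pow_const 2).stronglyMeasurable.integral_prod_right'.measurable

theorem IsSamplingModel.measurable_pathMoment (hm : IsSamplingModel P X T ε) (N : ℕ) (σ2 : ℝ)
    {p : I → ℝ} (hp : Measurable p) : Measurable fun ω => pathMoment N σ2 p (X 0 ω) := by
  unfold pathMoment
  refine Measurable.add (Measurable.div_const ?_ _) ((hm.measurable_integral_mul hp).pow_const 2)
  have h1 : Measurable fun z : Ω × I => p z.2 ^ 2 * (X 0 z.1 z.2 ^ 2 + σ2) :=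
    ((hp.comp measurable_snd).pow_const 2).mul ((hm.measurable_uncurry.pow_const 2).add_const _)
  exact h1.stronglyMeasurable.integral_prod_right'.measurable

/-- The squared L² norm of ξ_r² is the fourth moment of the score, which is at most a multiple of
λ_r². -/
theorem IsSamplingModel.exists_l2Bound_score_sq (hm : IsSamplingModel P X T ε)
    (he : IsEigenExpansion (covFun P (X 0)) lam φ) (hs : SmoothEigenfunctions c φ)
    (hmom : FourthMoments P (X 0) lam φ) (hd : PolynomialDecay a lam) :
    ∃ C : ℝ, 0 ≤ C ∧ ∀ r : ℕ, 1 ≤ r →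
      L2Bound P (fun ω => (∫ t : I, X 0 ω t * φ r t) ^ 2) (C * (r : ℝ) ^ (-a)) := by
  obtain ⟨A, hA⟩ := hmom.2
  obtain ⟨D, hD, hlam⟩ := hd
  refine ⟨√|A| * D, by positivity, fun r hr => ?_⟩
  obtain ⟨h1, h2⟩ := hA r hr
  have hmeas := hm.measurable_integral_mul (hs.measurable hr)
  have h3 : ∀ ω, ((∫ t : I, X 0 ω t * φ r t) ^ 2) ^ 2 = score (X 0) φ r ω ^ 4 := fun ω => by
    rw [← pow_mul]; rfl
  refine L2Bound.of_integral_le ((memLp_two_iff_integrable_sq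
    (hmeas.pow_const 2).aestronglyMeasurable).2 ?_) (by positivity) ?_
  · simp_rw [h3]
    exact h1
  · simp_rw [h3]
    refine h2.trans ?_
    rw [mul_assoc, mul_pow, Real.sq_sqrt (abs_nonneg _)]
    refine mul_le_mul (le_abs_self A) ?_ (sq_nonneg _) (abs_nonneg _)
    exact pow_le_pow_left₀ (he.pos r hr).le (hlam r hr).1 2

variable [IsProbabilityMeasure P]

theorem IsSamplingModel.integrable_pow_four (hm : IsSamplingModel P X T ε)
    (hmom : FourthMoments P (X 0) lam φ) :
    Integrable (fun z : Ω × I => X 0 z.1 z.2 ^ 4) (P.prod volume) := by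
  refine ⟨(hm.measurable_uncurry.pow_const 4).aestronglyMeasurable, ?_⟩
  unfold HasFiniteIntegral
  rw [lintegral_prod_symm _ (hm.measurable_uncurry.pow_const 4).enorm.aemeasurable]
  simp_rw [enorm_pow]
  exact hmom.1

theorem IsSamplingModel.ae_memLp (hm : IsSamplingModel P X T ε)
    (hmom : FourthMoments P (X 0) lam φ) :
    ∀ᵐ ω ∂P, MemLp (X 0 ω) 2 ∧ MemLp (fun t => X 0 ω t ^ 2) 2 := by
  filter_upwards [(hm.integrable_pow_four hmom).prod_right_ae] with ω hω
  have hx := hm.measurable_path ω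
  have h2 : MemLp (fun t => X 0 ω t ^ 2) 2 := by
    rw [memLp_two_iff_integrable_sq (hx.pow_const 2).aestronglyMeasurable]
    simp_rw [← pow_mul]
    exact hω
  refine ⟨?_, h2⟩
  rw [memLp_two_iff_integrable_sq hx.aestronglyMeasurable]
  exact h2.integrable (by norm_num)

theorem IsSamplingModel.exists_l2Bound_integral_sq (hm : IsSamplingModel P X T ε)
    (hmom : FourthMoments P (X 0) lam φ) :
    ∃ κ : ℝ, L2Bound P (fun ω => ∫ t, X 0 ω t ^ 2) κ := by
  have hI := hm.integrable_pow_four hmom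
  have hle : ∀ᵐ ω ∂P, (∫ t, X 0 ω t ^ 2) ^ 2 ≤ ∫ t, X 0 ω t ^ 4 := by
    filter_upwards [hm.ae_memLp hmom] with ω hω
    have h1 := integral_mul_sq_le hω.2 (g := fun _ => 1) (b := 1) (by simp)
    simp_rw [mul_one, ← pow_mul] at h1
    simpa using h1
  have hI2 : Integrable (fun ω => (∫ t, X 0 ω t ^ 2) ^ 2) P := by
    refine hI.integral_prod_left.mono' (hm.measurable_integral_sq.pow_const 2).aestronglyMeasurable ?_
    filter_upwards [hle] with ω hω
    rwa [Real.norm_of_nonneg (sq_nonneg _)]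
  refine ⟨√(∫ ω, (∫ t, X 0 ω t ^ 2) ^ 2 ∂P), L2Bound.of_integral_le
    ((memLp_two_iff_integrable_sq hm.measurable_integral_sq.aestronglyMeasurable).2 hI2)
    (Real.sqrt_nonneg _) ?_⟩
  rw [Real.sq_sqrt (integral_nonneg fun _ => sq_nonneg _)]

/-- The squared norm of the remainder is the series of ξ_r² over r > j. Minkowski's inequality
reduces its norm to ∑_{r > j} r^{-a}, of order j^{1-a}. -/
theorem IsSamplingModel.exists_l2Bound_pathTail (hm : IsSamplingModel P X T ε)
    (he : IsEigenExpansion (covFun P (X 0)) lam φ) (hs : SmoothEigenfunctions c φ)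
    (hmom : FourthMoments P (X 0) lam φ) (hd : PolynomialDecay a lam) (ha : 1 < a) :
    ∃ C : ℝ, 0 ≤ C ∧ ∀ j : ℕ, 1 ≤ j →
      L2Bound P (fun ω => ∫ t, pathTail φ j (X 0 ω) t ^ 2) (C * (j : ℝ) ^ (1 - a)) := by
  obtain ⟨C, hC, hb⟩ := hm.exists_l2Bound_score_sq he hs hmom hd
  have ha' : 0 < a - 1 := by linarith
  refine ⟨C * (a - 1)⁻¹, by positivity, fun j hj => ?_⟩
  refine L2Bound.hasSum (F := fun r ω => (∫ t : I, X 0 ω t * φ (j + 1 + r) t) ^ 2)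
    (u := fun r => C * ((j + 1 + r : ℕ) : ℝ) ^ (-a)) (fun r => hb _ (by omega)) (fun n => ?_) ?_
  · rw [← Finset.mul_sum, mul_assoc]
    exact mul_le_mul_of_nonneg_left (sum_range_rpow_neg_le ha hj n) hC
  · filter_upwards [hm.ae_memLp hmom] with ω hω
    exact he.hasSum_pathTail hω.1 j

/-- The condition on h is what makes the squared smoothing error, of order h⁴ k^{2c}, no larger than
the size k^{-a} of the squared score. -/
theorem IsSamplingModel.exists_l2Bound_pathMoment (hm : IsSamplingModel P X T ε)
    (he : IsEigenExpansion (covFun P (X 0)) lam φ) (hs : SmoothEigenfunctions c φ)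
    (hmom : FourthMoments P (X 0) lam φ) (hd : PolynomialDecay a lam) (hK : IsKernel K)
    (hB : SmoothBounds K φ c B) {σ2 : ℝ} (hσ : 0 ≤ σ2) {M : ℝ} (hM : 0 ≤ M) :
    ∃ C : ℝ, 0 ≤ C ∧ ∀ (N k : ℕ) (h : ℝ), 1 ≤ k → 0 < h →
      h ^ 4 * (k : ℝ) ^ (2 * c) ≤ M * (k : ℝ) ^ (-a) →
      L2Bound P (fun ω => pathMoment N σ2 (smoothEigen K h φ k) (X 0 ω))
        (C * (1 / N + (k : ℝ) ^ (-a))) := by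
  obtain ⟨κ, hκ⟩ := hm.exists_l2Bound_integral_sq hmom
  obtain ⟨D, hD, hξ⟩ := hm.exists_l2Bound_score_sq he hs hmom hd
  have hκ0 := hκ.nonneg
  refine ⟨B ^ 2 * (κ + σ2) + 2 * D + 2 * B ^ 2 * M * κ, by positivity, fun N k h hk hh hMk => ?_⟩
  have hk0 : (0 : ℝ) < k := by exact_mod_cast hk
  have hkc : ((k : ℝ) ^ c) ^ 2 = (k : ℝ) ^ (2 * c) := by
    rw [← Real.rpow_natCast, ← Real.rpow_mul hk0.le]
    congr 1; push_cast; ring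
  have hN : (0 : ℝ) ≤ 1 / N := by positivity
  have hka : (0 : ℝ) ≤ (k : ℝ) ^ (-a) := by positivity
  have h1 := (((hκ.add (L2Bound.const hσ)).const_mul (c := B ^ 2 / N) (by positivity)).add
    ((hξ k hk).const_mul (c := 2) (by norm_num))).add
    (hκ.const_mul (c := 2 * (B * h ^ 2 * (k : ℝ) ^ c) ^ 2) (by positivity))
  refine h1.mono (hm.measurable_pathMoment N σ2
    (hs.measurable_smoothEigen hK hh hk)).aestronglyMeasurable ?_ ?_
  · filter_upwards [hm.ae_memLp hmom] with ω hω
    refine ⟨pathMoment_nonneg hσ _ _, ?_⟩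
    refine (pathMoment_smoothEigen_le hs hK he hB hσ hh hω.1 N hk).trans (le_of_eq ?_)
    ring
  · have h2 : (B * h ^ 2 * (k : ℝ) ^ c) ^ 2 ≤ B ^ 2 * (M * (k : ℝ) ^ (-a)) := by
      calc _ = B ^ 2 * (h ^ 4 * (k : ℝ) ^ (2 * c)) := by rw [← hkc]; ring
        _ ≤ _ := by gcongr
    calc _ ≤ B ^ 2 / N * (κ + σ2) + 2 * (D * (k : ℝ) ^ (-a)) +
          2 * (B ^ 2 * (M * (k : ℝ) ^ (-a))) * κ := by gcongr
      _ = (B ^ 2 * (κ + σ2)) * (1 / N) + (2 * D + 2 * B ^ 2 * M * κ) * (k : ℝ) ^ (-a) := by ring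
      _ ≤ (B ^ 2 * (κ + σ2) + 2 * D + 2 * B ^ 2 * M * κ) * (1 / N) +
          (B ^ 2 * (κ + σ2) + 2 * D + 2 * B ^ 2 * M * κ) * (k : ℝ) ^ (-a) := by
        gcongr
        · have : 0 ≤ 2 * D + 2 * B ^ 2 * M * κ := by positivity
          linarith
        · have : 0 ≤ B ^ 2 * (κ + σ2) := by positivity
          linarith
      _ = _ := by ring

/-- The j rows of smoothing errors contribute j h⁴ j^{2c}, which under the condition on h is of the
same order j^{1-a} as the remainder of the path. -/
theorem IsSamplingModel.exists_l2Bound_sum_pathMoment (hm : IsSamplingModel P X T ε)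
    (he : IsEigenExpansion (covFun P (X 0)) lam φ) (hs : SmoothEigenfunctions c φ)
    (hmom : FourthMoments P (X 0) lam φ) (hd : PolynomialDecay a lam) (ha : 1 < a) (hc : 0 ≤ c)
    (hK : IsKernel K) (hB : SmoothBounds K φ c B) {σ2 : ℝ} (hσ : 0 ≤ σ2) {M : ℝ} (hM : 0 ≤ M)
    (H : ℝ) :
    ∃ C : ℝ, 0 ≤ C ∧ ∀ (N j : ℕ) (h : ℝ) (s : Finset ℕ), 1 ≤ j → 0 < h → h ≤ H →
      (∀ k ∈ s, j < k) → h ^ 4 * (j : ℝ) ^ (2 * c) ≤ M * (j : ℝ) ^ (-a) →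
      L2Bound P (fun ω => ∑ k ∈ s, pathMoment N σ2 (smoothEigen K h φ k) (X 0 ω))
        (C * (h⁻¹ / N + (j : ℝ) ^ (1 - a))) := by
  obtain ⟨κ, hκ⟩ := hm.exists_l2Bound_integral_sq hmom
  obtain ⟨D, hD, hξ⟩ := hm.exists_l2Bound_pathTail he hs hmom hd ha
  obtain ⟨B', hB'0, hB'⟩ := he.exists_sum_smoothEigen_sq_le hK H
  have hκ0 := hκ.nonneg
  have hB0 := hB.pos
  refine ⟨B' * (κ + σ2) + 2 * B * M * κ + 2 * D, by positivity,
    fun N j h s hj hh hhH hsj hMj => ?_⟩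
  have hj0 : (0 : ℝ) < j := by exact_mod_cast hj
  have hs1 : ∀ k ∈ s, 1 ≤ k := fun k hk => by have := hsj k hk; omega
  have hN : (0 : ℝ) ≤ h⁻¹ / N := by positivity
  have hja : (0 : ℝ) ≤ (j : ℝ) ^ (1 - a) := by positivity
  have h1 := (((hκ.add (L2Bound.const hσ)).const_mul (c := B' * h⁻¹ / N) (by positivity)).add
    (hκ.const_mul (c := 2 * (j * (B * h ^ 4 * (j : ℝ) ^ (2 * c)))) (by positivity))).add
    ((hξ j hj).const_mul (c := 2) (by norm_num))
  refine h1.mono (Finset.measurable_sum s fun k hk => hm.measurable_pathMoment N σ2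
    (hs.measurable_smoothEigen hK hh (hs1 k hk))).aestronglyMeasurable ?_ ?_
  · filter_upwards [hm.ae_memLp hmom] with ω hω
    refine ⟨Finset.sum_nonneg fun k _ => pathMoment_nonneg hσ _ _, ?_⟩
    refine (sum_pathMoment_smoothEigen_le hs hK he hB hc hσ hh (hm.measurable_path ω) hω.1 N hsj
      (hB' h hh hhH s hs1)).trans (le_of_eq ?_)
    ring
  · have h2 : (j : ℝ) * (B * h ^ 4 * (j : ℝ) ^ (2 * c)) ≤ B * M * (j : ℝ) ^ (1 - a) := by
      have h3 : (j : ℝ) ^ (1 - a) = j * (j : ℝ) ^ (-a) := by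
        rw [sub_eq_add_neg, Real.rpow_add hj0, Real.rpow_one]
      calc _ = B * j * (h ^ 4 * (j : ℝ) ^ (2 * c)) := by ring
        _ ≤ B * j * (M * (j : ℝ) ^ (-a)) := by gcongr
        _ = _ := by rw [h3]; ring
    calc _ ≤ B' * h⁻¹ / N * (κ + σ2) + 2 * (B * M * (j : ℝ) ^ (1 - a)) * κ +
          2 * (D * (j : ℝ) ^ (1 - a)) := by gcongr
      _ = (B' * (κ + σ2)) * (h⁻¹ / N) + (2 * B * M * κ + 2 * D) * (j : ℝ) ^ (1 - a) := by ring
      _ ≤ (B' * (κ + σ2) + 2 * B * M * κ + 2 * D) * (h⁻¹ / N) +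
          (B' * (κ + σ2) + 2 * B * M * κ + 2 * D) * (j : ℝ) ^ (1 - a) := by
        gcongr
        · have : 0 ≤ 2 * B * M * κ + 2 * D := by positivity
          linarith
        · have : 0 ≤ B' * (κ + σ2) := by positivity
          linarith
      _ = _ := by ring

end Moments

/-! ### Mean of a subject's contribution -/

section Mean

variable {Ω : Type*} [MeasurableSpace Ω] {P : Measure Ω} [IsProbabilityMeasure P]
  {X : ℕ → Ω → I → ℝ} {T : ℕ → ℕ → Ω → I} {ε : ℕ → ℕ → Ω → ℝ}
  {lam : ℕ → ℝ} {φ : ℕ → ℝ → ℝ}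

theorem IsSamplingModel.memLp_uncurry (hm : IsSamplingModel P X T ε)
    (hmom : FourthMoments P (X 0) lam φ) :
    MemLp (fun z : Ω × I => X 0 z.1 z.2) 2 (P.prod volume) := by
  rw [memLp_two_iff_integrable_sq hm.measurable_uncurry.aestronglyMeasurable]
  refine ((hm.integrable_pow_four hmom).add (integrable_const (1 : ℝ))).mono'
    (hm.measurable_uncurry.pow_const 2).aestronglyMeasurable (Filter.Eventually.of_forall fun z => ?_)
  rw [Real.norm_of_nonneg (sq_nonneg _), Pi.add_apply]
  nlinarith [sq_nonneg (X 0 z.1 z.2 ^ 2 - 1), sq_nonneg (X 0 z.1 z.2)]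

theorem IsSamplingModel.memLp_integral_mul (hm : IsSamplingModel P X T ε)
    (hmom : FourthMoments P (X 0) lam φ) {p : I → ℝ} {b : ℝ} (hp : Measurable p)
    (hpb : ∀ t, |p t| ≤ b) : MemLp (fun ω => ∫ t, X 0 ω t * p t) 2 P := by
  have h0 := (hm.memLp_uncurry hmom).integrable_sq.integral_prod_left
  rw [memLp_two_iff_integrable_sq (hm.measurable_integral_mul hp).aestronglyMeasurable]
  refine (h0.const_mul (b ^ 2)).mono'
    ((hm.measurable_integral_mul hp).pow_const 2).aestronglyMeasurable ?_
  filter_upwards [hm.ae_memLp hmom] with ω hω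
  rw [Real.norm_of_nonneg (sq_nonneg _)]
  exact integral_mul_sq_le hω.1 hpb

theorem IsSamplingModel.integral_mul_eq_covFun (hm : IsSamplingModel P X T ε) (s t : I) :
    ∫ ω, X 0 ω s * X 0 ω t ∂P = covFun P (X 0) s t := by
  unfold covFun
  rw [covariance_eq_sub (hm.memLp_X s) (hm.memLp_X t), hm.mean_X s, zero_mul, sub_zero]
  rfl

/-- The mean of the product of two integrals of a path, by Fubini's theorem. -/
theorem IsSamplingModel.integral_integral_mul_integral (hm : IsSamplingModel P X T ε)
    (hmom : FourthMoments P (X 0) lam φ) {p q : I → ℝ} {b v : ℝ} (hp : Measurable p)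
    (hpb : ∀ t, |p t| ≤ b) (hq : Measurable q) (hqb : ∀ t, |q t| ≤ b)
    (hv : HasBilin (covFun P (X 0)) p q v) :
    ∫ ω, (∫ t, X 0 ω t * p t) * (∫ t, X 0 ω t * q t) ∂P = v := by
  have hX := hm.memLp_uncurry hmom
  -- Fubini's theorem is applied for fixed t and then once more in t, matching the iterated integral
  -- in `HasBilin`.
  have h1 : ∀ t, ∫ ω, (∫ s, X 0 ω s * p s) * X 0 ω t ∂P = ∫ s, covFun P (X 0) s t * p s := by
    intro t
    have i0 : Integrable (fun z : Ω × I => X 0 z.1 t * X 0 z.1 z.2) (P.prod volume) :=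
      ((hm.memLp_X t).comp_fst volume).integrable_mul hX
    have i1 : Integrable (fun z : Ω × I => X 0 z.1 t * X 0 z.1 z.2 * p z.2) (P.prod volume) :=
      i0.mul_bdd (c := b) (hp.comp measurable_snd).aestronglyMeasurable
        (Filter.Eventually.of_forall fun z => hpb z.2)
    calc ∫ ω, (∫ s, X 0 ω s * p s) * X 0 ω t ∂P
        = ∫ ω, (∫ s, X 0 ω t * X 0 ω s * p s) ∂P := by
          refine integral_congr_ae (Filter.Eventually.of_forall fun ω => ?_)
          simp only
          simp_rw [mul_assoc]
          rw [integral_const_mul, mul_comm]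
      _ = ∫ s, (∫ ω, X 0 ω t * X 0 ω s * p s ∂P) := integral_integral_swap i1
      _ = _ := by
          refine integral_congr_ae (Filter.Eventually.of_forall fun s => ?_)
          simp only
          rw [integral_mul_const, ← hm.integral_mul_eq_covFun s t]
          simp_rw [mul_comm]
  have j0 : Integrable (fun z : Ω × I => (∫ s, X 0 z.1 s * p s) * X 0 z.1 z.2) (P.prod volume) :=
    ((hm.memLp_integral_mul hmom hp hpb).comp_fst volume).integrable_mul hX
  have j1 : Integrable (fun z : Ω × I => (∫ s, X 0 z.1 s * p s) * X 0 z.1 z.2 * q z.2)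
      (P.prod volume) :=
    j0.mul_bdd (c := b) (hq.comp measurable_snd).aestronglyMeasurable
      (Filter.Eventually.of_forall fun z => hqb z.2)
  calc ∫ ω, (∫ t, X 0 ω t * p t) * (∫ t, X 0 ω t * q t) ∂P
      = ∫ ω, (∫ t, (∫ s, X 0 ω s * p s) * X 0 ω t * q t) ∂P := by
        refine integral_congr_ae (Filter.Eventually.of_forall fun ω => ?_)
        simp only
        simp_rw [mul_assoc]
        rw [integral_const_mul]
    _ = ∫ t, (∫ ω, (∫ s, X 0 ω s * p s) * X 0 ω t * q t ∂P) := integral_integral_swap j1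
    _ = ∫ t, (∫ s, covFun P (X 0) s t * p s) * q t := by
        refine integral_congr_ae (Filter.Eventually.of_forall fun t => ?_)
        simp only
        rw [integral_mul_const, h1]
    _ = v := hv.eq

end Mean

/-! ### Summability of the eigenvalues -/

section Decay

variable {lam : ℕ → ℝ} {a : ℝ} {C : I → I → ℝ} {φ : ℕ → ℝ → ℝ}

theorem IsEigenExpansion.summable (he : IsEigenExpansion C lam φ) (hd : PolynomialDecay a lam)
    (ha : 1 < a) : Summable fun k => lam (k + 1) := by
  obtain ⟨A, hA, hl⟩ := hd
  have h1 : Summable fun k : ℕ => A * ((k + 1 : ℕ) : ℝ) ^ (-a) :=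
    ((summable_nat_add_iff 1).2 (Real.summable_nat_rpow.2 (by linarith))).mul_left A
  exact Summable.of_nonneg_of_le (fun k => (he.pos _ (by omega)).le)
    (fun k => (hl (k + 1) (by omega)).1) h1

end Decay

/-! ### Bias caused by smoothing -/

section Bias

variable {C : I → I → ℝ} {lam : ℕ → ℝ} {φ : ℕ → ℝ → ℝ} {K : ℝ → ℝ} {a c B D h M : ℝ} {j k : ℕ}

/-- The bias that smoothing causes in the coefficient of the covariance function at `φ_j, φ_k`. -/
noncomputable def smoothBias (lam : ℕ → ℝ) (K : ℝ → ℝ) (h : ℝ) (φ : ℕ → ℝ → ℝ) (j k : ℕ) : ℝ :=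
  (lam j + lam k) * smoothError K h φ j k +
    ∑' r : ℕ, lam (r + 1) * (smoothError K h φ j (r + 1) * smoothError K h φ k (r + 1))

/-- Expansion of (δ_{jr} + e_{jr})(δ_{kr} + e_{kr}): the Kronecker product gives the unsmoothed
value w, the mixed terms pick out λ_j and λ_k, and the rest is the series in `smoothBias`. It
converges as a combination of convergent series. -/
theorem IsEigenExpansion.exists_hasBilin_smoothEigen (he : IsEigenExpansion C lam φ)
    (hs : SmoothEigenfunctions c φ) (hlam : Summable fun k => lam (k + 1)) (hK : IsKernel K)
    (hB : SmoothBounds K φ c B) (hh : 0 < h) (hj : 1 ≤ j) (hk : 1 ≤ k) :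
    ∃ w, HasBilin C (fun t => φ j t) (fun t => φ k t) w ∧
      HasBilin C (smoothEigen K h φ j) (smoothEigen K h φ k) (w + smoothBias lam K h φ j k) ∧
      HasSum (fun r : ℕ => lam (r + 1) *
        (smoothError K h φ j (r + 1) * smoothError K h φ k (r + 1)))
        (∑' r : ℕ, lam (r + 1) * (smoothError K h φ j (r + 1) * smoothError K h φ k (r + 1))) := by
  obtain ⟨b, hb⟩ := hs.bounded
  obtain ⟨w, hw, hw'⟩ := he.hasBilin hs hlam (hs.measurable hj) (hb j hj) (hs.measurable hk) (hb k hk)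
  obtain ⟨v, hv, hv'⟩ := he.hasBilin hs hlam (hs.measurable_smoothEigen hK hh hj)
    (hB.abs_le j h hj hh) (hs.measurable_smoothEigen hK hh hk) (hB.abs_le k h hk hh)
  have hδ : ∀ i r, 1 ≤ i → 1 ≤ r → ∫ t : I, φ i t * φ r t = if i = r then 1 else 0 := by
    intro i r hi hr
    split_ifs with hir
    · subst hir
      simp_rw [← sq, he.norm_eq_one _ hi]
    · exact he.orthogonal i r hi hr hir
  have hsingle : ∀ i l, 1 ≤ i → HasSum (fun r : ℕ => lam (r + 1) *
      ((if i = r + 1 then 1 else 0) * smoothError K h φ l (r + 1)))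
      (lam i * smoothError K h φ l i) := by
    intro i l hi
    obtain ⟨i, rfl⟩ := Nat.exists_eq_add_of_le' hi
    have h1 := hasSum_single (f := fun r : ℕ => lam (r + 1) *
      ((if i + 1 = r + 1 then 1 else 0) * smoothError K h φ l (r + 1))) i (fun r hr => by
        rw [if_neg (by omega)]
        ring)
    simpa using h1
  have h1 := ((hv'.sub hw').sub (hsingle j k hj)).sub (hsingle k j hk)
  have h2 : ∀ r : ℕ, lam (r + 1) * ((∫ t : I, smoothEigen K h φ j t * φ (r + 1) t) *
        ∫ t : I, smoothEigen K h φ k t * φ (r + 1) t) -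
      lam (r + 1) * ((∫ t : I, φ j t * φ (r + 1) t) * ∫ t : I, φ k t * φ (r + 1) t) -
      lam (r + 1) * ((if j = r + 1 then 1 else 0) * smoothError K h φ k (r + 1)) -
      lam (r + 1) * ((if k = r + 1 then 1 else 0) * smoothError K h φ j (r + 1)) =
      lam (r + 1) * (smoothError K h φ j (r + 1) * smoothError K h φ k (r + 1)) := by
    intro r
    rw [hs.integral_smoothEigen_mul hK he hh hj (by omega),
      hs.integral_smoothEigen_mul hK he hh hk (by omega), hδ j _ hj (by omega),
      hδ k _ hk (by omega)]
    ring
  simp only [h2] at h1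
  refine ⟨w, hw, ?_, ?_⟩
  · have h3 : w + smoothBias lam K h φ j k = v := by
      unfold smoothBias
      rw [h1.tsum_eq, hs.smoothError_comm hK he hh hk hj]
      ring
    rw [h3]
    exact hv
  · rw [h1.tsum_eq]
    exact h1

theorem SmoothBounds.sum_range_error_sq_le (hB : SmoothBounds K φ c B) (hj : 1 ≤ j) (hh : 0 < h)
    (n : ℕ) : ∑ r ∈ range n, smoothError K h φ j (r + 1) ^ 2 ≤ B * h ^ 4 * (j : ℝ) ^ (2 * c) := by
  have h1 := hB.sum_error_sq_le j h ((range n).map (addRightEmbedding 1)) hj hh (fun k hk => by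
    obtain ⟨r, -, rfl⟩ := Finset.mem_map.1 hk
    simp)
  simpa using h1

/-- Cauchy–Schwarz on partial sums, then passage to the limit. -/
theorem SmoothBounds.sq_tsum_le (hB : SmoothBounds K φ c B) (hj : 1 ≤ j) (hh : 0 < h) {S L : ℝ}
    (hS : HasSum (fun r : ℕ => lam (r + 1) *
        (smoothError K h φ j (r + 1) * smoothError K h φ k (r + 1))) S)
    (hL : ∀ n, ∑ r ∈ range n, (lam (r + 1) * smoothError K h φ k (r + 1)) ^ 2 ≤ L) :
    S ^ 2 ≤ B * h ^ 4 * (j : ℝ) ^ (2 * c) * L := by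
  have hB0 := hB.pos
  have hL0 : 0 ≤ L := by simpa using hL 0
  refine le_of_tendsto' (hS.tendsto_sum_nat.pow 2) fun n => ?_
  have h1 : ∑ r ∈ range n, lam (r + 1) *
      (smoothError K h φ j (r + 1) * smoothError K h φ k (r + 1)) =
      ∑ r ∈ range n, smoothError K h φ j (r + 1) * (lam (r + 1) * smoothError K h φ k (r + 1)) :=
    Finset.sum_congr rfl fun r _ => by ring
  rw [h1]
  refine (Finset.sum_mul_sq_le_sq_mul_sq _ _ _).trans ?_
  exact mul_le_mul (hB.sum_range_error_sq_le hj hh n) (hL n)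
    (Finset.sum_nonneg fun _ _ => sq_nonneg _) (by positivity)

/-- Bias at the indices `k ≤ 2 j`. -/
theorem smoothBias_sq_le (he : IsEigenExpansion C lam φ) (hs : SmoothEigenfunctions c φ)
    (hK : IsKernel K) (hB : SmoothBounds K φ c B) (ha : 1 < a) (hD : 0 ≤ D)
    (hlam : ∀ r : ℕ, 1 ≤ r → lam r ≤ D * (r : ℝ) ^ (-a)) (hM : 0 ≤ M) (hh : 0 < h) (hj : 1 ≤ j)
    (hk : 1 ≤ k) (hkj : k ≤ 2 * j) (hMj : h ^ 4 * (j : ℝ) ^ (2 * a + 2 * c) ≤ M)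
    (hS : HasSum (fun r : ℕ => lam (r + 1) *
        (smoothError K h φ j (r + 1) * smoothError K h φ k (r + 1)))
        (∑' r : ℕ, lam (r + 1) * (smoothError K h φ j (r + 1) * smoothError K h φ k (r + 1)))) :
    smoothBias lam K h φ j k ^ 2 ≤
      2 * (4 * D ^ 2 * B ^ 2 + B ^ 2 * D ^ 2 * M) * (2 ^ a) ^ 2 *
        (h ^ 4 * (k : ℝ) ^ (2 * c - 2 * a)) := by
  have hj0 : (0 : ℝ) < j := by exact_mod_cast hj
  have hk0 : (0 : ℝ) < k := by exact_mod_cast hk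
  have hB0 := hB.pos
  have hsq : ∀ (x b : ℝ), 0 < x → (x ^ b) ^ 2 = x ^ (2 * b) := fun x b hx => by
    rw [← Real.rpow_natCast, ← Real.rpow_mul hx.le]
    congr 1; push_cast; ring
  -- From k ≤ 2j; this is the source of the factors 2^a.
  have hja : (j : ℝ) ^ (-a) ≤ 2 ^ a * (k : ℝ) ^ (-a) := by
    have h1 : (k : ℝ) ≤ 2 * j := by exact_mod_cast hkj
    calc (j : ℝ) ^ (-a) = 2 ^ a * (2 * (j : ℝ)) ^ (-a) := by
          rw [Real.mul_rpow (by norm_num) hj0.le, ← mul_assoc, ← Real.rpow_add (by norm_num)]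
          simp
      _ ≤ _ := by
          gcongr 2 ^ a * ?_
          exact Real.rpow_le_rpow_of_nonpos hk0 h1 (by linarith)
  have h2a : (1 : ℝ) ≤ 2 ^ a := Real.one_le_rpow (by norm_num) (by linarith)
  have hka0 : 0 ≤ (k : ℝ) ^ (-a) := by positivity
  have hlj : 0 ≤ lam j := (he.pos j hj).le
  have hlk : 0 ≤ lam k := (he.pos k hk).le
  have hl : lam j + lam k ≤ 2 * D * (2 ^ a * (k : ℝ) ^ (-a)) := by
    have h1 : lam j ≤ D * (2 ^ a * (k : ℝ) ^ (-a)) := (hlam j hj).trans (by gcongr)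
    have h2 : lam k ≤ D * (2 ^ a * (k : ℝ) ^ (-a)) :=
      (hlam k hk).trans (mul_le_mul_of_nonneg_left (le_mul_of_one_le_left hka0 h2a) hD)
    linarith
  -- Symmetry of the errors gives the factor k^c in place of j^c.
  have hE : smoothError K h φ j k ^ 2 ≤ (B * h ^ 2 * (k : ℝ) ^ c) ^ 2 := by
    rw [hs.smoothError_comm hK he hh hj hk, ← sq_abs]
    exact pow_le_pow_left₀ (abs_nonneg _) (hB.error_le k j h hk hj hh) 2
  have hlamD : ∀ r : ℕ, lam (r + 1) ^ 2 ≤ D ^ 2 := by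
    intro r
    refine pow_le_pow_left₀ (he.pos _ (by omega)).le ((hlam _ (by omega)).trans ?_) 2
    refine mul_le_of_le_one_right hD (Real.rpow_le_one_of_one_le_of_nonpos ?_ (by linarith))
    push_cast
    linarith [Nat.cast_nonneg (α := ℝ) r]
  have hS2 := hB.sq_tsum_le hj hh hS (L := D ^ 2 * (B * h ^ 4 * (k : ℝ) ^ (2 * c))) (fun n => by
    calc ∑ r ∈ range n, (lam (r + 1) * smoothError K h φ k (r + 1)) ^ 2
        ≤ ∑ r ∈ range n, D ^ 2 * smoothError K h φ k (r + 1) ^ 2 :=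
          Finset.sum_le_sum fun r _ => by
            rw [mul_pow]
            exact mul_le_mul_of_nonneg_right (hlamD r) (sq_nonneg _)
      _ ≤ _ := by
          rw [← Finset.mul_sum]
          exact mul_le_mul_of_nonneg_left (hB.sum_range_error_sq_le hk hh n) (sq_nonneg _))
  -- The bandwidth condition supplies the decay k^{-2a} that the quadratic term lacks, since there
  -- the eigenvalues are only bounded by a constant.
  have hMj2 : h ^ 4 * (j : ℝ) ^ (2 * c) ≤ M * (2 ^ a * (k : ℝ) ^ (-a)) ^ 2 := by
    calc h ^ 4 * (j : ℝ) ^ (2 * c) = h ^ 4 * (j : ℝ) ^ (2 * a + 2 * c) * ((j : ℝ) ^ (-a)) ^ 2 := by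
          rw [hsq _ _ hj0, mul_assoc, ← Real.rpow_add hj0]
          congr 2; ring
      _ ≤ _ := by gcongr
  have hkk : (k : ℝ) ^ (2 * c - 2 * a) = ((k : ℝ) ^ c) ^ 2 * ((k : ℝ) ^ (-a)) ^ 2 := by
    rw [hsq _ _ hk0, hsq _ _ hk0, ← Real.rpow_add hk0]
    congr 1; ring
  unfold smoothBias
  set S := ∑' r : ℕ, lam (r + 1) * (smoothError K h φ j (r + 1) * smoothError K h φ k (r + 1))
  have hT : ((lam j + lam k) * smoothError K h φ j k) ^ 2 ≤
      (2 * D * (2 ^ a * (k : ℝ) ^ (-a))) ^ 2 * (B * h ^ 2 * (k : ℝ) ^ c) ^ 2 := by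
    rw [mul_pow]
    gcongr
  have hS3 : S ^ 2 ≤ B * (M * (2 ^ a * (k : ℝ) ^ (-a)) ^ 2) *
      (D ^ 2 * (B * h ^ 4 * (k : ℝ) ^ (2 * c))) := by
    refine hS2.trans ?_
    rw [mul_assoc B]
    gcongr
  calc _ ≤ 2 * ((lam j + lam k) * smoothError K h φ j k) ^ 2 + 2 * S ^ 2 := by
        nlinarith [sq_nonneg ((lam j + lam k) * smoothError K h φ j k - S)]
    _ ≤ 2 * ((2 * D * (2 ^ a * (k : ℝ) ^ (-a))) ^ 2 * (B * h ^ 2 * (k : ℝ) ^ c) ^ 2) +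
        2 * (B * (M * (2 ^ a * (k : ℝ) ^ (-a)) ^ 2) *
          (D ^ 2 * (B * h ^ 4 * (k : ℝ) ^ (2 * c)))) := by linarith
    _ = _ := by
        rw [hkk, ← hsq _ _ hk0]
        ring

/-- Total bias at the indices `k > j`. -/
theorem sum_smoothBias_sq_le (he : IsEigenExpansion C lam φ) (hs : SmoothEigenfunctions c φ)
    (hK : IsKernel K) (hB : SmoothBounds K φ c B) (ha : 1 < a) (hc : 0 ≤ c)
    (hlam : ∀ r : ℕ, 1 ≤ r → lam r ≤ D * (r : ℝ) ^ (-a)) (hh : 0 < h) (hj : 1 ≤ j)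
    (hMj : h ^ 4 * (j : ℝ) ^ (2 * a + 2 * c) ≤ M)
    (hS : ∀ k, 1 ≤ k → HasSum (fun r : ℕ => lam (r + 1) *
        (smoothError K h φ j (r + 1) * smoothError K h φ k (r + 1)))
        (∑' r : ℕ, lam (r + 1) * (smoothError K h φ j (r + 1) * smoothError K h φ k (r + 1))))
    {s : Finset ℕ} (hsj : ∀ k ∈ s, j < k) :
    ∑ k ∈ s, smoothBias lam K h φ j k ^ 2 ≤
      2 * (4 * D ^ 2 * B + B * (D ^ 2 * B * M + D ^ 2 * B * (2 * a - 1)⁻¹)) *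
        (h ^ 4 * (j : ℝ) ^ (1 + 2 * c - 2 * a)) := by
  have hj1 : (1 : ℝ) ≤ j := by exact_mod_cast hj
  have hj0 : (0 : ℝ) < j := by linarith
  have hB0 := hB.pos
  have ha2 : 0 < 2 * a - 1 := by linarith
  have hs1 : ∀ k ∈ s, 1 ≤ k := fun k hk => by have := hsj k hk; omega
  have hsq : ∀ (x b : ℝ), 0 < x → (x ^ b) ^ 2 = x ^ (2 * b) := fun x b hx => by
    rw [← Real.rpow_natCast, ← Real.rpow_mul hx.le]
    congr 1; push_cast; ring
  have hlamsq : ∀ r : ℕ, 1 ≤ r → lam r ^ 2 ≤ D ^ 2 * (r : ℝ) ^ (-(2 * a)) := by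
    intro r hr
    have hr0 : (0 : ℝ) < r := by exact_mod_cast hr
    calc lam r ^ 2 ≤ (D * (r : ℝ) ^ (-a)) ^ 2 := pow_le_pow_left₀ (he.pos r hr).le (hlam r hr) 2
      _ = _ := by rw [mul_pow, hsq _ _ hr0]; congr 2; ring
  have hMj2 : h ^ 4 * (j : ℝ) ^ (2 * c) ≤ M * (j : ℝ) ^ (-(2 * a)) := by
    calc h ^ 4 * (j : ℝ) ^ (2 * c) =
          h ^ 4 * (j : ℝ) ^ (2 * a + 2 * c) * (j : ℝ) ^ (-(2 * a)) := by
          rw [mul_assoc, ← Real.rpow_add hj0]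
          congr 2; ring
      _ ≤ _ := by gcongr
  have hj12 : (j : ℝ) ^ (1 - 2 * a) = j * (j : ℝ) ^ (-(2 * a)) := by
    rw [sub_eq_add_neg, Real.rpow_add hj0, Real.rpow_one]
  have hjj : (j : ℝ) ^ (1 + 2 * c - 2 * a) = (j : ℝ) ^ (2 * c) * (j : ℝ) ^ (1 - 2 * a) := by
    rw [← Real.rpow_add hj0]
    congr 1; ring
  have hEsum : ∀ r, 1 ≤ r → ∑ k ∈ s, smoothError K h φ k r ^ 2 =
      ∑ k ∈ s, smoothError K h φ r k ^ 2 := fun r hr =>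
    Finset.sum_congr rfl fun k hk => by rw [hs.smoothError_comm hK he hh (hs1 k hk) hr]
  -- The rows are split at r = j. For r ≤ j each of the j rows of errors is at most B M j^{-2a} by
  -- the bandwidth condition. For r > j the error sums are only bounded, and the decay of λ_r² gives
  -- the tail j^{1-2a}.
  have hrow : ∀ n, ∑ r ∈ range n, lam (r + 1) ^ 2 * ∑ k ∈ s, smoothError K h φ k (r + 1) ^ 2 ≤
      (D ^ 2 * B * M + D ^ 2 * B * (2 * a - 1)⁻¹) * (j : ℝ) ^ (1 - 2 * a) := by
    intro n
    have hnn : ∀ r : ℕ, 0 ≤ lam (r + 1) ^ 2 * ∑ k ∈ s, smoothError K h φ k (r + 1) ^ 2 := fun r =>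
      mul_nonneg (sq_nonneg _) (Finset.sum_nonneg fun _ _ => sq_nonneg _)
    have h1 : ∑ r ∈ range j, lam (r + 1) ^ 2 * ∑ k ∈ s, smoothError K h φ k (r + 1) ^ 2 ≤
        D ^ 2 * B * M * (j : ℝ) ^ (1 - 2 * a) := by
      calc _ ≤ ∑ r ∈ range j, D ^ 2 * (B * (M * (j : ℝ) ^ (-(2 * a)))) := by
            refine Finset.sum_le_sum fun r hr => ?_
            have hr1 : (1 : ℝ) ≤ ((r + 1 : ℕ) : ℝ) := by exact_mod_cast (by omega : 1 ≤ r + 1)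
            have hrj : ((r + 1 : ℕ) : ℝ) ≤ j := by exact_mod_cast Finset.mem_range.1 hr
            refine mul_le_mul ?_ ?_ (Finset.sum_nonneg fun _ _ => sq_nonneg _) (sq_nonneg _)
            · refine (hlamsq _ (by omega)).trans (mul_le_of_le_one_right (sq_nonneg _) ?_)
              exact Real.rpow_le_one_of_one_le_of_nonpos hr1 (by linarith)
            · rw [hEsum _ (by omega)]
              refine (hB.sum_error_sq_le _ h s (by omega) hh hs1).trans ?_
              rw [mul_assoc]
              refine mul_le_mul_of_nonneg_left (le_trans ?_ hMj2) hB0.le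
              gcongr
        _ = _ := by
            rw [Finset.sum_const, card_range, nsmul_eq_mul, hj12]
            ring
    have h2 : ∑ r ∈ range n, lam (j + r + 1) ^ 2 *
        ∑ k ∈ s, smoothError K h φ k (j + r + 1) ^ 2 ≤
        D ^ 2 * B * (2 * a - 1)⁻¹ * (j : ℝ) ^ (1 - 2 * a) := by
      calc _ ≤ ∑ r ∈ range n, D ^ 2 * B * ((j + 1 + r : ℕ) : ℝ) ^ (-(2 * a)) := by
            refine Finset.sum_le_sum fun r hr => ?_
            rw [show j + r + 1 = j + 1 + r by ring, mul_right_comm]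
            refine mul_le_mul (hlamsq _ (by omega)) ?_ (Finset.sum_nonneg fun _ _ => sq_nonneg _)
              (by positivity)
            rw [hEsum _ (by omega)]
            exact hB.sum_error_sq_le_const _ h s (by omega) hh hs1
        _ ≤ _ := by
            rw [← Finset.mul_sum, mul_assoc _ (2 * a - 1)⁻¹]
            exact mul_le_mul_of_nonneg_left (sum_range_rpow_neg_le (by linarith) hj n)
              (by positivity)
    calc _ ≤ ∑ r ∈ range (j + n), lam (r + 1) ^ 2 * ∑ k ∈ s, smoothError K h φ k (r + 1) ^ 2 :=
          Finset.sum_le_sum_of_subset_of_nonneg (Finset.range_mono (by omega)) fun r _ _ => hnn r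
      _ ≤ _ := by
          rw [Finset.sum_range_add, add_mul]
          exact add_le_add h1 h2
  set S := fun k => ∑' r : ℕ, lam (r + 1) *
    (smoothError K h φ j (r + 1) * smoothError K h φ k (r + 1)) with hSdef
  have hSsum : ∑ k ∈ s, S k ^ 2 ≤ B * h ^ 4 * (j : ℝ) ^ (2 * c) *
      ((D ^ 2 * B * M + D ^ 2 * B * (2 * a - 1)⁻¹) * (j : ℝ) ^ (1 - 2 * a)) := by
    refine le_of_tendsto' (tendsto_finsetSum s fun k hk =>
      ((hS k (hs1 k hk)).tendsto_sum_nat.pow 2)) fun n => ?_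
    calc _ ≤ ∑ k ∈ s, (∑ r ∈ range n, smoothError K h φ j (r + 1) ^ 2) *
          ∑ r ∈ range n, (lam (r + 1) * smoothError K h φ k (r + 1)) ^ 2 := by
          refine Finset.sum_le_sum fun k _ => le_trans (le_of_eq ?_)
            (Finset.sum_mul_sq_le_sq_mul_sq _ _ _)
          congr 1
          exact Finset.sum_congr rfl fun r _ => by ring
      _ = (∑ r ∈ range n, smoothError K h φ j (r + 1) ^ 2) *
          ∑ r ∈ range n, lam (r + 1) ^ 2 * ∑ k ∈ s, smoothError K h φ k (r + 1) ^ 2 := by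
          rw [← Finset.mul_sum, Finset.sum_comm]
          simp_rw [mul_pow, Finset.mul_sum]
      _ ≤ _ := mul_le_mul (hB.sum_range_error_sq_le hj hh n) (hrow n)
          (Finset.sum_nonneg fun r _ => mul_nonneg (sq_nonneg _)
            (Finset.sum_nonneg fun _ _ => sq_nonneg _)) (by positivity)
  -- For k > j both eigenvalues are at most D j^{-a}. The last inequality gives away a factor j,
  -- which the quadratic term needs anyway.
  have hT : ∑ k ∈ s, ((lam j + lam k) * smoothError K h φ j k) ^ 2 ≤
      4 * D ^ 2 * B * (h ^ 4 * (j : ℝ) ^ (1 + 2 * c - 2 * a)) := by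
    calc _ ≤ ∑ k ∈ s, 4 * (D ^ 2 * (j : ℝ) ^ (-(2 * a))) * smoothError K h φ j k ^ 2 := by
          refine Finset.sum_le_sum fun k hk => ?_
          have hjk : (j : ℝ) ≤ k := by exact_mod_cast (hsj k hk).le
          rw [mul_pow]
          refine mul_le_mul_of_nonneg_right ?_ (sq_nonneg _)
          have h1 := hlamsq j hj
          have h2 : lam k ^ 2 ≤ D ^ 2 * (j : ℝ) ^ (-(2 * a)) := (hlamsq k (hs1 k hk)).trans
            (mul_le_mul_of_nonneg_left (Real.rpow_le_rpow_of_nonpos hj0 hjk (by linarith))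
              (sq_nonneg _))
          nlinarith [sq_nonneg (lam j - lam k)]
      _ ≤ 4 * (D ^ 2 * (j : ℝ) ^ (-(2 * a))) * (B * h ^ 4 * (j : ℝ) ^ (2 * c)) := by
          rw [← Finset.mul_sum]
          exact mul_le_mul_of_nonneg_left (hB.sum_error_sq_le j h s hj hh hs1) (by positivity)
      _ = 4 * D ^ 2 * B * (h ^ 4 * ((j : ℝ) ^ (2 * c) * (j : ℝ) ^ (-(2 * a)))) := by ring
      _ ≤ _ := by
          rw [hjj, hj12]
          gcongr
          exact le_mul_of_one_le_left (by positivity) hj1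
  calc _ ≤ ∑ k ∈ s, (2 * ((lam j + lam k) * smoothError K h φ j k) ^ 2 + 2 * S k ^ 2) := by
        refine Finset.sum_le_sum fun k _ => ?_
        have h1 : smoothBias lam K h φ j k = (lam j + lam k) * smoothError K h φ j k + S k := rfl
        rw [h1]
        nlinarith [sq_nonneg ((lam j + lam k) * smoothError K h φ j k - S k)]
    _ = 2 * ∑ k ∈ s, ((lam j + lam k) * smoothError K h φ j k) ^ 2 + 2 * ∑ k ∈ s, S k ^ 2 := by
        rw [Finset.sum_add_distrib, Finset.mul_sum, Finset.mul_sum]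
    _ ≤ 2 * (4 * D ^ 2 * B * (h ^ 4 * (j : ℝ) ^ (1 + 2 * c - 2 * a))) +
        2 * (B * h ^ 4 * (j : ℝ) ^ (2 * c) *
          ((D ^ 2 * B * M + D ^ 2 * B * (2 * a - 1)⁻¹) * (j : ℝ) ^ (1 - 2 * a))) := by linarith
    _ = _ := by
        rw [hjj]
        ring

end Bias

/-! ### Mean squared error of the coefficients -/

section ErrorCoeff

variable {Ω : Type*} [MeasurableSpace Ω] {P : Measure Ω} [IsProbabilityMeasure P]
  {X : ℕ → Ω → I → ℝ} {T : ℕ → ℕ → Ω → I} {ε : ℕ → ℕ → Ω → ℝ}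
  {lam : ℕ → ℝ} {φ : ℕ → ℝ → ℝ} {K : ℝ → ℝ} {a c B h : ℝ}

/-- Variance and squared bias of a coefficient of the estimation error. -/
theorem IsSamplingModel.integral_errorCoeff_sq_le (hm : IsSamplingModel P X T ε)
    (he : IsEigenExpansion (covFun P (X 0)) lam φ) (hs : SmoothEigenfunctions c φ)
    (hmom : FourthMoments P (X 0) lam φ) (hlam : Summable fun k => lam (k + 1)) (hK : IsKernel K)
    (hB : SmoothBounds K φ c B) {n N j k : ℕ} (hn : 1 ≤ n) (hN : 2 ≤ N) (hh : 0 < h) (hj : 1 ≤ j)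
    (hk : 1 ≤ k)
    (hint : Integrable (fun ω => pathMoment N (∫ ω, ε 0 0 ω ^ 2 ∂P) (smoothEigen K h φ j) (X 0 ω) *
      pathMoment N (∫ ω, ε 0 0 ω ^ 2 ∂P) (smoothEigen K h φ k) (X 0 ω)) P) :
    Integrable (fun ω => errorCoeff P K X T ε φ n N h j k ω ^ 2) P ∧
    ∫ ω, errorCoeff P K X T ε φ n N h j k ω ^ 2 ∂P ≤
      1 / n * (64 * ∫ ω, pathMoment N (∫ ω, ε 0 0 ω ^ 2 ∂P) (smoothEigen K h φ j) (X 0 ω) *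
        pathMoment N (∫ ω, ε 0 0 ω ^ 2 ∂P) (smoothEigen K h φ k) (X 0 ω) ∂P) +
      2 * smoothBias lam K h φ j k ^ 2 := by
  obtain ⟨g, hg, hg0⟩ := hm.jointly_measurable_X 0
  have hpj := hs.measurable_smoothEigen hK hh hj
  have hpk := hs.measurable_smoothEigen hK hh hk
  have hX2 : ∀ᵐ ω ∂P, MemLp (X 0 ω) 2 := (hm.ae_memLp hmom).mono fun ω hω => hω.1
  obtain ⟨w, hw, hwb, -⟩ := he.exists_hasBilin_smoothEigen hs hlam hK hB hh hj hk
  have hmean := hm.integral_integral_mul_integral hmom hpj (hB.abs_le j h hj hh) hpk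
    (hB.abs_le k h hk hh) hwb
  have hU := fun i => hm.subjectVar_moments i hg hg0 hpj (hB.abs_le j h hj hh) hpk
    (hB.abs_le k h hk hh) hX2 hN hint
  have hV := measurable_subjectVar hg N hpj hpk
  have hind : Pairwise fun i l => IndepFun
      (fun ω => subjectVar g N (smoothEigen K h φ j) (smoothEigen K h φ k) (X i ω, design T ε i ω))
      (fun ω => subjectVar g N (smoothEigen K h φ j) (smoothEigen K h φ k) (X l ω, design T ε l ω))
      P := fun i l hil => (hm.iIndepFun_design.indepFun hil).comp hV hV
  have hmain := integral_average_sub_sq_le (fun i => (hU i).1) hind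
    (fun i => (hU i).2.2.trans hmean) (fun i => (hU i).2.1) w hn
  -- The identity holds almost surely only, since all paths are evaluated through the functional g
  -- of `X 0`.
  have hae : ∀ᵐ ω ∂P, (1 / (n : ℝ) * ∑ i ∈ range n, subjectVar g N (smoothEigen K h φ j)
      (smoothEigen K h φ k) (X i ω, design T ε i ω) - w) ^ 2 =
      errorCoeff P K X T ε φ n N h j k ω ^ 2 := by
    filter_upwards [ae_all_iff.2 fun i => ae_all_iff.2 fun l => hm.ae_apply_eq hg hg0 i l] with ω hω
    have h1 := ((hK.hasBilin_covEstimator (X := X) (T := T) (ε := ε) hh (hs.integrable hj)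
      (hs.integrable hk) n N ω).sub hw).eq
    have h2 : errorCoeff P K X T ε φ n N h j k ω = _ := h1
    rw [h2]
    congr 3
    refine Finset.sum_congr rfl fun i _ => ?_
    unfold subjectVar design obs
    simp only [hω]
    rfl
  refine ⟨hmain.1.congr hae, ?_⟩
  rw [← integral_congr_ae hae]
  refine hmain.2.trans (le_of_eq ?_)
  ring

/-- The bandwidth condition in the form in which the moment bounds use it. -/
theorem bandwidth_le {M : ℝ} {j k : ℕ} (ha : 0 ≤ a) (hc : 0 ≤ c) (hj : 1 ≤ j) (hk : 1 ≤ k)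
    (hkj : k ≤ 2 * j) (hM : h ^ 4 * (j : ℝ) ^ (2 * a + 2 * c) ≤ M) :
    h ^ 4 * (k : ℝ) ^ (2 * c) ≤ 2 ^ (2 * a + 2 * c) * M * (k : ℝ) ^ (-a) := by
  have hk1 : (1 : ℝ) ≤ k := by exact_mod_cast hk
  have hk0 : (0 : ℝ) < k := by linarith
  have hkj' : (k : ℝ) ≤ 2 * j := by exact_mod_cast hkj
  calc h ^ 4 * (k : ℝ) ^ (2 * c)
      = h ^ 4 * ((k : ℝ) ^ (2 * a + 2 * c) * (k : ℝ) ^ (-(2 * a))) := by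
        rw [← Real.rpow_add hk0]
        congr 2; ring
    _ ≤ h ^ 4 * ((2 * (j : ℝ)) ^ (2 * a + 2 * c) * (k : ℝ) ^ (-a)) := by
        have h1 : (k : ℝ) ^ (-(2 * a)) ≤ (k : ℝ) ^ (-a) :=
          Real.rpow_le_rpow_of_exponent_le hk1 (by linarith)
        gcongr
    _ = 2 ^ (2 * a + 2 * c) * (h ^ 4 * (j : ℝ) ^ (2 * a + 2 * c)) * (k : ℝ) ^ (-a) := by
        rw [Real.mul_rpow (by norm_num) (Nat.cast_nonneg _)]
        ring
    _ ≤ _ := by gcongr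

/-- Cauchy–Schwarz over the paths multiplies the norm for j by the norm for k, or by the norm of the
whole sum over k > j. This accounts for the product form of the variance terms. -/
theorem IsSamplingModel.exists_integral_errorCoeff_sq_le (hm : IsSamplingModel P X T ε)
    (he : IsEigenExpansion (covFun P (X 0)) lam φ) (hs : SmoothEigenfunctions c φ)
    (hmom : FourthMoments P (X 0) lam φ) (hd : PolynomialDecay a lam) (ha : 1 < a) (hc : 0 ≤ c)
    (hK : IsKernel K) {M : ℝ} (hM : 0 ≤ M) :
    ∃ A : ℝ, 0 ≤ A ∧ ∀ (n N j : ℕ) (h : ℝ), 1 ≤ n → 2 ≤ N → 1 ≤ j → 0 < h →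
      h ^ 4 * (j : ℝ) ^ (2 * a + 2 * c) ≤ M →
      (∀ k : ℕ, 1 ≤ k → Integrable (fun ω => errorCoeff P K X T ε φ n N h j k ω ^ 2) P) ∧
      (∀ k : ℕ, 1 ≤ k → k ≤ 2 * j → ∫ ω, errorCoeff P K X T ε φ n N h j k ω ^ 2 ∂P ≤
        A * (1 / n * ((1 / N + (j : ℝ) ^ (-a)) * (1 / N + (k : ℝ) ^ (-a))) +
          h ^ 4 * (k : ℝ) ^ (2 * c - 2 * a))) ∧
      ∀ s : Finset ℕ, (∀ k ∈ s, j < k) →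
        ∑ k ∈ s, ∫ ω, errorCoeff P K X T ε φ n N h j k ω ^ 2 ∂P ≤
          A * (1 / n * ((1 / N + (j : ℝ) ^ (-a)) * (h⁻¹ / N + (j : ℝ) ^ (1 - a))) +
            h ^ 4 * (j : ℝ) ^ (1 + 2 * c - 2 * a)) := by
  obtain ⟨B, hB⟩ := hs.exists_smoothBounds hK he
  have hlam := he.summable hd ha
  have hσ : 0 ≤ ∫ ω, ε 0 0 ω ^ 2 ∂P := integral_nonneg fun _ => sq_nonneg _
  set σ2 := ∫ ω, ε 0 0 ω ^ 2 ∂P with hσ2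
  have hM1 : 0 ≤ 2 ^ (2 * a + 2 * c) * M := by positivity
  obtain ⟨C₁, hC₁, h1⟩ := hm.exists_l2Bound_pathMoment he hs hmom hd hK hB hσ hM1
  obtain ⟨C₂, hC₂, h2⟩ := hm.exists_l2Bound_sum_pathMoment he hs hmom hd ha hc hK hB hσ hM1 (M + 1)
  obtain ⟨D, hD, hdec⟩ := id hd
  have hlamD : ∀ r : ℕ, 1 ≤ r → lam r ≤ D * (r : ℝ) ^ (-a) := fun r hr => (hdec r hr).1
  have hB0 := hB.pos
  have ha2 : 0 ≤ (2 * a - 1)⁻¹ := inv_nonneg.2 (by linarith)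
  set b₁ := 2 * (4 * D ^ 2 * B ^ 2 + B ^ 2 * D ^ 2 * M) * (2 ^ a) ^ 2 with hb₁
  set b₂ := 2 * (4 * D ^ 2 * B + B * (D ^ 2 * B * M + D ^ 2 * B * (2 * a - 1)⁻¹)) with hb₂
  have hb₁0 : 0 ≤ b₁ := by positivity
  have hb₂0 : 0 ≤ b₂ := by positivity
  refine ⟨64 * C₁ ^ 2 + 64 * (C₁ * C₂) + 2 * b₁ + 2 * b₂, by positivity,
    fun n N j h hn hN hj hh hMj => ?_⟩
  have hj1 : (1 : ℝ) ≤ j := by exact_mod_cast hj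
  -- As j ≥ 1, the bandwidth condition forces h⁴ ≤ M, and a bandwidth beyond M + 1 ≥ 1 would satisfy
  -- h ≤ h⁴.
  have hhM : h ≤ M + 1 := by
    by_contra! hlt
    have h3 : (1 : ℝ) ≤ (j : ℝ) ^ (2 * a + 2 * c) := Real.one_le_rpow hj1 (by linarith)
    have h4 : h ^ 4 ≤ M := (le_mul_of_one_le_right (by positivity) h3).trans hMj
    have h5 : h ≤ h ^ 4 := le_self_pow₀ (by linarith) (by norm_num)
    linarith
  have hfj := h1 N j h hj hh (bandwidth_le (by linarith) hc hj hj (by omega) hMj)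
  have hint : ∀ k, 1 ≤ k → Integrable (fun ω => pathMoment N σ2 (smoothEigen K h φ j) (X 0 ω) *
      pathMoment N σ2 (smoothEigen K h φ k) (X 0 ω)) P := by
    intro k hk
    have hk0 : (0 : ℝ) < k := by exact_mod_cast hk
    -- For arbitrary k the bandwidth condition gives nothing, so the constant is chosen to depend on
    -- h and k. This is harmless because only integrability is extracted.
    obtain ⟨C₃, -, h3⟩ := hm.exists_l2Bound_pathMoment he hs hmom hd hK hB hσ
      (M := h ^ 4 * (k : ℝ) ^ (2 * c) * (k : ℝ) ^ a) (by positivity)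
    refine (hfj.integral_mul_le (h3 N k h hk hh (le_of_eq ?_))).1
    rw [mul_assoc _ ((k : ℝ) ^ a), ← Real.rpow_add hk0]
    simp
  have herr := fun k (hk : 1 ≤ k) =>
    hm.integral_errorCoeff_sq_le he hs hmom hlam hK hB hn hN hh hj hk (hint k hk)
  have hS := fun k (hk : 1 ≤ k) =>
    (he.exists_hasBilin_smoothEigen hs hlam hK hB hh hj hk).choose_spec.2.2
  have hN0 : (0 : ℝ) ≤ 1 / N := by positivity
  have hn0 : (0 : ℝ) ≤ 1 / n := by positivity
  refine ⟨fun k hk => (herr k hk).1, fun k hk hkj => ?_, fun s hsj => ?_⟩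
  · have hfk := h1 N k h hk hh (bandwidth_le (by linarith) hc hj hk hkj hMj)
    have hbias := smoothBias_sq_le he hs hK hB ha hD.le hlamD hM hh hj hk hkj hMj (hS k hk)
    rw [← hb₁] at hbias
    have hvar := (hfj.integral_mul_le hfk).2
    set V := 1 / (n : ℝ) * ((1 / N + (j : ℝ) ^ (-a)) * (1 / N + (k : ℝ) ^ (-a))) with hV
    set W := h ^ 4 * (k : ℝ) ^ (2 * c - 2 * a) with hW
    have hV0 : 0 ≤ V := by positivity
    have hW0 : 0 ≤ W := by positivity
    refine (herr k hk).2.trans ?_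
    calc _ ≤ 1 / (n : ℝ) * (64 * (C₁ * (1 / N + (j : ℝ) ^ (-a)) *
          (C₁ * (1 / N + (k : ℝ) ^ (-a))))) + 2 * (b₁ * W) := by gcongr
      _ = 64 * C₁ ^ 2 * V + 2 * b₁ * W := by rw [hV]; ring
      _ ≤ (64 * C₁ ^ 2 + 64 * (C₁ * C₂) + 2 * b₁ + 2 * b₂) * V +
          (64 * C₁ ^ 2 + 64 * (C₁ * C₂) + 2 * b₁ + 2 * b₂) * W := by
        gcongr
        · have : 0 ≤ 64 * (C₁ * C₂) + 2 * b₁ + 2 * b₂ := by positivity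
          linarith
        · have : 0 ≤ 64 * C₁ ^ 2 + 64 * (C₁ * C₂) + 2 * b₂ := by positivity
          linarith
      _ = _ := by ring
  · have hs1 : ∀ k ∈ s, 1 ≤ k := fun k hk => by have := hsj k hk; omega
    have hfs := h2 N j h s hj hh hhM hsj (bandwidth_le (by linarith) hc hj hj (by omega) hMj)
    have hbias := sum_smoothBias_sq_le he hs hK hB ha hc hlamD hh hj hMj hS hsj
    rw [← hb₂] at hbias
    -- One application of Cauchy–Schwarz to the sum over k, not one for each k.
    have hvar := (hfj.integral_mul_le hfs).2
    simp_rw [Finset.mul_sum] at hvar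
    rw [integral_finsetSum _ fun k hk => hint k (hs1 k hk)] at hvar
    set V := 1 / (n : ℝ) * ((1 / N + (j : ℝ) ^ (-a)) * (h⁻¹ / N + (j : ℝ) ^ (1 - a))) with hV
    set W := h ^ 4 * (j : ℝ) ^ (1 + 2 * c - 2 * a) with hW
    have hV0 : 0 ≤ V := by positivity
    have hW0 : 0 ≤ W := by positivity
    refine (Finset.sum_le_sum fun k hk => (herr k (hs1 k hk)).2).trans ?_
    rw [Finset.sum_add_distrib, ← Finset.mul_sum, ← Finset.mul_sum, ← Finset.mul_sum]
    calc _ ≤ 1 / (n : ℝ) * (64 * (C₁ * (1 / N + (j : ℝ) ^ (-a)) *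
          (C₂ * (h⁻¹ / N + (j : ℝ) ^ (1 - a))))) + 2 * (b₂ * W) := by gcongr
      _ = 64 * (C₁ * C₂) * V + 2 * b₂ * W := by rw [hV]; ring
      _ ≤ (64 * C₁ ^ 2 + 64 * (C₁ * C₂) + 2 * b₁ + 2 * b₂) * V +
          (64 * C₁ ^ 2 + 64 * (C₁ * C₂) + 2 * b₁ + 2 * b₂) * W := by
        gcongr
        · have : 0 ≤ 64 * C₁ ^ 2 + 2 * b₁ + 2 * b₂ := by positivity
          linarith
        · have : 0 ≤ 64 * C₁ ^ 2 + 64 * (C₁ * C₂) + 2 * b₁ := by positivity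
          linarith
      _ = _ := by ring

end ErrorCoeff

end DiscreteFPCA

/-! ### The main theorem -/

theorem theorem1 {Ω : Type*} [MeasurableSpace Ω] (P : Measure Ω) [IsProbabilityMeasure P]
    (X : ℕ → Ω → I → ℝ) (T : ℕ → ℕ → Ω → I) (ε : ℕ → ℕ → Ω → ℝ)
    (K : ℝ → ℝ) (lam : ℕ → ℝ) (φ : ℕ → ℝ → ℝ) (a c : ℝ) (ha : 1 < a) (hc : 0 < c)
    (hmodel : DiscreteFPCA.IsSamplingModel P X T ε)
    (heigen : DiscreteFPCA.IsEigenExpansion (DiscreteFPCA.covFun P (X 0)) lam φ)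
    (hmoment : DiscreteFPCA.FourthMoments P (X 0) lam φ)
    (hdecay : DiscreteFPCA.PolynomialDecay a lam)
    (hsmooth : DiscreteFPCA.SmoothEigenfunctions c φ)
    (hK : DiscreteFPCA.IsKernel K) (M : ℝ) :
    ∃ A : ℝ, 0 < A ∧ ∀ (n N j : ℕ) (h : ℝ), 1 ≤ n → 2 ≤ N → 1 ≤ j → 0 < h →
      h ^ 4 * (j : ℝ) ^ (2 * a + 2 * c) ≤ M →
      (∀ k : ℕ, 1 ≤ k →
        Integrable (fun ω => DiscreteFPCA.errorCoeff P K X T ε φ n N h j k ω ^ 2) P) ∧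
      (∀ k : ℕ, 1 ≤ k → k ≤ 2 * j →
        ∫ ω, DiscreteFPCA.errorCoeff P K X T ε φ n N h j k ω ^ 2 ∂P ≤
          A * (1 / (n : ℝ) * ((j : ℝ) ^ (-a) * (k : ℝ) ^ (-a)
              + ((j : ℝ) ^ (-a) + (k : ℝ) ^ (-a)) / N + 1 / (N : ℝ) ^ 2)
            + h ^ 4 * (k : ℝ) ^ (2 * c - 2 * a))) ∧
      Summable (fun m : ℕ =>
        ∫ ω, DiscreteFPCA.errorCoeff P K X T ε φ n N h j (j + 1 + m) ω ^ 2 ∂P) ∧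
      ∑' m : ℕ, ∫ ω, DiscreteFPCA.errorCoeff P K X T ε φ n N h j (j + 1 + m) ω ^ 2 ∂P ≤
        A * (1 / (n : ℝ) * ((j : ℝ) ^ (1 - 2 * a)
            + (h⁻¹ * (j : ℝ) ^ (-a) + (j : ℝ) ^ (1 - a)) / N + 1 / (h * (N : ℝ) ^ 2))
          + h ^ 4 * (j : ℝ) ^ (1 + 2 * c - 2 * a)) := by
  obtain ⟨A, hA, hb⟩ := hmodel.exists_integral_errorCoeff_sq_le heigen hsmooth hmoment hdecay ha hc.le
    hK (abs_nonneg M)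
  refine ⟨A + 1, by positivity, fun n N j h hn hN hj hh hMj => ?_⟩
  obtain ⟨h1, h2, h3⟩ := hb n N j h hn hN hj hh (hMj.trans (le_abs_self M))
  have hj0 : (0 : ℝ) < j := by exact_mod_cast hj
  -- A bound uniform over finite sets of nonnegative terms gives both convergence of the series and
  -- the bound for its sum.
  have hsum : ∀ u : Finset ℕ,
      ∑ m ∈ u, ∫ ω, DiscreteFPCA.errorCoeff P K X T ε φ n N h j (j + 1 + m) ω ^ 2 ∂P ≤
        (A + 1) * (1 / (n : ℝ) * ((j : ℝ) ^ (1 - 2 * a)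
            + (h⁻¹ * (j : ℝ) ^ (-a) + (j : ℝ) ^ (1 - a)) / N + 1 / (h * (N : ℝ) ^ 2))
          + h ^ 4 * (j : ℝ) ^ (1 + 2 * c - 2 * a)) := by
    intro u
    have h4 := h3 (u.map (addLeftEmbedding (j + 1))) (fun k hk => by
      obtain ⟨m, -, rfl⟩ := Finset.mem_map.1 hk
      simp only [addLeftEmbedding_apply]
      omega)
    rw [Finset.sum_map] at h4
    simp only [addLeftEmbedding_apply] at h4
    have h5 : (1 / (N : ℝ) + (j : ℝ) ^ (-a)) * (h⁻¹ / N + (j : ℝ) ^ (1 - a)) =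
        (j : ℝ) ^ (1 - 2 * a) + (h⁻¹ * (j : ℝ) ^ (-a) + (j : ℝ) ^ (1 - a)) / N +
          1 / (h * (N : ℝ) ^ 2) := by
      rw [show 1 - 2 * a = -a + (1 - a) by ring, Real.rpow_add hj0]
      field_simp
      ring
    rw [h5] at h4
    refine h4.trans (mul_le_mul_of_nonneg_right (by linarith) (by positivity))
  have hnn : ∀ m, 0 ≤ ∫ ω, DiscreteFPCA.errorCoeff P K X T ε φ n N h j (j + 1 + m) ω ^ 2 ∂P :=
    fun m => integral_nonneg fun _ => sq_nonneg _
  refine ⟨h1, fun k hk hkj => ?_, summable_of_sum_le hnn hsum, Real.tsum_le_of_sum_le hnn hsum⟩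
  have h5 : (1 / (N : ℝ) + (j : ℝ) ^ (-a)) * (1 / N + (k : ℝ) ^ (-a)) =
      (j : ℝ) ^ (-a) * (k : ℝ) ^ (-a) + ((j : ℝ) ^ (-a) + (k : ℝ) ^ (-a)) / N +
        1 / (N : ℝ) ^ 2 := by
    field_simp
    ring
  have h4 := h2 k hk hkj
  rw [h5] at h4
  exact h4.trans (mul_le_mul_of_nonneg_right (by linarith) (by positivity))
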